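/- \textbf{Setting.} Terms of the linear substitution calculus (LSC) are $t ::= x \mid \lambda x.t \mid t\,u \mid t[x{\leftarrow}u]$, modulo $\alpha$-equivalence ($\lambda x.t$ and $t[x{\leftarrow}u]$ bind $x$ in $t$); $\lambda$-terms are the terms without explicit substitutions. Shallow contexts are $C ::= \langle\cdot\rangle \mid \lambda x.C \mid C\,t \mid t\,C \mid C[x{\leftarrow}t]$ and substitution contexts are $L ::= \langle\cdot\rangle\mid L[x{\leftarrow}t]$. The size $|\cdot|$ is the number of constructors. Reduction is the closure by shallow contexts of $L\langle\lambda x.t\rangle u\to_{\mathtt{dB}} L\langle t[x{\leftarrow}u]\rangle$ and of $C\langle x\rangle[x{\leftarrow}u]\to_{\mathtt{ls}} C\langle u\rangle[x{\leftarrow}u]$ ($C$ not capturing $x$ nor the free variables of $u$, after $\alpha$-conversion). The position of a $\mathtt{dB}$-redex is the context around $L\langle\lambda x.t\rangle u$; the position of an $\mathtt{ls}$-redex is the whole context $E$ around the substituted occurrence, so that the step is $E\langle x\rangle\to E\langle r\rangle$, where $E=D\langle C[x{\leftarrow}r]\rangle$ for some $C$ not capturing $x$. The unfolding $t{\downarrow}$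 is the $\lambda$-term obtained by performing all explicit substitutions of $t$. The relative unfolding $t{\downarrow}_C$ is given by $t{\downarrow}_{\langle\cdot\rangle}=t{\downarrow}$, $t{\downarrow}_{\lambda x.C}=t{\downarrow}_{C u}=t{\downarrow}_{uC}=t{\downarrow}_C$ and $t{\downarrow}_{C[x\leftarrow u]}=t{\downarrow}_C\{x{\leftarrow}u{\downarrow}\}$ (with binders named apart). A redex is \emph{useful} if it is a $\mathtt{dB}$-redex or an $\mathtt{ls}$-redex $E\langle x\rangle\to E\langle r\rangle$ such that $r{\downarrow}_E$ contains a $\beta$-redex, or is an abstraction while $E$ is applicative, i.e. of the form $C\langle L\,t\rangle$. On positions, $C\prec_O D$ if $C$ is a proper prefix of $D$; $\prec_L$ is the closure by contexts of $C\,u\prec_L t\,D$ whenever $t=C\langle s\rangle$ and $u=D\langle s'\rangle$ for some $s,s'$; and $\prec_{LO}$ is the union of $\prec_O$ and $\prec_L$. The LOU strategy reduces, in a term $t$, the useful redex of $t$ whose position $\prec_{LO}$-precedes the positions of all other useful redexes of $t$ (if $t$ has a useful redex). A strategy $\leadsto$ on LSC terms is \emph{mechanisable} if it has the \emph{subterm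 property} (for every derivation $t\leadsto^* u$ and every $\mathtt{ls}$-step of $\leadsto$ from $u$, the duplicated term is a subterm of $t$, modulo $\alpha$) and the \emph{selection property} (given a term $u$, finding the position of the redex reduced by $\leadsto$ in $u$, or reporting that there is none, takes time polynomial in the size of $u$). \textbf{The algorithms.} Results are tuples $(n,b,V,W)$ with $n\in\{\mathsf{var}(x)\mid x \text{ a variable}\}\cup\{\mathsf{lam},\mathsf{app}\}$, $b$ a truth value, and $V,W$ finite sets of variables. Below, $(n_t,b_t,V_t,W_t)$ and $(n_u,b_u,V_u,W_u)$ denote the tuples computed for the components $t$ and $u$. On $\lambda$-terms, $\mathcal A_g$ is defined by $\mathcal A_g(x)=(\mathsf{var}(x),\mathsf{false},\emptyset,\{x\})$, $\mathcal A_g(\lambda x.t)=(\mathsf{lam},b_t,V_t-\{x\},W_t-\{x\})$, $\mathcal A_g(t\,u)=(\mathsf{app},\,b_t\vee b_u\vee(n_t=\mathsf{lam}),\,V_t\cup V_u\cup\{x\mid n_t=\mathsf{var}(x)\},\,W_t\cup W_u)$. On LSC terms, $\mathcal B_g$ is defined by the same clauses and $\mathcal B_g(t[x{\leftarrow}u])=(n,b,V,W)$,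 where $n=n_u$ if $n_t=\mathsf{var}(x)$ and $n=n_t$ otherwise; $b=b_t\vee(b_u\wedge x\in W_t)\vee(n_u=\mathsf{lam}\wedge x\in V_t)$; $V=(V_t-\{x\})\cup V'\cup\{y\mid n_u=\mathsf{var}(y)\wedge x\in V_t\}$ and $W=(W_t-\{x\})\cup W'$, with $V'=V_u$, $W'=W_u$ if $x\in W_t$, and $V'=W'=\emptyset$ otherwise. On pairs of an LSC term and a shallow context, $\mathcal C_g(t,\langle\cdot\rangle)=\mathcal B_g(t)$, $\mathcal C_g(t,\lambda x.C)=\mathcal C_g(t,C\,u)=\mathcal C_g(t,u\,C)=\mathcal C_g(t,C)$, and $\mathcal C_g(t,C[x{\leftarrow}u])$ is obtained from $\mathcal C_g(t,C)$ and $\mathcal B_g(u)$ exactly as $\mathcal B_g(t[x{\leftarrow}u])$ is obtained from $\mathcal B_g(t)$ and $\mathcal B_g(u)$. \textbf{Proposition.} The algorithms $\mathcal A_g$, $\mathcal B_g$, $\mathcal C_g$ all work in polynomial time: with finite sets represented by lists and one step charged for every recursive call, every element visited by a set operation and every other elementary operation, the number of steps of $\mathcal A_g(t)$ and $\mathcal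 B_g(t)$ is bounded by a polynomial in $|t|$, and that of $\mathcal C_g(t,C)$ by a polynomial in $|t|+|C|$; moreover the three algorithms can be implemented by Turing machines working in time polynomial in the length of the encoded input (Polish notation, binary de Bruijn indices for the variables). Hence there is a polynomial time Turing machine that tests, given a context $E$ and a term $s$, whether $E\langle s\rangle$ has a useful redex of position $E$. Consequently the LOU strategy has the selection property (with polynomial time Turing machines), and it is mechanisable. -/

import Mathlib

namespace LSC

/-! ### Terms

Terms are taken modulo α-equivalence: they are represented with de Bruijn indices. Under `d`
binders the indices `0, …, d-1` are the bound variables (innermost first) and `d + j` is the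
`j`-th free variable. -/

/-- Ordinary `λ`-terms. -/
inductive LTerm : Type
  | var : ℕ → LTerm
  | lam : LTerm → LTerm
  | app : LTerm → LTerm → LTerm
  deriving DecidableEq

/-- Terms of the linear substitution calculus. `es t u` is the explicit substitution `t[x←u]`:
it binds the index `0` in `t` and nothing in `u`. -/
inductive Term : Type
  | var : ℕ → Term
  | lam : Term → Term
  | app : Term → Term → Term
  | es : Term → Term → Term
  deriving DecidableEq

/-- Shallow contexts. `appL C u` is `C u`, `appR t C` is `t C`, and `es C u` is `C[x←u]`. -/
inductive Ctx : Type
  | hole : Ctx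
  | lam : Ctx → Ctx
  | appL : Ctx → Term → Ctx
  | appR : Term → Ctx → Ctx
  | es : Ctx → Term → Ctx
  deriving DecidableEq

/-- Substitution contexts `L ::= ⟨·⟩ | L[x←u]`. -/
inductive SubCtx : Type
  | hole : SubCtx
  | es : SubCtx → Term → SubCtx

/-- A renaming of variables pushed under a binder. -/
def liftRen (ρ : ℕ → ℕ) : ℕ → ℕ
  | 0 => 0
  | n + 1 => ρ n + 1

namespace LTerm

/-- The size (number of constructors). -/
def size : LTerm → ℕ
  | var _ => 1
  | lam t => t.size + 1
  | app t u => t.size + u.size + 1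

/-- Renaming of the free variables. -/
def rename : (ℕ → ℕ) → LTerm → LTerm
  | ρ, var n => var (ρ n)
  | ρ, lam t => lam (rename (liftRen ρ) t)
  | ρ, app t u => app (rename ρ t) (rename ρ u)

/-- `t` moved under `k` additional binders. -/
def shift (k : ℕ) (t : LTerm) : LTerm := t.rename (· + k)

/-- A simultaneous substitution pushed under a binder. -/
def liftSubst (σ : ℕ → LTerm) : ℕ → LTerm
  | 0 => var 0
  | n + 1 => (σ n).shift 1

/-- Capture-avoiding simultaneous substitution. -/
def subst : (ℕ → LTerm) → LTerm → LTerm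
  | σ, var n => σ n
  | σ, lam t => lam (subst (liftSubst σ) t)
  | σ, app t u => app (subst σ t) (subst σ u)

/-- The implicit substitution `t{x←u}` where `x` is the `k`-th binder around `t`, which is
removed, and `u` lives outside of the `k + 1` innermost binders. -/
def substAt (t : LTerm) (k : ℕ) (u : LTerm) : LTerm :=
  t.subst fun i => if i < k then var i else if i = k then u.shift k else var (i - 1)

/-- `t` is an abstraction. -/
def IsLam (t : LTerm) : Prop := ∃ r, t = lam r

/-- `t` contains a `β`-redex. -/
inductive HasBeta : LTerm → Prop
  | root (r u : LTerm) : HasBeta (app (lam r) u)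
  | lam {t : LTerm} : HasBeta t → HasBeta (lam t)
  | appL {t : LTerm} (u : LTerm) : HasBeta t → HasBeta (app t u)
  | appR (t : LTerm) {u : LTerm} : HasBeta u → HasBeta (app t u)

end LTerm

namespace Term

/-- The size (number of constructors). -/
def size : Term → ℕ
  | var _ => 1
  | lam t => t.size + 1
  | app t u => t.size + u.size + 1
  | es t u => t.size + u.size + 1

/-- Renaming of the free variables. -/
def rename : (ℕ → ℕ) → Term → Term
  | ρ, var n => var (ρ n)
  | ρ, lam t => lam (rename (liftRen ρ) t)
  | ρ, app t u => app (rename ρ t) (rename ρ u)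
  | ρ, es t u => es (rename (liftRen ρ) t) (rename ρ u)

/-- `t` moved under `k` additional binders. -/
def shift (k : ℕ) (t : Term) : Term := t.rename (· + k)

/-- `i` is a free variable of the term. -/
def Free : ℕ → Term → Prop
  | i, var n => i = n
  | i, lam t => Free (i + 1) t
  | i, app t u => Free i t ∨ Free i u
  | i, es t u => Free (i + 1) t ∨ Free i u

/-- The unfolding of a term: explicit substitutions are turned into implicit ones. -/
def unf : Term → LTerm
  | var n => .var n
  | lam t => .lam t.unf
  | app t u => .app t.unf u.unf
  | es t u => t.unf.substAt 0 u.unf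

/-- `SubAt t d s`: `s` occurs in `t` (anywhere, also inside explicit substitutions) in the scope
of `d` binders of `t`. -/
inductive SubAt : Term → ℕ → Term → Prop
  | refl (t : Term) : SubAt t 0 t
  | lam {t s : Term} {d : ℕ} : SubAt t d s → SubAt (lam t) (d + 1) s
  | appL {t s : Term} (u : Term) {d : ℕ} : SubAt t d s → SubAt (app t u) d s
  | appR (t : Term) {u s : Term} {d : ℕ} : SubAt u d s → SubAt (app t u) d s
  | esL {t s : Term} (u : Term) {d : ℕ} : SubAt t d s → SubAt (es t u) (d + 1) s
  | esR (t : Term) {u s : Term} {d : ℕ} : SubAt u d s → SubAt (es t u) d s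

/-- `r`, living in the scope of `d'` binders, is (modulo α-equivalence) a subterm of `t`: some
occurrence `r₀` of a subterm of `t`, in the scope of `d` binders of `t`, becomes `r` under an
injective renaming of its variables which maps variables bound in `t` to the `d'` local
variables and which fixes the variables that are free in `t`. -/
def IsSubterm (d' : ℕ) (r t : Term) : Prop :=
  ∃ (d : ℕ) (r₀ : Term) (ρ : ℕ → ℕ), SubAt t d r₀ ∧ r = r₀.rename ρ ∧
    Set.InjOn ρ {i | Free i r₀} ∧
    (∀ i, i < d → Free i r₀ → ρ i < d') ∧
    (∀ j, Free (d + j) r₀ → ρ (d + j) = d' + j)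

end Term

namespace SubCtx

/-- Plugging `L⟨t⟩`. -/
def plug : SubCtx → Term → Term
  | hole, t => t
  | es L u, t => .es (L.plug t) u

/-- The number of explicit substitutions of `L`. -/
def length : SubCtx → ℕ
  | hole => 0
  | es L _ => L.length + 1

/-- `L` as a shallow context. -/
def toCtx : SubCtx → Ctx
  | hole => .hole
  | es L u => .es L.toCtx u

end SubCtx

namespace Ctx

/-- The size (number of constructors). -/
def size : Ctx → ℕ
  | hole => 1
  | lam C => C.size + 1
  | appL C u => C.size + u.size + 1
  | appR t C => t.size + C.size + 1
  | es C u => C.size + u.size + 1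

/-- Plugging `C⟨t⟩` of a term (possibly capturing variables). -/
def plug : Ctx → Term → Term
  | hole, t => t
  | lam C, t => .lam (C.plug t)
  | appL C u, t => .app (C.plug t) u
  | appR r C, t => .app r (C.plug t)
  | es C u, t => .es (C.plug t) u

/-- Plugging `C⟨D⟩` of a context. -/
def comp : Ctx → Ctx → Ctx
  | hole, D => D
  | lam C, D => lam (C.comp D)
  | appL C u, D => appL (C.comp D) u
  | appR r C, D => appR r (C.comp D)
  | es C u, D => es (C.comp D) u

/-- The number of binders (abstractions and explicit substitutions) that scope over the hole. -/
def depth : Ctx → ℕ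
  | hole => 0
  | lam C => C.depth + 1
  | appL C _ => C.depth
  | appR _ C => C.depth
  | es C _ => C.depth + 1

/-- The number of abstractions that scope over the hole. -/
def lamDepth : Ctx → ℕ
  | hole => 0
  | lam C => C.lamDepth + 1
  | appL C _ => C.lamDepth
  | appR _ C => C.lamDepth
  | es C _ => C.lamDepth

/-- The prefix relation between contexts and terms: `C⟨s⟩ = t` for some `s`. -/
def PrefixOf (C : Ctx) (t : Term) : Prop := ∃ s, C.plug s = t

/-- Applicative contexts `C⟨L t⟩`. -/
def Applicative (A : Ctx) : Prop :=
  ∃ (C : Ctx) (L : SubCtx) (t : Term), A = C.comp (appL L.toCtx t)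

/-- The outside-in order. -/
inductive OutsideIn : Ctx → Ctx → Prop
  | root {C : Ctx} : C ≠ hole → OutsideIn hole C
  | closure (E : Ctx) {C D : Ctx} : OutsideIn C D → OutsideIn (E.comp C) (E.comp D)

/-- The left-to-right order. (On shallow contexts a hole never lies inside an explicit
substitution, so that only the application gives rise to a left and a right part.) -/
inductive LeftRight : Ctx → Ctx → Prop
  | app {C D : Ctx} {t u : Term} : C.PrefixOf t → D.PrefixOf u →
      LeftRight (appL C u) (appR t D)
  | closure (E : Ctx) {C D : Ctx} : LeftRight C D → LeftRight (E.comp C) (E.comp D)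

/-- The left-to-right outside-in order. -/
def LO (C D : Ctx) : Prop := OutsideIn C D ∨ LeftRight C D

end Ctx

/-- The unfolding of `t` in the context `C`. The abstractions of `C` are dropped by the relative
unfolding, so that their variables stay free in the result (as the indices `< C.lamDepth`), while
the explicit substitutions of `C` are performed. -/
def relUnf (t : Term) : Ctx → LTerm
  | .hole => t.unf
  | .lam C => relUnf t C
  | .appL C _ => relUnf t C
  | .appR _ C => relUnf t C
  | .es C u => (relUnf t C).substAt C.lamDepth u.unf

/-! ### Redexes, useful redexes and strategies -/

/-- `Contract E s s'`: the term `E⟨s⟩` has a redex of position `E`, whose reduction yields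
`E⟨s'⟩`. The two cases are
`L⟨λx.r⟩ u → L⟨r[x←u]⟩` (at any position `E`), and, in compact form, `E⟨x⟩ → E⟨u⟩`, where
`E = D⟨C[x←u]⟩` and `C` does not capture `x`. -/
inductive Contract : Ctx → Term → Term → Prop
  | dB (E : Ctx) (L : SubCtx) (r u : Term) :
      Contract E (.app (L.plug (.lam r)) u) (L.plug (.es r (u.shift L.length)))
  | ls (D C : Ctx) (u : Term) :
      Contract (D.comp (.es C u)) (.var C.depth) (u.shift (C.depth + 1))

/-- `UsefulRedex E s`: the term `E⟨s⟩` has a useful redex of position `E`, that is, either a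
`dB`-redex or a substitution redex `E⟨x⟩ → E⟨r⟩` such that the unfolding of `r` in `E` contains a
`β`-redex, or is an abstraction while `E` is applicative. -/
inductive UsefulRedex : Ctx → Term → Prop
  | dB (E : Ctx) (L : SubCtx) (r u : Term) : UsefulRedex E (.app (L.plug (.lam r)) u)
  | ls (D C : Ctx) (u : Term) (E : Ctx) (r : Term) :
      E = D.comp (.es C u) → r = u.shift (C.depth + 1) →
      ((relUnf r E).HasBeta ∨ ((relUnf r E).IsLam ∧ E.Applicative)) →
      UsefulRedex E (.var C.depth)

/-- The usefulness test, on a redex given as a position `E` and the expression `s` filling it: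
the answer is `true` iff `E⟨s⟩` has a useful redex of position `E`. -/
noncomputable def usefulTest (R : Ctx × Term) : Bool :=
  haveI := Classical.propDecidable (UsefulRedex R.1 R.2)
  decide (UsefulRedex R.1 R.2)

/-- A strategy on terms of the calculus: `X t E` says that `X` reduces the redex of `t` whose
position is `E`. -/
abbrev Strategy : Type := Term → Ctx → Prop

/-- One reduction step of a strategy. -/
def Strategy.Step (X : Strategy) (t t' : Term) : Prop :=
  ∃ (E : Ctx) (s s' : Term), X t E ∧ t = E.plug s ∧ t' = E.plug s' ∧ Contract E s s'

/-- The leftmost-outermost useful strategy: `E` is the position of a useful redex of `t` that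
precedes all other useful redexes of `t` in the left-to-right outside-in order. -/
def LOU : Strategy := fun t E =>
  ∃ s, E.plug s = t ∧ UsefulRedex E s ∧
    ∀ (E' : Ctx) (s' : Term), E'.plug s' = t → UsefulRedex E' s' → E' ≠ E → E.LO E'

/-! ### Encodings and polynomial time -/

/-- The alphabet used for the encodings of inputs and outputs. -/
inductive Tok : Type
  | bit : Bool → Tok
  | endm | var | lam | app | appL | appR | es | hole | some
  deriving DecidableEq, Fintype

/-- An encoding of the elements of a type as strings, which is prefix-free (in particular
injective). -/
structure Code (α : Type) where
  enc : α → List Tok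
  prefixFree : ∀ (a b : α) (l m : List Tok), enc a ++ l = enc b ++ m → a = b ∧ l = m

/-- The function `f` is computed by a Turing machine (with finitely many stacks) that runs in time
polynomial in the length of the encoded input. -/
def PolyTime {α β : Type} (ca : Code α) (cb : Code β) (f : α → β) : Prop :=
  Nonempty (Turing.TM2ComputableInPolyTime ca.enc cb.enc f)

/-- Binary notation (least significant digit first), followed by an end marker. -/
def encNat (n : ℕ) : List Tok := (Computability.encodeNat n).map Tok.bit ++ [Tok.endm]

theorem encNat_prefixFree (a b : ℕ) (l m : List Tok)
    (h : encNat a ++ l = encNat b ++ m) : a = b ∧ l = m := by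
  have key : ∀ (x y : List Bool), x.map Tok.bit ++ Tok.endm :: l = y.map Tok.bit ++ Tok.endm :: m →
      x = y ∧ l = m := by
    intro x
    induction x with
    | nil => intro y hy; cases y <;> simp_all
    | cons c x ih =>
      intro y hy
      cases y with
      | nil => simp at hy
      | cons d y =>
        simp only [List.map_cons, List.cons_append, List.cons.injEq, Tok.bit.injEq] at hy
        obtain ⟨h1, h2⟩ := ih y hy.2
        exact ⟨by rw [hy.1, h1], h2⟩
  have h' := key (Computability.encodeNat a) (Computability.encodeNat b) (by simpa [encNat] using h)
  refine ⟨?_, h'.2⟩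
  have := congrArg Computability.decodeNat h'.1
  simpa using this

/-- Truth values. -/
def boolCode : Code Bool where
  enc b := [Tok.bit b]
  prefixFree a b l m h := by simpa using h

/-- Polish notation of `λ`-terms. -/
def LTerm.enc : LTerm → List Tok
  | .var n => Tok.var :: encNat n
  | .lam t => Tok.lam :: t.enc
  | .app t u => Tok.app :: (t.enc ++ u.enc)

def lTermCode : Code LTerm where
  enc := LTerm.enc
  prefixFree a := by
    induction a with
    | var n =>
      intro b l m h
      cases b <;> simp [LTerm.enc] at h ⊢
      exact encNat_prefixFree _ _ _ _ h
    | lam t ih =>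
      intro b l m h
      cases b <;> simp [LTerm.enc] at h ⊢
      exact ih _ _ _ h
    | app t u iht ihu =>
      intro b l m h
      cases b <;> simp [LTerm.enc] at h ⊢
      obtain ⟨h1, h2⟩ := iht _ _ _ h
      obtain ⟨h3, h4⟩ := ihu _ _ _ h2
      exact ⟨⟨h1, h3⟩, h4⟩

/-- Polish notation of terms. -/
def Term.enc : Term → List Tok
  | .var n => Tok.var :: encNat n
  | .lam t => Tok.lam :: t.enc
  | .app t u => Tok.app :: (t.enc ++ u.enc)
  | .es t u => Tok.es :: (t.enc ++ u.enc)

def termCode : Code Term where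
  enc := Term.enc
  prefixFree a := by
    induction a with
    | var n =>
      intro b l m h
      cases b <;> simp [Term.enc] at h ⊢
      exact encNat_prefixFree _ _ _ _ h
    | lam t ih =>
      intro b l m h
      cases b <;> simp [Term.enc] at h ⊢
      exact ih _ _ _ h
    | app t u iht ihu =>
      intro b l m h
      cases b <;> simp [Term.enc] at h ⊢
      obtain ⟨h1, h2⟩ := iht _ _ _ h
      obtain ⟨h3, h4⟩ := ihu _ _ _ h2
      exact ⟨⟨h1, h3⟩, h4⟩
    | es t u iht ihu =>
      intro b l m h
      cases b <;> simp [Term.enc] at h ⊢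
      obtain ⟨h1, h2⟩ := iht _ _ _ h
      obtain ⟨h3, h4⟩ := ihu _ _ _ h2
      exact ⟨⟨h1, h3⟩, h4⟩

/-- Polish notation of shallow contexts. -/
def Ctx.enc : Ctx → List Tok
  | .hole => [Tok.hole]
  | .lam C => Tok.lam :: C.enc
  | .appL C u => Tok.appL :: (C.enc ++ u.enc)
  | .appR t C => Tok.appR :: (t.enc ++ C.enc)
  | .es C u => Tok.es :: (C.enc ++ u.enc)

def ctxCode : Code Ctx where
  enc := Ctx.enc
  prefixFree a := by
    induction a with
    | hole =>
      intro b l m h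
      cases b <;> simp [Ctx.enc] at h ⊢
      exact h
    | lam C ih =>
      intro b l m h
      cases b <;> simp [Ctx.enc] at h ⊢
      exact ih _ _ _ h
    | appL C u ih =>
      intro b l m h
      cases b <;> simp [Ctx.enc] at h ⊢
      obtain ⟨h1, h2⟩ := ih _ _ _ h
      obtain ⟨h3, h4⟩ := termCode.prefixFree _ _ _ _ h2
      exact ⟨⟨h1, h3⟩, h4⟩
    | appR t C ih =>
      intro b l m h
      cases b <;> simp [Ctx.enc] at h ⊢
      obtain ⟨h1, h2⟩ := termCode.prefixFree _ _ _ _ h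
      obtain ⟨h3, h4⟩ := ih _ _ _ h2
      exact ⟨⟨h1, h3⟩, h4⟩
    | es C u ih =>
      intro b l m h
      cases b <;> simp [Ctx.enc] at h ⊢
      obtain ⟨h1, h2⟩ := ih _ _ _ h
      obtain ⟨h3, h4⟩ := termCode.prefixFree _ _ _ _ h2
      exact ⟨⟨h1, h3⟩, h4⟩

/-- Pairs. -/
def Code.pair {α β : Type} (ca : Code α) (cb : Code β) : Code (α × β) where
  enc p := ca.enc p.1 ++ cb.enc p.2
  prefixFree a b l m h := by
    simp only [List.append_assoc] at h
    obtain ⟨h1, h2⟩ := ca.prefixFree _ _ _ _ h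
    obtain ⟨h3, h4⟩ := cb.prefixFree _ _ _ _ h2
    exact ⟨Prod.ext h1 h3, h4⟩

/-- Optional values. -/
def Code.option {α : Type} (ca : Code α) : Code (Option α) where
  enc
    | none => [Tok.endm]
    | some a => Tok.some :: ca.enc a
  prefixFree a b l m h := by
    cases a <;> cases b <;> simp at h ⊢
    · exact h
    · exact ca.prefixFree _ _ _ _ h

/-- Lists of variables. -/
def encList : List ℕ → List Tok
  | [] => [Tok.endm]
  | x :: l => Tok.var :: (encNat x ++ encList l)

theorem encList_prefixFree (a b : List ℕ) (l m : List Tok)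
    (h : encList a ++ l = encList b ++ m) : a = b ∧ l = m := by
  induction a generalizing b with
  | nil =>
    cases b <;> simp [encList] at h ⊢
    exact h
  | cons x a ih =>
    cases b <;> simp [encList] at h ⊢
    obtain ⟨h1, h2⟩ := encNat_prefixFree _ _ _ _ h
    obtain ⟨h3, h4⟩ := ih _ h2
    exact ⟨⟨h1, h3⟩, h4⟩

/-! ### Mechanisable strategies -/

/-- The subterm property: along every derivation of `X` from `t`, every substitution step
`D⟨C⟨x⟩[x←r]⟩ → D⟨C⟨r⟩[x←r]⟩` duplicates a subterm `r` of `t`. -/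
def SubtermProperty (X : Strategy) : Prop :=
  ∀ t u : Term, Relation.ReflTransGen X.Step t u →
    ∀ (D C : Ctx) (r : Term), u = (D.comp (.es C r)).plug (.var C.depth) →
      X u (D.comp (.es C r)) → Term.IsSubterm D.depth r t

/-- The selection property: the search of the redex of `u` that `X` reduces (if there is one)
takes time polynomial in the size of `u`. -/
def SelectionProperty (X : Strategy) : Prop :=
  ∃ next : Term → Option Ctx, PolyTime termCode ctxCode.option next ∧
    ∀ (u : Term) (E : Ctx), next u = some E ↔ X u E

/-- Mechanisable strategies. -/
def Mechanisable (X : Strategy) : Prop := SubtermProperty X ∧ SelectionProperty X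

/-! ### The three algorithms

They are written in a monad that counts steps. Finite sets of variables are represented by
lists without repetitions. Every recursive call, every element visited by a set operation, and
every other elementary operation costs one step. -/

/-- The result of a computation, with the number of steps it took. -/
structure Timed (α : Type) where
  val : α
  steps : ℕ

instance : Monad Timed where
  pure a := ⟨a, 0⟩
  bind x f := ⟨(f x.val).val, x.steps + (f x.val).steps⟩

/-- One step. -/
def tick : Timed Unit := ⟨(), 1⟩

/-- The test `x ∈ V`. -/
def memT (x : ℕ) : List ℕ → Timed Bool
  | [] => do
      tick
      return false
  | y :: V => do
      tick
      if x = y then return true else memT x V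

/-- The union `V ∪ W`. -/
def unionT : List ℕ → List ℕ → Timed (List ℕ)
  | [], W => do
      tick
      return W
  | x :: V, W => do
      tick
      let U ← unionT V W
      let b ← memT x U
      return (if b then U else x :: U)

/-- The name of the variable `y` after the removal of the binder of the `k`-th variable, when `y`
is not this variable. -/
def unbindVar (k y : ℕ) : ℕ := if y < k then y else y - 1

/-- The set `V - {x}`, where `x` is the `k`-th variable, whose binder is removed. -/
def removeT (k : ℕ) : List ℕ → Timed (List ℕ)
  | [] => do
      tick
      return []
  | y :: V => do
      tick
      let U ← removeT k V
      return (if y = k then U else unbindVar k y :: U)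

/-- The set `V`, seen under `k` additional binders. -/
def raiseT (k : ℕ) : List ℕ → Timed (List ℕ)
  | [] => do
      tick
      return []
  | y :: V => do
      tick
      let U ← raiseT k V
      return (y + k) :: U

/-- The nature of a `λ`-term. -/
inductive Nature : Type
  | var : ℕ → Nature
  | lam : Nature
  | app : Nature
  deriving DecidableEq

/-- The nature, seen under `k` additional binders. -/
def Nature.raise (k : ℕ) : Nature → Nature
  | .var y => .var (y + k)
  | .lam => .lam
  | .app => .app

/-- `{y | n = var y}`. -/
def Nature.vars : Nature → List ℕ
  | .var y => [y]
  | .lam => []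
  | .app => []

/-- Tuples `(n, b, V, W)`: nature of the term, presence of a `β`-redex, variables with an
occurrence in applicative position, free variables. -/
structure Tuple : Type where
  nature : Nature
  redex : Bool
  apvars : List ℕ
  freevars : List ℕ

/-- The clause for variables. -/
def varCase (x : ℕ) : Timed Tuple := do
  tick
  return ⟨.var x, false, [], [x]⟩

/-- The clause for abstractions `λx.t`, given the tuple of `t`. -/
def lamCase (a : Tuple) : Timed Tuple := do
  tick
  let V ← removeT 0 a.apvars
  let W ← removeT 0 a.freevars
  return ⟨.lam, a.redex, V, W⟩

/-- The clause for applications `t u`, given the tuples of `t` and `u`. -/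
def appCase (a b : Tuple) : Timed Tuple := do
  tick
  let V₁ ← unionT a.apvars b.apvars
  let V ← unionT V₁ a.nature.vars
  let W ← unionT a.freevars b.freevars
  return ⟨.app, a.redex || b.redex || decide (a.nature = .lam), V, W⟩

/-- The clause for explicit substitutions `[x←u]`, given the tuple of the expression to which the
substitution is applied, the tuple of `u`, and the index `k` of `x` (`u` lives outside of the
`k + 1` innermost binders). -/
def esCase (k : ℕ) (a b : Tuple) : Timed Tuple := do
  tick
  let nu := b.nature.raise k
  let Vu ← raiseT k b.apvars
  let Wu ← raiseT k b.freevars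
  let inV ← memT k a.apvars
  let inW ← memT k a.freevars
  let n := match a.nature with
    | .var y => if y = k then nu else .var (unbindVar k y)
    | .lam => .lam
    | .app => .app
  let V₀ ← removeT k a.apvars
  let V₁ ← unionT V₀ (if inW then Vu else [])
  let V ← unionT V₁ (if inV then nu.vars else [])
  let W₀ ← removeT k a.freevars
  let W ← unionT W₀ (if inW then Wu else [])
  return ⟨n, a.redex || (b.redex && inW) || (decide (nu = .lam) && inV), V, W⟩

/-- The algorithm `A_g` on `λ`-terms. -/
def Ag : LTerm → Timed Tuple
  | .var x => varCase x
  | .lam t => do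
      let a ← Ag t
      lamCase a
  | .app t u => do
      let a ← Ag t
      let b ← Ag u
      appCase a b

/-- The algorithm `B_g` on terms with explicit substitutions. -/
def Bg : Term → Timed Tuple
  | .var x => varCase x
  | .lam t => do
      let a ← Bg t
      lamCase a
  | .app t u => do
      let a ← Bg t
      let b ← Bg u
      appCase a b
  | .es t u => do
      let a ← Bg t
      let b ← Bg u
      esCase 0 a b

/-- The computation of `C.lamDepth`, which is the index of `x` when the substitution of
`C[x←u]` is performed in the relative unfolding. -/
def lamDepthT : Ctx → Timed ℕ
  | .hole => do
      tick
      return 0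
  | .lam C => do
      tick
      let k ← lamDepthT C
      return k + 1
  | .appL C _ => do
      tick
      lamDepthT C
  | .appR _ C => do
      tick
      lamDepthT C
  | .es C _ => do
      tick
      lamDepthT C

/-- The algorithm `C_g` on pairs of a term and a shallow context. -/
def Cg (t : Term) : Ctx → Timed Tuple
  | .hole => do
      tick
      Bg t
  | .lam C => do
      tick
      Cg t C
  | .appL C _ => do
      tick
      Cg t C
  | .appR _ C => do
      tick
      Cg t C
  | .es C u => do
      let a ← Cg t C
      let b ← Bg u
      let k ← lamDepthT C
      esCase k a b

def encNature : Nature → List Tok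
  | .var y => Tok.var :: encNat y
  | .lam => [Tok.lam]
  | .app => [Tok.app]

theorem encNature_prefixFree (a b : Nature) (l m : List Tok)
    (h : encNature a ++ l = encNature b ++ m) : a = b ∧ l = m := by
  cases a <;> cases b <;> simp [encNature] at h ⊢
  · exact encNat_prefixFree _ _ _ _ h
  · exact h
  · exact h

def tupleCode : Code Tuple where
  enc a := encNature a.nature ++ (boolCode.enc a.redex ++ (encList a.apvars ++ encList a.freevars))
  prefixFree a b l m h := by
    cases a; cases b
    simp only [List.append_assoc] at h
    obtain ⟨h1, h2⟩ := encNature_prefixFree _ _ _ _ h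
    obtain ⟨h3, h4⟩ := boolCode.prefixFree _ _ _ _ h2
    obtain ⟨h5, h6⟩ := encList_prefixFree _ _ _ _ h4
    obtain ⟨h7, h8⟩ := encList_prefixFree _ _ _ _ h6
    simp_all

end LSC

/-! The proposition combines four independent facts.

Cost. Every list in a computed tuple is at most as long as the input has constructors (`Bg_short`,
`Cg_short`), so a clause costs quadratically many steps (`esCase_steps`); one clause is run per
constructor. In `Cg` the index of each substitution is recomputed, which adds a linear term.

Machines. A stack program compiles to a Turing machine with one transition per instruction and one
to halt. The functions on trees computed by such programs in polynomial time (`PolyFun`) are closed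
under composition, pairing, case distinction, loops of polynomial length with polynomially bounded
states, and hence folds over lists. Reading Polish notation from right to left with a stack of
values evaluates any structural recursion (`PolyFun.foldRaw`), in polynomial time as soon as the
constructors are in `PolyFun` and the values on trees no larger than the input are of polynomial
size. The three algorithms are instances of one recursion, `tupleAlg`; its values are small because
the list lengths and the bit lengths of the indices are at most quadratic in the encoding
(`fold_tupleAlg_small`).

Correctness. Unfoldings can be exponentially large, but a tuple holds all that matters about one:
its head constructor, the presence of a redex, its applied and its free variables (`Bg_describes`,
`Cg_describes`). The substitution clause is right because a redex of `t{x←u}` comes from `t`, from a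
copy of `u`, or from an abstraction `u` put in an applied occurrence of `x` (`hasBeta_subst`). Since
a substituted variable and its content have the same relative unfolding (`relUnf_bound`), and a
variable bound by no substitution unfolds to a variable, usefulness at `E⟨x⟩` is read off `Cg x E`
(`usefulRedex_var`). The redex of the strategy is then the first useful one in the list `decs` of
all decompositions of the term; it is unique because the order on positions embeds into the
lexicographic order on paths (`LO.path_lt`).

Subterm property. The invariant `Reachable` says that, in a term reached from `t`, arguments and
contents of substitutions on the path to the next redex and to the right of it are still subterms of
`t`, except below applications whose left part is not an answer and has no useful redex. The left
part of such an application stays so, because usefulness does not depend on the arguments around a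
position (`UsefulRedex.change_arg`); hence the application never becomes a `dB`-redex, and its
altered argument never enters a substitution. The substitution on the path to a fired `ls`-redex
thus holds a subterm of `t` (`Reachable.ctx_intact`, `Reachable.contract`). -/

namespace LSC

/-! ### Stack programs

A small imperative language over four stacks of tokens. A program has a finite set of labels and
leaves through an exit labelled with a result in `X`; programs compose like a monad. -/

/-- The names of the stacks. -/
inductive Stk : Type
  | main | left | right | cnt
  deriving DecidableEq

instance : Fintype Stk := ⟨{.main, .left, .right, .cnt}, fun k => by cases k <;> decide⟩

/-- The contents of the stacks. -/
@[ext] structure Store : Type where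
  main : List Tok
  left : List Tok
  right : List Tok
  cnt : List Tok

namespace Store

def get (S : Store) : Stk → List Tok
  | .main => S.main
  | .left => S.left
  | .right => S.right
  | .cnt => S.cnt

def set (S : Store) : Stk → List Tok → Store
  | .main, l => { S with main := l }
  | .left, l => { S with left := l }
  | .right, l => { S with right := l }
  | .cnt, l => { S with cnt := l }

theorem get_set (S : Store) (k : Stk) (l : List Tok) :
    (S.set k l).get = Function.update S.get k l := by
  funext j
  cases k <;> cases j <;> simp [set, get, Function.update]

end Store

/-- Instructions with continuations in `Λ`. -/
inductive Instr (Λ : Type) : Type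
  | pop (k : Stk) (next : Option Tok → Λ) : Instr Λ
  | push (k : Stk) (t : Tok) (next : Λ) : Instr Λ
  | jump (next : Λ) : Instr Λ

namespace Instr

def map {Λ Λ' : Type} (f : Λ → Λ') : Instr Λ → Instr Λ'
  | pop k next => pop k fun o => f (next o)
  | push k t next => push k t (f next)
  | jump next => jump (f next)

def exec {Λ : Type} : Instr Λ → Store → Λ × Store
  | pop k next, S => (next (S.get k).head?, S.set k (S.get k).tail)
  | push k t next, S => (next, S.set k (t :: S.get k))
  | jump next, S => (next, S)

theorem exec_map {Λ Λ' : Type} (f : Λ → Λ') (i : Instr Λ) (S : Store) :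
    (i.map f).exec S = (f (i.exec S).1, (i.exec S).2) := by
  cases i <;> rfl

end Instr

/-- Programs with results in `X`. -/
structure Frag (X : Type) where
  Λ : Type
  fin : Fintype Λ
  entry : Λ ⊕ X
  code : Λ → Instr (Λ ⊕ X)

attribute [instance] Frag.fin

namespace Frag

variable {X Y : Type}

/-- `F` runs from the label `l` to the exit `x` in the given number of steps. -/
inductive Reach (F : Frag X) : F.Λ ⊕ X → Store → X → Store → ℕ → Prop
  | exit (x : X) (S : Store) : Reach F (.inr x) S x S 0
  | step {l : F.Λ} {S : Store} {x : X} {S' : Store} {n : ℕ} :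
      Reach F ((F.code l).exec S).1 ((F.code l).exec S).2 x S' n → Reach F (.inl l) S x S' (n + 1)

/-- `F` runs from the store `S` to the store `S'` with the result `x` in at most `n` steps. -/
def Runs (F : Frag X) (S : Store) (x : X) (S' : Store) (n : ℕ) : Prop :=
  ∃ m ≤ n, F.Reach F.entry S x S' m

theorem Runs.mono {F : Frag X} {S S' : Store} {x : X} {n m : ℕ} (h : F.Runs S x S' n)
    (hnm : n ≤ m) : F.Runs S x S' m := by
  obtain ⟨k, hk, h⟩ := h
  exact ⟨k, hk.trans hnm, h⟩

/-- The empty program. -/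
protected def pure (x : X) : Frag X where
  Λ := Empty
  fin := inferInstance
  entry := .inr x
  code := Empty.elim

theorem runs_pure (x : X) (S : Store) : (Frag.pure x).Runs S x S 0 := ⟨0, le_rfl, .exit x S⟩

def pop (k : Stk) : Frag (Option Tok) where
  Λ := Unit
  fin := inferInstance
  entry := .inl ()
  code _ := .pop k .inr

theorem runs_pop (k : Stk) (S : Store) :
    (pop k).Runs S (S.get k).head? (S.set k (S.get k).tail) 1 :=
  ⟨1, le_rfl, .step (.exit _ _)⟩

def push (k : Stk) (t : Tok) : Frag Unit where
  Λ := Unit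
  fin := inferInstance
  entry := .inl ()
  code _ := .push k t (.inr ())

theorem runs_push (k : Stk) (t : Tok) (S : Store) :
    (push k t).Runs S () (S.set k (t :: S.get k)) 1 :=
  ⟨1, le_rfl, .step (.exit _ _)⟩

section Bind

variable [Fintype X] (F : Frag X) (G : X → Frag Y)

def bindRight (x : X) : (G x).Λ ⊕ Y → (F.Λ ⊕ Σ x, (G x).Λ) ⊕ Y
  | .inl l => .inl (.inr ⟨x, l⟩)
  | .inr y => .inr y

/-- An exit of `F` is identified with the entry of the continuation, so composition costs no step.
The composite has one copy of the continuation's labels per result, hence the finiteness of `X`. -/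
def bindLeft : F.Λ ⊕ X → (F.Λ ⊕ Σ x, (G x).Λ) ⊕ Y
  | .inl l => .inl (.inl l)
  | .inr x => bindRight F G x (G x).entry

/-- Sequential composition. -/
protected def bind : Frag Y where
  Λ := F.Λ ⊕ Σ x, (G x).Λ
  fin := inferInstance
  entry := bindLeft F G F.entry
  code
    | .inl l => (F.code l).map (bindLeft F G)
    | .inr ⟨x, l⟩ => ((G x).code l).map (bindRight F G x)

variable {F G}

theorem Reach.bindRight {x : X} {l : (G x).Λ ⊕ Y} {S S' : Store} {y : Y} {n : ℕ}
    (h : (G x).Reach l S y S' n) : (F.bind G).Reach (Frag.bindRight F G x l) S y S' n := by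
  induction h with
  | exit y S => exact .exit y S
  | step _ ih =>
    refine .step (F := F.bind G) (l := .inr ⟨x, _⟩) ?_
    simp only [Frag.bind, Instr.exec_map]
    exact ih

theorem Reach.bindLeft {l : F.Λ ⊕ X} {S S₁ S' : Store} {x : X} {y : Y} {n m : ℕ}
    (h : F.Reach l S x S₁ n) (h' : (G x).Reach (G x).entry S₁ y S' m) :
    (F.bind G).Reach (Frag.bindLeft F G l) S y S' (n + m) := by
  induction h with
  | exit x S => simpa [Frag.bindLeft] using h'.bindRight
  | step _ ih =>
    rw [Nat.add_right_comm]
    refine .step (F := F.bind G) (l := .inl _) ?_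
    simp only [Frag.bind, Instr.exec_map]
    exact ih h'

theorem Runs.bind {S S₁ S' : Store} {x : X} {y : Y} {n m : ℕ}
    (h : F.Runs S x S₁ n) (h' : (G x).Runs S₁ y S' m) :
    (F.bind G).Runs S y S' (n + m) := by
  obtain ⟨n', hn, h⟩ := h
  obtain ⟨m', hm, h'⟩ := h'
  exact ⟨n' + m', by omega, h.bindLeft h'⟩

end Bind

section Iter

variable (F : Frag (Option Y))

/-- The additional label `none` only jumps to the entry of `F`. It is needed because this entry may
itself be an exit asking for a further round, which leaves no label of `F` to land on. -/
def iterLabel : F.Λ ⊕ Option Y → Option F.Λ ⊕ Y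
  | .inl l => .inl (some l)
  | .inr none => .inl none
  | .inr (some y) => .inr y

/-- Repetition of a program until it yields a result. -/
def iter : Frag Y where
  Λ := Option F.Λ
  fin := inferInstance
  entry := .inl none
  code
    | none => .jump (iterLabel F F.entry)
    | some l => (F.code l).map (iterLabel F)

variable {F}

theorem Reach.iter {l : F.Λ ⊕ Option Y} {S S₁ S' : Store} {o : Option Y} {y : Y} {n m : ℕ}
    (h : F.Reach l S o S₁ n) (h' : (iter F).Reach (iterLabel F (.inr o)) S₁ y S' m) :
    (iter F).Reach (iterLabel F l) S y S' (n + m) := by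
  induction h with
  | exit o S => simpa using h'
  | step _ ih =>
    rw [Nat.add_right_comm]
    refine .step (F := Frag.iter F) (l := some _) ?_
    simp only [Frag.iter, Instr.exec_map]
    exact ih h'

theorem Runs.iter_done {S S' : Store} {y : Y} {n : ℕ} (h : F.Runs S (some y) S' n) :
    (iter F).Runs S y S' (n + 1) := by
  obtain ⟨n', hn, h⟩ := h
  exact ⟨n' + 1, by omega, .step (h.iter (m := 0) (.exit _ _))⟩

theorem Runs.iter_next {S S₁ S' : Store} {y : Y} {n m : ℕ} (h : F.Runs S none S₁ n)
    (h' : (iter F).Runs S₁ y S' m) : (iter F).Runs S y S' (n + m + 1) := by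
  obtain ⟨n', hn, h⟩ := h
  obtain ⟨m', hm, h'⟩ := h'
  exact ⟨n' + m' + 1, by omega, .step (h.iter h')⟩

end Iter

/-! ### Compilation to Turing machines -/

/-- A popped token goes through the internal register of the machine, on which the following jump
branches. -/
def Instr.toStmt {Λ Λ' : Type} (f : Λ → Λ') :
    Instr Λ → Turing.TM2.Stmt (fun _ : Stk => Tok) Λ' (Option Tok)
  | .pop k next => .pop k (fun _ o => o) (.goto fun o => f (next o))
  | .push k t next => .push k (fun _ => t) (.goto fun _ => f next)
  | .jump next => .goto fun _ => f next

/-- The Turing machine of a program. It reads its input from the main stack, and leaves its output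
there. -/
def machine (F : Frag Unit) : Turing.FinTM2 where
  K := Stk
  k₀ := .main
  k₁ := .main
  Γ _ := Tok
  Λ := F.Λ ⊕ Unit
  main := F.entry
  σ := Option Tok
  initialState := none
  Γk₀Fin := inferInstance
  m
    | .inl l => Instr.toStmt id (F.code l)
    | .inr _ => .load (fun _ => none) .halt

/-- The additional step is that of the exit label, which resets the register and halts: a halting
configuration must have the initial register value. -/
theorem Reach.machine {F : Frag Unit} {l : F.Λ ⊕ Unit} {S S' : Store} {n : ℕ}
    (h : F.Reach l S () S' n) (v : Option Tok) :
    (flip bind F.machine.step)^[n + 1]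
      (some (⟨some l, v, S.get⟩ : F.machine.Cfg)) = some ⟨none, none, S'.get⟩ := by
  generalize hx : () = x at h
  induction h generalizing v with
  | exit x S => rfl
  | @step l S x S' n h ih =>
    rw [Function.iterate_succ_apply]
    have : ∃ v', F.machine.step ⟨some (.inl l), v, S.get⟩ =
        some ⟨some ((F.code l).exec S).1, v', ((F.code l).exec S).2.get⟩ := by
      have h0 : F.machine.step ⟨some (.inl l), v, S.get⟩ =
        some (Turing.TM2.stepAux (Instr.toStmt id (F.code l)) v S.get) := rfl
      rw [h0]
      cases F.code l <;>
        simp only [Instr.toStmt, Turing.TM2.stepAux, Instr.exec, Store.get_set] <;>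
        exact ⟨_, rfl⟩
    obtain ⟨v', hv⟩ := this
    have hb : (flip bind F.machine.step)
        (some (⟨some (.inl l), v, S.get⟩ : F.machine.Cfg)) =
        F.machine.step ⟨some (.inl l), v, S.get⟩ := rfl
    rw [hb, hv]
    exact ih v' hx

theorem polyTime_of_runs {α β : Type} {ca : Code α} {cb : Code β} {f : α → β} (F : Frag Unit)
    (p : Polynomial ℕ)
    (h : ∀ a, F.Runs ⟨ca.enc a, [], [], []⟩ () ⟨cb.enc (f a), [], [], []⟩
      (p.eval (ca.enc a).length)) : PolyTime ca cb f := by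
  choose n hn hr using h
  refine ⟨{
    tm := F.machine
    inputAlphabet := Equiv.refl _
    outputAlphabet := Equiv.refl _
    time := p + 1
    outputsFun := fun a => ?_ }⟩
  refine ⟨⟨n a + 1, ?_⟩, ?_⟩
  · have h1 : Turing.initList F.machine (List.map (Equiv.refl Tok).invFun (ca.enc a)) =
        ⟨some F.entry, none, (⟨ca.enc a, [], [], []⟩ : Store).get⟩ := by
      simp only [Turing.initList]
      congr 1
      funext k
      cases k <;> simp [machine, Store.get]; rfl
    have h2 : Turing.haltList F.machine (List.map (Equiv.refl Tok).invFun (cb.enc (f a))) =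
        ⟨none, none, (⟨cb.enc (f a), [], [], []⟩ : Store).get⟩ := by
      simp only [Turing.haltList]
      congr 1
      funext k
      cases k <;> simp [machine, Store.get]; rfl
    have := (hr a).machine none
    rw [← h1, ← h2] at this
    exact this
  · simpa using hn a

end Frag

end LSC

namespace LSC

/-! ### Binary trees on a stack -/

/-- Binary trees with tokens at the leaves, the universal data type of stack programs. -/
inductive Data : Type
  | leaf (t : Tok) : Data
  | node (a b : Data) : Data

namespace Data

def enc : Data → List Tok
  | leaf t => [.var, t]
  | node a b => .app :: (a.enc ++ b.enc)

def size : Data → ℕ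
  | leaf _ => 2
  | node a b => a.size + b.size + 1

@[simp] theorem length_enc (d : Data) : d.enc.length = d.size := by
  induction d with
  | leaf t => rfl
  | node a b iha ihb => simp [enc, size, iha, ihb]

theorem two_le_size (d : Data) : 2 ≤ d.size := by
  cases d with
  | leaf t => simp [size]
  | node a b =>
    have key : ∀ d : Data, 1 ≤ d.size := fun d => by cases d <;> simp [size]
    have := key a
    have := key b
    simp only [size]; omega

end Data

/-- The store whose only nonempty stack is the main one. -/
abbrev onMain (l : List Tok) : Store := ⟨l, [], [], []⟩

/-! ### Deleting, duplicating and exchanging trees -/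

namespace Frag

variable {X Y : Type}

def seq (F : Frag Unit) (G : Frag Y) : Frag Y := F.bind fun _ => G

theorem Runs.seq {F : Frag Unit} {G : Frag Y} {S S₁ S' : Store} {y : Y} {n m : ℕ}
    (h : F.Runs S () S₁ n) (h' : G.Runs S₁ y S' m) : (F.seq G).Runs S y S' (n + m) :=
  Runs.bind (G := fun _ => G) h h'

theorem Runs.pop_bind {k : Stk} {G : Option Tok → Frag Y} {S S' : Store} {y : Y} {n : ℕ}
    (h : (G (S.get k).head?).Runs (S.set k (S.get k).tail) y S' n) :
    ((pop k).bind G).Runs S y S' (n + 1) :=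
  ((runs_pop k S).bind h).mono (by omega)

theorem Runs.push_bind {k : Stk} {t : Tok} {G : Unit → Frag Y} {S S' : Store} {y : Y} {n : ℕ}
    (h : (G ()).Runs (S.set k (t :: S.get k)) y S' n) :
    ((push k t).bind G).Runs S y S' (n + 1) :=
  ((runs_push k t S).bind h).mono (by omega)

/-- Pushes a word, whose first letter ends up on the top of the main stack. -/
def pushAll : List Tok → Frag Unit
  | [] => .pure ()
  | t :: l => (pushAll l).seq (push .main t)

theorem runs_pushAll (l m : List Tok) :
    (pushAll l).Runs (onMain m) () (onMain (l ++ m)) l.length := by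
  induction l with
  | nil => exact runs_pure _ _
  | cons t l ih => exact ih.seq (runs_push .main t _)

/-- Moves the content of a stack to another stack. -/
def pour (k k' : Stk) : Frag Unit :=
  iter <| (pop k).bind fun
    | none => .pure (some ())
    | some t => (push k' t).bind fun _ => .pure none

theorem runs_pour {k k' : Stk} (hk : k ≠ k') (S : Store) :
    (pour k k').Runs S () ((S.set k []).set k' ((S.get k).reverse ++ S.get k'))
      (3 * (S.get k).length + 2) := by
  generalize hl : S.get k = l
  induction l generalizing S with
  | nil =>
    have hS : (S.set k []).set k' ([].reverse ++ S.get k') = S.set k (S.get k).tail := by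
      cases k <;> cases k' <;> simp_all [Store.get, Store.set]
    rw [hS]
    refine Runs.iter_done (Runs.pop_bind (n := 0) ?_)
    rw [hl]
    exact runs_pure _ _
  | cons t l ih =>
    have ih' := ih ((S.set k l).set k' (t :: (S.set k l).get k')) (by
      cases k <;> cases k' <;> simp_all [Store.get, Store.set])
    have hS : (((S.set k l).set k' (t :: (S.set k l).get k')).set k []).set k'
        (l.reverse ++ ((S.set k l).set k' (t :: (S.set k l).get k')).get k') =
        (S.set k []).set k' ((t :: l).reverse ++ S.get k') := by
      cases k <;> cases k' <;> simp_all [Store.get, Store.set]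
    rw [hS] at ih'
    refine Runs.mono (Runs.iter_next (n := 2) (Runs.pop_bind (n := 1) ?_) ih') ?_
    · rw [hl]
      exact Runs.push_bind (runs_pure _ _)
    · simp only [List.length_cons]
      omega

/-- Empties the left stack. -/
def clear : Frag Unit :=
  iter <| (pop .left).bind fun
    | none => .pure (some ())
    | some _ => .pure none

theorem runs_clear (m a b c : List Tok) :
    clear.Runs ⟨m, a, b, c⟩ () ⟨m, [], b, c⟩ (2 * a.length + 2) := by
  induction a with
  | nil => exact Runs.iter_done (Runs.pop_bind (runs_pure _ _))
  | cons t a ih =>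
    exact (Runs.iter_next (n := 1) (Runs.pop_bind (runs_pure _ _)) ih).mono
      (by simp only [List.length_cons]; omega)

/-- Moves the content of the left stack both to the main and to the right stack. -/
def pourBoth : Frag Unit :=
  iter <| (pop .left).bind fun
    | none => .pure (some ())
    | some t => (push .main t).bind fun _ => (push .right t).bind fun _ => .pure none

theorem runs_pourBoth (m a b c : List Tok) :
    pourBoth.Runs ⟨m, a, b, c⟩ () ⟨a.reverse ++ m, [], a.reverse ++ b, c⟩ (4 * a.length + 2) := by
  induction a generalizing m b with
  | nil => exact Runs.iter_done (Runs.pop_bind (runs_pure _ _))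
  | cons t a ih =>
    simp only [List.reverse_cons, List.append_assoc, List.cons_append, List.nil_append]
    exact (Runs.iter_next (n := 3) (Runs.pop_bind (Runs.push_bind (Runs.push_bind (runs_pure none _))))
      (ih (t :: m) (t :: b))).mono (by simp only [List.length_cons]; omega)

/-- The stack `cnt` holds one token for each tree still to be read after the current one: a node
adds a token, a leaf removes one, and a leaf that finds no token is the last. -/
def takeStep : Frag (Option Unit) :=
  (pop .main).bind fun
    | some .app => (push .left .app).bind fun _ => (push .cnt .app).bind fun _ => .pure none
    | some .var => (push .left .var).bind fun _ => (pop .main).bind fun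
      | some t => (push .left t).bind fun _ => (pop .cnt).bind fun
        | none => .pure (some ())
        | some _ => .pure none
      | none => .pure (some ())
    | _ => .pure (some ())

/-- Moves (and reverses) a tree from the main to the left stack. -/
def take : Frag Unit := iter takeStep

/-- The second half makes the induction work: it treats a tree that is not the last one, such as a
left subtree, after which the loop goes on with one pending token less. -/
theorem runs_take_aux (d : Data) (m a b : List Tok) :
    (take.Runs ⟨d.enc ++ m, a, b, []⟩ () ⟨m, d.enc.reverse ++ a, b, []⟩ (6 * d.size)) ∧
    ∀ (t : Tok) (c : List Tok) (S : Store) (n : ℕ),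
      take.Runs ⟨m, d.enc.reverse ++ a, b, c⟩ () S n →
      take.Runs ⟨d.enc ++ m, a, b, t :: c⟩ () S (6 * d.size + n) := by
  induction d generalizing m a with
  | leaf t =>
    have h1 : ∀ c : List Tok, takeStep.Runs ⟨.var :: t :: m, a, b, c⟩
        (match c.head? with | none => some () | some _ => none)
        ⟨m, t :: .var :: a, b, c.tail⟩ 5 := by
      intro c
      refine Runs.pop_bind (Runs.push_bind (Runs.pop_bind (Runs.push_bind
        (Runs.pop_bind (n := 0) ?_))))
      cases c <;> exact runs_pure _ _
    refine ⟨(h1 []).iter_done.mono (by simp [Data.size]), fun s c S n h => ?_⟩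
    exact ((h1 (s :: c)).iter_next h).mono (by simp [Data.size])
  | node d e ihd ihe =>
    have h1 : ∀ c : List Tok, takeStep.Runs ⟨.app :: (d.enc ++ (e.enc ++ m)), a, b, c⟩ none
        ⟨d.enc ++ (e.enc ++ m), .app :: a, b, .app :: c⟩ 3 := fun c =>
      Runs.pop_bind (Runs.push_bind (Runs.push_bind (runs_pure none _)))
    simp only [Data.enc, Data.size, List.cons_append, List.append_assoc, List.reverse_cons,
      List.reverse_append, List.nil_append]
    constructor
    · exact ((h1 []).iter_next ((ihd _ _).2 _ _ _ _ (ihe _ _).1)).mono (by omega)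
    · intro s c S n h
      exact ((h1 (s :: c)).iter_next ((ihd _ _).2 _ _ _ _ ((ihe _ _).2 _ _ _ _ h))).mono (by omega)

theorem runs_take (d : Data) (m a b : List Tok) :
    take.Runs ⟨d.enc ++ m, a, b, []⟩ () ⟨m, d.enc.reverse ++ a, b, []⟩ (6 * d.size) :=
  (runs_take_aux d m a b).1

/-- Removes a tree. -/
def drop : Frag Unit := take.seq clear

theorem runs_drop (d : Data) (m b : List Tok) :
    drop.Runs ⟨d.enc ++ m, [], b, []⟩ () ⟨m, [], b, []⟩ (9 * d.size) := by
  refine ((runs_take d m [] b).seq (runs_clear _ _ _ _)).mono ?_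
  have := d.two_le_size
  simp; omega

/-- Duplicates a tree. -/
def dup : Frag Unit :=
  take.seq <| pourBoth.seq <| (pour .right .left).seq (pour .left .main)

/-- A pour reverses a word, so the spare copy on the right stack needs two of them to reach the main
stack in its original order. -/
theorem runs_dup (d : Data) (m : List Tok) :
    dup.Runs (onMain (d.enc ++ m)) () (onMain (d.enc ++ (d.enc ++ m))) (19 * d.size) := by
  have h1 := runs_take d m [] []
  have h2 := runs_pourBoth m (d.enc.reverse ++ []) [] []
  have h3 := runs_pour (k := .right) (k' := .left) (by decide) ⟨d.enc ++ m, [], d.enc, []⟩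
  have h4 := runs_pour (k := .left) (k' := .main) (by decide) ⟨d.enc ++ m, d.enc.reverse, [], []⟩
  simp only [Store.get, Store.set, List.append_nil, List.reverse_reverse] at h1 h2 h3 h4
  refine (h1.seq (h2.seq (h3.seq h4))).mono ?_
  have := d.two_le_size
  simp; omega

/-- Exchanges two trees. -/
def swap : Frag Unit :=
  take.seq <| (pour .left .right).seq <| take.seq <| (pour .right .cnt).seq <|
    (pour .cnt .main).seq (pour .left .main)

theorem runs_swap (d e : Data) (m : List Tok) :
    swap.Runs (onMain (d.enc ++ (e.enc ++ m))) () (onMain (e.enc ++ (d.enc ++ m)))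
      (19 * (d.size + e.size)) := by
  have h1 := runs_take d (e.enc ++ m) [] []
  have h2 := runs_pour (k := .left) (k' := .right) (by decide) ⟨e.enc ++ m, d.enc.reverse, [], []⟩
  have h3 := runs_take e m [] d.enc
  -- The counter is empty between two runs of `take` and serves here as an auxiliary stack for
  -- reversing `d` while the left stack holds `e`.
  have h4 := runs_pour (k := .right) (k' := .cnt) (by decide) ⟨m, e.enc.reverse, d.enc, []⟩
  have h5 := runs_pour (k := .cnt) (k' := .main) (by decide)
    ⟨m, e.enc.reverse, [], d.enc.reverse⟩
  have h6 := runs_pour (k := .left) (k' := .main) (by decide) ⟨d.enc ++ m, e.enc.reverse, [], []⟩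
  simp only [Store.get, Store.set, List.append_nil, List.reverse_reverse] at h1 h2 h3 h4 h5 h6
  refine (h1.seq (h2.seq (h3.seq (h4.seq (h5.seq h6))))).mono ?_
  have := d.two_le_size
  have := e.two_le_size
  simp; omega

end Frag

end LSC

namespace LSC

/-! ### Polynomial time functions -/

/-- The coefficients are natural numbers. Monotonicity is what allows size bounds to be substituted
into time bounds. -/
theorem _root_.Polynomial.monotone_eval_nat (p : Polynomial ℕ) : Monotone fun n => p.eval n := by
  intro a b h
  simp only [Polynomial.eval_eq_sum_range]
  exact Finset.sum_le_sum fun i _ => Nat.mul_le_mul le_rfl (Nat.pow_le_pow_left h i)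

/-- Types whose elements are represented by trees. -/
class Rep (α : Type) where
  rep : α → Data

open LSC.Rep

/-- The size of the representation. -/
def sz {α : Type} [Rep α] (a : α) : ℕ := (rep a).size

section Instances

variable {α β : Type} [Rep α] [Rep β]

instance : Rep Unit := ⟨fun _ => .leaf .endm⟩
instance : Rep Tok := ⟨.leaf⟩
instance : Rep Bool := ⟨fun b => .leaf (.bit b)⟩
instance : Rep (α × β) := ⟨fun x => .node (rep x.1) (rep x.2)⟩

def repList : List α → Data
  | [] => .leaf .endm
  | a :: l => .node (rep a) (repList l)

instance : Rep (List α) := ⟨repList⟩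
-- Options are lists of length at most one and numbers are words of bits, so that list programs
-- handle them without new primitives.
instance : Rep (Option α) := ⟨fun o => rep o.toList⟩
instance : Rep ℕ := ⟨fun n => rep (Computability.encodeNat n)⟩

@[simp] theorem sz_unit (u : Unit) : sz u = 2 := rfl
@[simp] theorem sz_tok (t : Tok) : sz t = 2 := rfl
@[simp] theorem sz_bool (b : Bool) : sz b = 2 := rfl
@[simp] theorem sz_prod (a : α) (b : β) : sz (a, b) = sz a + sz b + 1 := rfl
@[simp] theorem sz_nil : sz ([] : List α) = 2 := rfl
@[simp] theorem sz_cons (a : α) (l : List α) : sz (a :: l) = sz a + sz l + 1 := rfl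

theorem two_le_sz (a : α) : 2 ≤ sz a := Data.two_le_size _

theorem sz_append (l m : List α) : sz (l ++ m) + 2 = sz l + sz m := by
  induction l with
  | nil => simp; omega
  | cons a l ih => simp only [List.cons_append, sz_cons]; omega

theorem sz_le_of_mem {a : α} {l : List α} (h : a ∈ l) : sz a ≤ sz l := by
  induction l with
  | nil => simp at h
  | cons b l ih =>
    rcases List.mem_cons.1 h with rfl | h
    · simp; omega
    · have := ih h; simp; omega

theorem length_le_sz (l : List α) : l.length ≤ sz l := by
  induction l with
  | nil => simp
  | cons a l ih => simp; omega

end Instances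

/-- `f` is computed by a stack program in polynomial time. -/
def PolyFun {α β : Type} [Rep α] [Rep β] (f : α → β) : Prop :=
  ∃ (F : Frag Unit) (p : Polynomial ℕ), ∀ a, sz (f a) ≤ p.eval (sz a) ∧
    ∀ m, F.Runs (onMain ((rep a).enc ++ m)) () (onMain ((rep (f a)).enc ++ m)) (p.eval (sz a))

namespace PolyFun

open Frag

variable {α β γ δ σ : Type} [Rep α] [Rep β] [Rep γ] [Rep δ] [Rep σ]

theorem sz_le {f : α → β} (h : PolyFun f) : ∃ p : Polynomial ℕ, ∀ a, sz (f a) ≤ p.eval (sz a) := by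
  obtain ⟨F, p, h⟩ := h
  exact ⟨p, fun a => (h a).1⟩

/-- Only the representations matter. -/
theorem congr_rep {α' β' : Type} [Rep α'] [Rep β'] {f : α → β} {g : α' → β'} (h : PolyFun f)
    (i : α' → α) (hi : ∀ a, rep (i a) = rep a) (hfg : ∀ a, rep (f (i a)) = rep (g a)) :
    PolyFun g := by
  obtain ⟨F, p, h⟩ := h
  refine ⟨F, p, fun a => ?_⟩
  have := h (i a)
  simpa only [sz, hi, hfg] using this

theorem congr_out {β' : Type} [Rep β'] {f : α → β} {g : α → β'} (h : PolyFun f)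
    (hfg : ∀ a, rep (f a) = rep (g a)) : PolyFun g :=
  h.congr_rep id (fun _ => rfl) hfg

protected theorem id : PolyFun fun a : α => a :=
  ⟨.pure (), .X, fun a => ⟨by simp, fun _ => (runs_pure _ _).mono (by simp)⟩⟩

theorem comp {g : β → γ} {f : α → β} (hg : PolyFun g) (hf : PolyFun f) :
    PolyFun fun a => g (f a) := by
  obtain ⟨F, p, hF⟩ := hf
  obtain ⟨G, q, hG⟩ := hg
  refine ⟨F.seq G, p + q.comp p, fun a => ⟨?_, fun m => ?_⟩⟩
  · have h1 := (hG (f a)).1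
    have h2 := q.monotone_eval_nat (hF a).1
    simp only [Polynomial.eval_add, Polynomial.eval_comp] at *
    omega
  · refine (((hF a).2 m).seq ((hG (f a)).2 m)).mono ?_
    have h2 := q.monotone_eval_nat (hF a).1
    simp only [Polynomial.eval_add, Polynomial.eval_comp] at *
    omega

theorem const (b : β) : PolyFun fun _ : α => b := by
  refine ⟨drop.seq (pushAll (rep b).enc), 9 * .X + .C (sz b), fun a => ⟨by simp, fun m => ?_⟩⟩
  refine ((runs_drop _ _ _).seq (runs_pushAll _ _)).mono ?_
  simp [sz]

theorem pair {f : α → β} {g : α → γ} (hf : PolyFun f) (hg : PolyFun g) :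
    PolyFun fun a => (f a, g a) := by
  obtain ⟨F, p, hF⟩ := hf
  obtain ⟨G, q, hG⟩ := hg
  -- The swaps give access to the second copy of the argument and then restore the order. The costs
  -- are `19 * X` for `dup`, `19 * (p + X)` and `19 * (p + q)` for the swaps, `p`, `q` and one push.
  refine ⟨dup.seq <| F.seq <| swap.seq <| G.seq <| swap.seq (push .main .app),
    38 * .X + 39 * p + 20 * q + 1, fun a => ⟨?_, fun m => ?_⟩⟩
  · have h1 := (hF a).1
    have h2 := (hG a).1
    simp only [sz_prod, Polynomial.eval_add, Polynomial.eval_mul, Polynomial.eval_ofNat,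
      Polynomial.eval_X, Polynomial.eval_one]
    omega
  · have h1 := (hF a).1
    have h2 := (hG a).1
    have := (runs_dup (rep a) m).seq <| ((hF a).2 _).seq <| (runs_swap _ _ _).seq <|
      ((hG a).2 _).seq <| (runs_swap _ _ _).seq <| runs_push .main .app _
    refine Runs.mono (S' := onMain ((rep (f a, g a)).enc ++ m)) (by
      simpa [rep, Data.enc, Store.set, Store.get] using this) ?_
    simp only [sz, Polynomial.eval_add, Polynomial.eval_mul, Polynomial.eval_ofNat,
      Polynomial.eval_X, Polynomial.eval_one] at *
    omega

theorem fst {f : α → β × γ} (hf : PolyFun f) : PolyFun fun a => (f a).1 := by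
  refine comp (g := Prod.fst) ?_ hf
  refine ⟨(pop .main).bind fun _ => swap.seq drop, 28 * .X + 1, fun a => ⟨?_, fun m => ?_⟩⟩
  · obtain ⟨a, b⟩ := a
    simp only [sz_prod, Polynomial.eval_add, Polynomial.eval_mul, Polynomial.eval_ofNat,
      Polynomial.eval_X, Polynomial.eval_one]
    omega
  · obtain ⟨a, b⟩ := a
    have := (runs_swap (rep a) (rep b) m).seq (runs_drop (rep b) ((rep a).enc ++ m) [])
    refine Runs.mono (Runs.pop_bind (n := 19 * ((rep a).size + (rep b).size) + 9 * (rep b).size) ?_) ?_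
    · simpa [rep, Data.enc, Store.set, Store.get] using this
    · have := sz_prod a b
      simp only [sz, Polynomial.eval_add, Polynomial.eval_mul, Polynomial.eval_ofNat,
        Polynomial.eval_X, Polynomial.eval_one] at *
      omega

theorem snd {f : α → β × γ} (hf : PolyFun f) : PolyFun fun a => (f a).2 := by
  refine comp (g := Prod.snd) ?_ hf
  refine ⟨(pop .main).bind fun _ => drop, 9 * .X + 1, fun a => ⟨?_, fun m => ?_⟩⟩
  · obtain ⟨a, b⟩ := a
    simp only [sz_prod, Polynomial.eval_add, Polynomial.eval_mul, Polynomial.eval_ofNat,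
      Polynomial.eval_X, Polynomial.eval_one]
    omega
  · obtain ⟨a, b⟩ := a
    have := runs_drop (rep a) ((rep b).enc ++ m) []
    refine Runs.mono (Runs.pop_bind (n := 9 * (rep a).size) ?_) ?_
    · simpa [rep, Data.enc, Store.set, Store.get] using this
    · have := sz_prod a b
      simp only [sz, Polynomial.eval_add, Polynomial.eval_mul, Polynomial.eval_ofNat,
        Polynomial.eval_X, Polynomial.eval_one] at *
      omega

/-- Every function between tokens can be computed. -/
theorem ofTok (g : Tok → Tok) {f : α → Tok} (hf : PolyFun f) : PolyFun fun a => g (f a) := by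
  refine comp (g := g) ?_ hf
  refine ⟨(pop .main).bind fun _ => (pop .main).bind fun o => pushAll [.var, g (o.getD .endm)],
    4, fun a => ⟨by simp, fun m => ?_⟩⟩
  exact (Runs.pop_bind (Runs.pop_bind (runs_pushAll _ _))).mono (by simp)

theorem tokTest (g : Tok → Bool) {f : α → Tok} (hf : PolyFun f) : PolyFun fun a => g (f a) :=
  (hf.ofTok fun t => .bit (g t)).congr_out fun _ => rfl

theorem cond {p : α → Bool} {f g : α → β} (hp : PolyFun p) (hf : PolyFun f) (hg : PolyFun g) :
    PolyFun fun a => bif p a then f a else g a := by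
  -- The test is evaluated beside a copy of the argument, which the selected branch consumes.
  refine (comp (g := fun x : Bool × α => bif x.1 then f x.2 else g x.2) ?_ (hp.pair .id))
  obtain ⟨F, p, hF⟩ := hf
  obtain ⟨G, q, hG⟩ := hg
  refine ⟨(pop .main).bind fun _ => (pop .main).bind fun _ => (pop .main).bind fun
    | some (.bit true) => F
    | _ => G, p + q + 3, fun x => ?_⟩
  obtain ⟨b, a⟩ := x
  have hp := p.monotone_eval_nat (show sz a ≤ sz (b, a) by simp only [sz_prod]; omega)
  have hq := q.monotone_eval_nat (show sz a ≤ sz (b, a) by simp only [sz_prod]; omega)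
  simp only [Polynomial.eval_add, Polynomial.eval_ofNat] at *
  have hFa := hF a
  have hGa := hG a
  cases b
  · refine ⟨by simp only [cond_false]; omega, fun m => ?_⟩
    exact (Runs.pop_bind (Runs.pop_bind (Runs.pop_bind (hGa.2 m)))).mono (by omega)
  · refine ⟨by simp only [cond_true]; omega, fun m => ?_⟩
    exact (Runs.pop_bind (Runs.pop_bind (Runs.pop_bind (hFa.2 m)))).mono (by omega)

theorem ite {p : α → Prop} [DecidablePred p] {f g : α → β} (hp : PolyFun fun a => decide (p a))
    (hf : PolyFun f) (hg : PolyFun g) : PolyFun fun a => if p a then f a else g a := by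
  have := hp.cond hf hg
  simpa only [Bool.cond_decide] using this

theorem not {p : α → Bool} (hp : PolyFun p) : PolyFun fun a => !p a := by
  convert hp.cond (const false) (const true) using 2 with a
  cases p a <;> rfl

theorem and {p q : α → Bool} (hp : PolyFun p) (hq : PolyFun q) : PolyFun fun a => p a && q a := by
  convert hp.cond hq (const false) using 2 with a
  cases p a <;> rfl

theorem or {p q : α → Bool} (hp : PolyFun p) (hq : PolyFun q) : PolyFun fun a => p a || q a := by
  convert hp.cond (const true) hq using 2 with a
  cases p a <;> rfl

theorem cons {f : α → β} {g : α → List β} (hf : PolyFun f) (hg : PolyFun g) :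
    PolyFun fun a => f a :: g a :=
  (hf.pair hg).congr_out fun _ => rfl

theorem some {f : α → β} (hf : PolyFun f) : PolyFun fun a => Option.some (f a) :=
  (hf.cons (const [])).congr_out fun _ => rfl

theorem listCase {l : α → List β} {f : α → γ} {g : α × β × List β → γ}
    (hl : PolyFun l) (hf : PolyFun f) (hg : PolyFun g) :
    PolyFun fun a => match l a with
      | [] => f a
      | b :: t => g (a, b, t) := by
  refine comp (g := fun x : List β × α => match x.1 with
      | [] => f x.2
      | b :: t => g (x.2, b, t)) ?_ (hl.pair .id)
  obtain ⟨F, p, hF⟩ := hf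
  obtain ⟨G, q, hG⟩ := hg
  -- A nonempty list is a node made of its head and its tail, hence already represents that pair:
  -- its node token is put back, it is exchanged with `a`, and a new node is formed.
  refine ⟨(pop .main).bind fun _ => (pop .main).bind fun
    | Option.some .app => (push .main .app).seq <| swap.seq <| (push .main .app).seq G
    | _ => (pop .main).bind fun _ => F, p + q + 19 * .X + 4, fun x => ?_⟩
  obtain ⟨l, a⟩ := x
  have hp := p.monotone_eval_nat (show sz a ≤ sz (l, a) by simp only [sz_prod]; omega)
  simp only [Polynomial.eval_add, Polynomial.eval_mul, Polynomial.eval_X,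
    Polynomial.eval_ofNat] at *
  cases l with
  | nil =>
    have hFa := hF a
    refine ⟨by dsimp only; omega, fun m => ?_⟩
    exact (Runs.pop_bind (Runs.pop_bind (Runs.pop_bind (hFa.2 m)))).mono (by omega)
  | cons b l =>
    have hGa := hG (a, b, l)
    have hq := q.monotone_eval_nat (show sz (a, b, l) ≤ sz (b :: l, a) by
      simp only [sz_prod, sz_cons]; omega)
    dsimp only at hq
    refine ⟨by dsimp only; omega, fun m => ?_⟩
    have h1 := runs_push .main .app (onMain ((rep b).enc ++ ((rep l).enc ++ ((rep a).enc ++ m))))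
    have h2 := runs_swap (rep (b :: l)) (rep a) m
    have h3 := runs_push .main .app (onMain ((rep a).enc ++ ((rep (b :: l)).enc ++ m)))
    have h4 := hGa.2 m
    simp only [sz_prod, sz_cons] at hq ⊢
    simp only [rep, repList, Data.enc, Store.set, Store.get, List.cons_append, List.append_assoc,
      Data.size] at h1 h2 h3 h4 ⊢
    refine (Runs.pop_bind (Runs.pop_bind (h1.seq (h2.seq (h3.seq h4))))).mono ?_
    simp only [sz, rep, Data.size] at hq ⊢
    omega

/-- While loops. -/
theorem whileLoop {t : σ → Bool} {f : σ → σ} {init h : α → σ} (ht : PolyFun t) (hf : PolyFun f)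
    (hinit : PolyFun init) (q : Polynomial ℕ)
    (H : ∀ a, ∃ n ≤ q.eval (sz a), h a = f^[n] (init a) ∧ t (f^[n] (init a)) = false ∧
      (∀ i < n, t (f^[i] (init a)) = true) ∧ ∀ i ≤ n, sz (f^[i] (init a)) ≤ q.eval (sz a)) :
    PolyFun h := by
  obtain ⟨I, v, hI⟩ := hinit
  obtain ⟨T, p, hT⟩ := ht
  obtain ⟨F, r, hF⟩ := hf
  refine ⟨I.seq <| iter <| dup.seq <| T.seq <| (pop .main).bind fun _ => (pop .main).bind fun
    | Option.some (.bit true) => F.bind fun _ => .pure none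
    | _ => .pure (Option.some ()),
    -- `v` pays for the initial state and the product for at most `q + 1` rounds of copying, testing
    -- and executing the body on states of size at most `q`; the last `q` bounds the output.
    v + (q + 1) * (19 * q + p.comp q + r.comp q + 4) + q, fun a => ?_⟩
  obtain ⟨n, hn, e, hfin, hlt, hsz⟩ := H a
  have hIa := (hI a).2
  generalize init a = s at *
  generalize sz a = N at *
  refine ⟨?_, fun m => ?_⟩
  · rw [e]
    refine (hsz n le_rfl).trans ?_
    simp only [Polynomial.eval_add]
    omega
  have hcost : ∀ i ≤ n, 19 * sz (f^[i] s) + p.eval (sz (f^[i] s)) + r.eval (sz (f^[i] s)) + 3 ≤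
      19 * q.eval N + p.eval (q.eval N) + r.eval (q.eval N) + 3 := by
    intro i hi
    have h1 := hsz i hi
    have h2 := p.monotone_eval_nat h1
    have h3 := r.monotone_eval_nat h1
    dsimp only at h2 h3
    omega
  set c := 19 * q.eval N + p.eval (q.eval N) + r.eval (q.eval N) + 4 with hc
  -- Induction on the number `j` of rounds that remain before the last test.
  have key : ∀ j i, i + j = n → (iter <| dup.seq <| T.seq <| (pop .main).bind fun _ =>
      (pop .main).bind fun
      | Option.some (.bit true) => F.bind fun _ => .pure none
      | _ => .pure (Option.some ())).Runs (onMain ((rep (f^[i] s)).enc ++ m)) ()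
        (onMain ((rep (f^[n] s)).enc ++ m)) ((j + 1) * c) := by
    intro j
    induction j with
    | zero =>
      intro i hi
      obtain rfl : i = n := by omega
      have h1 := (hT (f^[i] s)).2 ((rep (f^[i] s)).enc ++ m)
      rw [hfin] at h1
      refine (Runs.iter_done ((runs_dup _ _).seq (h1.seq (Runs.pop_bind (Runs.pop_bind
        (runs_pure (Option.some ()) _)))))).mono ?_
      have h2 := hcost i le_rfl
      simp only [sz] at *
      omega
    | succ j ih =>
      intro i hi
      have h1 := (hT (f^[i] s)).2 ((rep (f^[i] s)).enc ++ m)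
      rw [hlt i (by omega)] at h1
      have h2 := hcost i (by omega)
      have h3 := ih (i + 1) (by omega)
      rw [Function.iterate_succ_apply'] at h3
      refine (Runs.iter_next ((runs_dup _ _).seq (h1.seq (Runs.pop_bind (Runs.pop_bind
        (Runs.bind (G := fun _ => .pure none) ((hF _).2 m) (runs_pure none _)))))) h3).mono ?_
      simp only [sz] at *
      rw [Nat.succ_mul (j + 1) c]
      omega
  rw [e]
  refine ((hIa m).seq (key n 0 (by omega))).mono ?_
  simp only [Polynomial.eval_add, Polynomial.eval_mul, Polynomial.eval_comp,
    Polynomial.eval_ofNat, Polynomial.eval_one]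
  rw [add_assoc]
  exact Nat.add_le_add_left ((Nat.mul_le_mul (by omega) le_rfl).trans (Nat.le_add_right _ _)) _

/-- Iteration over a list, with a parameter. -/
theorem foldl {g : γ × β × α → β} {c : δ → γ} {l : δ → List α} {b : δ → β} (hg : PolyFun g)
    (hc : PolyFun c) (hl : PolyFun l) (hb : PolyFun b) (q : Polynomial ℕ)
    (hq : ∀ x l', l' <+: l x → sz (l'.foldl (fun b a => g (c x, b, a)) (b x)) ≤ q.eval (sz x)) :
    PolyFun fun x => (l x).foldl (fun b a => g (c x, b, a)) (b x) := by
  -- The loop state consists of the parameter, the unread part of the list and the accumulator.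
  let f : γ × List α × β → γ × List α × β := fun x => match x.2.1 with
    | [] => x
    | a :: l => (x.1, l, g (x.1, x.2.2, a))
  have hf : PolyFun f :=
    listCase (l := fun x : γ × List α × β => x.2.1) (f := fun x => x)
      (g := fun y => (y.1.1, y.2.2, g (y.1.1, y.1.2.2, y.2.1)))
      (snd .id |>.fst) .id
      ((fst .id).fst.pair ((snd .id).snd.pair
        (hg.comp ((fst .id).fst.pair ((fst .id).snd.snd.pair (snd .id).fst)))))
  have ht : PolyFun fun x : γ × List α × β => match x.2.1 with
    | [] => false
    | _ :: _ => true :=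
    listCase (l := fun x : γ × List α × β => x.2.1) (f := fun _ => false) (g := fun _ => true)
      (snd .id |>.fst) (const _) (const _)
  have hiter : ∀ (c : γ) (l : List α) (b : β) (i : ℕ), i ≤ l.length →
      f^[i] (c, l, b) = (c, l.drop i, (l.take i).foldl (fun b a => g (c, b, a)) b) := by
    intro c l b i
    induction i with
    | zero => intro _; simp
    | succ i ih =>
      intro hi
      rw [Function.iterate_succ_apply', ih (by omega)]
      have h1 : l.drop i = l[i] :: l.drop (i + 1) := List.drop_eq_getElem_cons (by omega)
      simp only [f, h1, List.take_succ_eq_append_getElem (show i < l.length by omega),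
        List.foldl_append, List.foldl_cons, List.foldl_nil]
  obtain ⟨p, hp⟩ := (hc.pair (hl.pair hb)).sz_le
  have hw := PolyFun.whileLoop (h := fun x => (c x, ([] : List α),
    (l x).foldl (fun b a => g (c x, b, a)) (b x))) ht hf (hc.pair (hl.pair hb)) (p + q + 2) (by
    intro x
    have hx := hp x
    have hqx := hq x
    generalize c x = c, l x = l, b x = b at *
    refine ⟨l.length, ?_, ?_, ?_, ?_, ?_⟩
    · have := length_le_sz l
      simp only [sz_prod, Polynomial.eval_add] at *
      omega
    · rw [hiter _ _ _ _ le_rfl]; simp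
    · rw [hiter _ _ _ _ le_rfl]; simp
    · intro i hi
      rw [hiter _ _ _ _ hi.le, List.drop_eq_getElem_cons hi]
    · intro i hi
      rw [hiter _ _ _ _ hi]
      have h1 := hqx _ (List.take_prefix i l)
      have h2 : sz (l.drop i) ≤ sz l := by
        have := sz_append (l.take i) (l.drop i)
        rw [List.take_append_drop] at this
        have := two_le_sz (l.take i)
        omega
      have := two_le_sz b
      simp only [sz_prod, Polynomial.eval_add, Polynomial.eval_ofNat] at *
      omega)
  exact hw.snd.snd

/-- Iteration over a list, when every step has a bounded growth. -/
theorem foldl_of_growth {g : γ × β × α → β} (hg : PolyFun g) (q : Polynomial ℕ)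
    (hq : ∀ c b a, sz (g (c, b, a)) ≤ sz b + q.eval (sz c + sz a)) :
    PolyFun fun x : γ × List α × β => x.2.1.foldl (fun b a => g (x.1, b, a)) x.2.2 := by
  -- The initial accumulator is below `X`, and there are at most `X` iterations, each adding at most
  -- `q`.
  refine foldl hg PolyFun.id.fst PolyFun.id.snd.fst PolyFun.id.snd.snd (.X + .X * q) ?_
  rintro ⟨c, l, b⟩ l' hl
  have key : ∀ (m : List α) (b' : β), (∀ a ∈ m, a ∈ l) →
      sz (m.foldl (fun b a => g (c, b, a)) b') ≤ sz b' + m.length * q.eval (sz (c, l, b)) := by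
    intro m
    induction m with
    | nil => intro b _; simp
    | cons a m ih =>
      intro b' hm
      have h1 := ih (g (c, b', a)) fun x hx => hm x (List.mem_cons_of_mem _ hx)
      have h2 := hq c b' a
      have h3 := sz_le_of_mem (hm a List.mem_cons_self)
      have h4 := q.monotone_eval_nat (show sz c + sz a ≤ sz (c, l, b) by
        simp only [sz_prod]; omega)
      dsimp only at h4
      simp only [List.foldl_cons, List.length_cons, Nat.succ_mul]
      omega
  refine (key l' b fun a ha => hl.subset ha).trans ?_
  simp only [Polynomial.eval_add, Polynomial.eval_mul, Polynomial.eval_X]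
  refine Nat.add_le_add (by simp only [sz_prod]; omega) (Nat.mul_le_mul ?_ le_rfl)
  have : l'.length ≤ l.length := hl.length_le
  have := length_le_sz l
  simp only [sz_prod]; omega

/-! ### Lists -/

theorem nil : PolyFun fun _ : α => ([] : List β) := const _

theorem reverse {l : α → List β} (hl : PolyFun l) : PolyFun fun a => (l a).reverse := by
  have h := foldl_of_growth (g := fun x : Unit × List β × β => x.2.2 :: x.2.1)
    (cons (PolyFun.id.snd.snd) (PolyFun.id.snd.fst)) (.X + 1) (fun c b a => by simp; omega)
  have h' := h.comp ((const ()).pair (hl.pair nil))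
  convert h' using 2 with a
  simp

theorem append {l m : α → List β} (hl : PolyFun l) (hm : PolyFun m) :
    PolyFun fun a => l a ++ m a := by
  have h := foldl_of_growth (g := fun x : Unit × List β × β => x.2.2 :: x.2.1)
    (cons (PolyFun.id.snd.snd) (PolyFun.id.snd.fst)) (.X + 1) (fun c b a => by simp; omega)
  have h' := h.comp ((const ()).pair (hl.reverse.pair hm))
  convert h' using 2 with a
  simp

/-- Mapping a function with a parameter over a list. -/
theorem map {g : γ × α → β} {c : δ → γ} {l : δ → List α} (hg : PolyFun g) (hc : PolyFun c)
    (hl : PolyFun l) : PolyFun fun x => (l x).map fun a => g (c x, a) := by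
  obtain ⟨q, hq⟩ := hg.sz_le
  have h := foldl_of_growth (g := fun x : γ × List β × α => g (x.1, x.2.2) :: x.2.1)
    (cons (hg.comp (PolyFun.id.fst.pair PolyFun.id.snd.snd)) (PolyFun.id.snd.fst))
    (q.comp (.X + 1) + 1) (fun c b a => by
      have := hq (c, a)
      simp only [sz_prod, sz_cons, Polynomial.eval_add, Polynomial.eval_comp, Polynomial.eval_X,
        Polynomial.eval_one] at *
      omega)
  have h' := h.comp (hc.pair (hl.reverse.pair nil))
  convert h' using 2 with x
  simp only
  rw [List.foldl_reverse]
  induction l x with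
  | nil => rfl
  | cons a t ih => rw [List.map_cons, ih, List.foldr_cons]

theorem filter {g : γ × α → Bool} {c : δ → γ} {l : δ → List α} (hg : PolyFun g) (hc : PolyFun c)
    (hl : PolyFun l) : PolyFun fun x => (l x).filter fun a => g (c x, a) := by
  have h := foldl_of_growth
    (g := fun x : γ × List α × α => bif g (x.1, x.2.2) then x.2.2 :: x.2.1 else x.2.1)
    ((hg.comp (PolyFun.id.fst.pair PolyFun.id.snd.snd)).cond
      (cons PolyFun.id.snd.snd PolyFun.id.snd.fst) PolyFun.id.snd.fst)
    (.X + 1) (fun c b a => by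
      cases g (c, a) <;> simp; omega)
  have h' := h.comp (hc.pair (hl.reverse.pair nil))
  convert h' using 2 with x
  simp only
  rw [List.foldl_reverse]
  induction l x with
  | nil => rfl
  | cons a t ih => cases h : g (c x, a) <;> simp [ih, h]

theorem any {g : γ × α → Bool} {c : δ → γ} {l : δ → List α} (hg : PolyFun g) (hc : PolyFun c)
    (hl : PolyFun l) : PolyFun fun x => (l x).any fun a => g (c x, a) := by
  have h := listCase (hg.filter hc hl) (const (α := δ) false) (const true)
  convert h using 2 with x
  induction l x with
  | nil => rfl
  | cons a t ih => cases h : g (c x, a) <;> simp only [List.any_cons, List.filter_cons, h, ih, Bool.true_or, Bool.false_or, if_true, Bool.false_eq_true, if_false]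

theorem find? {g : γ × α → Bool} {c : δ → γ} {l : δ → List α} (hg : PolyFun g) (hc : PolyFun c)
    (hl : PolyFun l) : PolyFun fun x => (l x).find? fun a => g (c x, a) := by
  have h := listCase (hg.filter hc hl) (const (α := δ) (none : Option α)) PolyFun.id.snd.fst.some
  convert h using 2 with x
  induction l x with
  | nil => rfl
  | cons a t ih => cases h : g (c x, a) <;> simp only [List.find?_cons, List.filter_cons, h, ih, if_true, Bool.false_eq_true, if_false]

theorem optionCase {o : α → Option β} {f : α → γ} {g : α × β → γ}
    (ho : PolyFun o) (hf : PolyFun f) (hg : PolyFun g) :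
    PolyFun fun a => match o a with
      | none => f a
      | Option.some b => g (a, b) := by
  have h := listCase (l := fun a => (o a).toList) (f := f) (g := fun x => g (x.1, x.2.1))
    (ho.congr_out fun _ => rfl) hf (hg.comp (PolyFun.id.fst.pair PolyFun.id.snd.fst))
  convert h using 2 with a
  cases o a <;> rfl

end PolyFun

end LSC

namespace LSC

open LSC.Rep

/-! ### Conversion between words and trees -/

namespace Frag

/-- Turns the content of the main stack into a list. -/
def load : Frag Unit :=
  (pour .main .left).seq <| (pushAll [.var, .endm]).seq <| iter <| (pop .left).bind fun
    | none => .pure (some ())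
    | some t => (push .main t).bind fun _ => (push .main .var).bind fun _ =>
      (push .main .app).bind fun _ => .pure none

theorem runs_load (l : List Tok) :
    load.Runs (onMain l) () (onMain (rep l).enc) (8 * l.length + 6) := by
  have h1 := runs_pour (k := .main) (k' := .left) (by decide) (onMain l)
  simp only [Store.get, Store.set, List.append_nil] at h1
  have h2 : ∀ (a r : List Tok), Runs (iter <| (pop .left).bind fun
      | none => .pure (some ())
      | some t => (push .main t).bind fun _ => (push .main .var).bind fun _ =>
        (push .main .app).bind fun _ => .pure none) ⟨(rep r).enc, a, [], []⟩ ()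
        (onMain (rep (a.reverse ++ r)).enc) (5 * a.length + 2) := by
    intro a
    induction a with
    | nil => exact fun r => Runs.iter_done (Runs.pop_bind (runs_pure _ _))
    | cons t a ih =>
      intro r
      have := ih (t :: r)
      refine (Runs.iter_next (n := 4) (Runs.pop_bind (Runs.push_bind (Runs.push_bind
        (Runs.push_bind (runs_pure none _))))) (S₁ := ⟨(rep (t :: r)).enc, a, [], []⟩)
          (m := 5 * a.length + 2) ?_).mono ?_
      · simpa using this
      · simp only [List.length_cons]; omega
  refine (h1.seq (Runs.seq (n := 2) (m := 5 * l.length + 2) (S₁ := ⟨[.var, .endm], l.reverse, [], []⟩) ?_ ?_)).mono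
    (by omega)
  · exact ((runs_pure () _).seq (runs_push .main .endm ⟨[], l.reverse, [], []⟩)).seq
      (runs_push .main .var _)
  · have h4 := h2 l.reverse []
    rw [List.reverse_reverse, List.append_nil, List.length_reverse] at h4
    exact h4

/-- Turns a list into the content of the main stack. -/
def unload : Frag Unit :=
  (iter <| (pop .main).bind fun
    | some .app => (pop .main).bind fun _ => (pop .main).bind fun
      | some t => (push .left t).bind fun _ => .pure none
      | none => .pure (some ())
    | _ => (pop .main).bind fun _ => .pure (some ())).seq (pour .left .main)

theorem runs_unload (l : List Tok) :
    unload.Runs (onMain (rep l).enc) () (onMain l) (8 * l.length + 5) := by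
  have h2 : ∀ (l a : List Tok), Runs (iter <| (pop .main).bind fun
      | some .app => (pop .main).bind fun _ => (pop .main).bind fun
        | some t => (push .left t).bind fun _ => .pure none
        | none => .pure (some ())
      | _ => (pop .main).bind fun _ => .pure (some ())) ⟨(rep l).enc, a, [], []⟩ ()
        ⟨[], l.reverse ++ a, [], []⟩ (5 * l.length + 3) := by
    intro l
    induction l with
    | nil => exact fun a => Runs.iter_done (Runs.pop_bind (Runs.pop_bind (runs_pure (some ()) _)))
    | cons t l ih =>
      intro a
      have := ih (t :: a)
      refine (Runs.iter_next (n := 4) (Runs.pop_bind (Runs.pop_bind (Runs.pop_bind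
        (Runs.push_bind (runs_pure none _))))) (S₁ := ⟨(rep l).enc, t :: a, [], []⟩)
          (m := 5 * l.length + 3) ?_).mono ?_
      · simpa using this
      · simp only [List.length_cons]; omega
  have h3 := runs_pour (k := .left) (k' := .main) (by decide) ⟨[], l.reverse, [], []⟩
  simp only [Store.get, Store.set, List.append_nil, List.reverse_reverse, List.length_reverse] at h3
  have h4 := h2 l []
  rw [List.append_nil] at h4
  exact (h4.seq h3).mono (by omega)

end Frag

theorem sz_word (l : List Tok) : sz l = 3 * l.length + 2 := by
  induction l with
  | nil => rfl
  | cons t l ih => simp [ih]; omega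

/-- Polynomial time functions on encodings give rise to polynomial time Turing machines. -/
theorem PolyFun.polyTime {α β γ : Type} [Rep γ] {ca : Code α} {cb : Code β} {f : α → β}
    {g : γ → List Tok} (hg : PolyFun g) (i : α → γ) (hi : ∀ a, rep (i a) = rep (ca.enc a))
    (hfg : ∀ a, g (i a) = cb.enc (f a)) : PolyTime ca cb f := by
  obtain ⟨F, p, hF⟩ := hg
  -- A word of length `n` has size `3 * n + 2` as a list, whence the composition. Loading and
  -- unloading cost `8` steps per letter, and the output is at most as long as its size bound.
  refine Frag.polyTime_of_runs (Frag.load.seq (F.seq Frag.unload))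
    (8 * .X + 11 + 9 * p.comp (3 * .X + 2)) fun a => ?_
  have h1 := Frag.runs_load (ca.enc a)
  have h2 := hF (i a)
  have h3 := h2.2 []
  rw [hfg] at h2 h3
  have e : sz (i a) = sz (ca.enc a) := by simp only [sz, hi]
  rw [hi, e, List.append_nil, List.append_nil] at h3
  refine (h1.seq (h3.seq (Frag.runs_unload _))).mono ?_
  have h4 := h2.1
  rw [e] at h4
  rw [sz_word, sz_word] at *
  simp only [Polynomial.eval_add, Polynomial.eval_mul, Polynomial.eval_comp, Polynomial.eval_X,
    Polynomial.eval_ofNat]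
  omega

/-! ### Binary numbers -/

open Computability (encodeNat encodeNum encodePosNum)

/-- The successor in binary notation. -/
def succBits : List Bool → List Bool
  | [] => [true]
  | false :: l => true :: l
  | true :: l => false :: succBits l

/-- The predecessor in binary notation. -/
def predBits : List Bool → List Bool
  | [] => []
  | false :: l => true :: predBits l
  | [true] => []
  | true :: l => false :: l

theorem encodePosNum_succ (n : PosNum) : encodePosNum n.succ = succBits (encodePosNum n) := by
  induction n with
  | one => rfl
  | bit1 n ih => simp [encodePosNum, PosNum.succ, succBits, ih]
  | bit0 n ih => rfl

theorem encodePosNum_ne_nil (n : PosNum) : encodePosNum n ≠ [] := by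
  cases n <;> simp [encodePosNum]

/-- The lowest digit `true` is simply cleared, unless it is the only one, when the canonical numeral
for zero is empty. The even case therefore needs the remaining digits to be nonempty. -/
theorem predBits_succBits (n : PosNum) : predBits (succBits (encodePosNum n)) = encodePosNum n := by
  induction n with
  | one => rfl
  | bit1 n ih => simp [encodePosNum, predBits, succBits, ih]
  | bit0 n ih =>
    have := encodePosNum_ne_nil n
    cases h : encodePosNum n with
    | nil => exact absurd h this
    | cons b l => simp [encodePosNum, succBits, h, predBits]

theorem encodeNat_succ (n : ℕ) : encodeNat (n + 1) = succBits (encodeNat n) := by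
  have : ((n + 1 : ℕ) : Num) = (n : Num).succ := by
    rw [Nat.cast_add, Nat.cast_one, Num.add_one]
  rw [encodeNat, encodeNat, this]
  cases (n : Num) with
  | zero => rfl
  | pos p => exact encodePosNum_succ p

theorem encodeNat_pred (n : ℕ) : encodeNat (n - 1) = predBits (encodeNat n) := by
  cases n with
  | zero => rfl
  | succ n =>
    rw [encodeNat_succ, Nat.add_sub_cancel, encodeNat]
    cases (n : Num) with
    | zero => rfl
    | pos p => exact (predBits_succBits p).symm

theorem encodeNat_injective : Function.Injective encodeNat :=
  Function.LeftInverse.injective Computability.decode_encodeNat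

theorem encodeNat_eq_nil {n : ℕ} : encodeNat n = [] ↔ n = 0 :=
  ⟨fun h => encodeNat_injective (h.trans rfl), fun h => by subst h; rfl⟩

theorem sz_succBits (l : List Bool) : sz (succBits l) ≤ sz l + 3 := by
  induction l with
  | nil => simp [succBits]
  | cons b l ih => cases b <;> simp [succBits]; omega

theorem sz_predBits (l : List Bool) : sz (predBits l) ≤ sz l := by
  induction l with
  | nil => simp [predBits]
  | cons b l ih =>
    cases b
    · simpa [predBits] using ih
    · cases l <;> simp [predBits]

namespace PolyFun

variable {α β γ δ σ : Type} [Rep α] [Rep β] [Rep γ] [Rep δ] [Rep σ]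

/-- One pass from the lowest digit; the state is the carry and the reversed output, and a carry left
at the end is written as a new top digit. -/
theorem succBits_polyFun : PolyFun succBits := by
  have h := foldl_of_growth (α := Bool) (β := Bool × List Bool) (γ := Unit)
    (g := fun x => bif x.2.1.1 then
      (bif x.2.2 then (true, false :: x.2.1.2) else (false, true :: x.2.1.2))
      else (false, x.2.2 :: x.2.1.2))
    (PolyFun.id.snd.fst.fst.cond (PolyFun.id.snd.snd.cond
      ((const true).pair ((const false).cons PolyFun.id.snd.fst.snd))
      ((const false).pair ((const true).cons PolyFun.id.snd.fst.snd)))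
      ((const false).pair (PolyFun.id.snd.snd.cons PolyFun.id.snd.fst.snd))) 3
    (by rintro _ ⟨c, b⟩ a; cases c <;> cases a <;> simp <;> omega)
  have h' := h.comp ((const (α := List Bool) ()).pair (PolyFun.id.pair (const (true, []))))
  have h'' := (h'.fst.cond ((const true).cons h'.snd) h'.snd).reverse
  convert h'' using 2 with l
  have key : ∀ l acc : List Bool,
      (List.foldl (fun (b : Bool × List Bool) a => bif b.1 then
        (bif a then (true, false :: b.2) else (false, true :: b.2)) else (false, a :: b.2))
        (false, acc) l) = (false, l.reverse ++ acc) := by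
    intro l
    induction l with
    | nil => simp
    | cons b l ih => intro acc; simp [ih]
  have key2 : ∀ l acc : List Bool, ∀ r,
      (List.foldl (fun (b : Bool × List Bool) a => bif b.1 then
        (bif a then (true, false :: b.2) else (false, true :: b.2)) else (false, a :: b.2))
        (true, acc) l) = r → acc.reverse ++ succBits l =
        (bif r.1 then true :: r.2 else r.2).reverse := by
    rintro l acc r rfl
    induction l generalizing acc with
    | nil => simp [succBits]
    | cons b l ih =>
      cases b
      · simp [succBits, key]
      · simpa [succBits] using ih (false :: acc)
  simpa using key2 l [] _ rfl

/-- One pass from the lowest digit. The first flag is the borrow. Once the borrow is absorbed, the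
second flag records that the digit `false` is still owed; it is written only if another digit
follows, which avoids a leading zero. -/
theorem predBits_polyFun : PolyFun predBits := by
  have h := foldl_of_growth (α := Bool) (β := (Bool × Bool) × List Bool) (γ := Unit)
    (g := fun x => bif x.2.1.1.1 then
      (bif x.2.2 then ((false, true), x.2.1.2) else ((true, true), true :: x.2.1.2))
      else ((false, false), bif x.2.1.1.2 then x.2.2 :: false :: x.2.1.2 else x.2.2 :: x.2.1.2))
    (PolyFun.id.snd.fst.fst.fst.cond (PolyFun.id.snd.snd.cond
      ((const (false, true)).pair PolyFun.id.snd.fst.snd)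
      ((const (true, true)).pair ((const true).cons PolyFun.id.snd.fst.snd)))
      ((const (false, false)).pair (PolyFun.id.snd.fst.fst.snd.cond
        (PolyFun.id.snd.snd.cons ((const false).cons PolyFun.id.snd.fst.snd))
        (PolyFun.id.snd.snd.cons PolyFun.id.snd.fst.snd)))) 6
    (by rintro _ ⟨⟨c, d⟩, b⟩ a; cases c <;> cases d <;> cases a <;> simp <;> omega)
  have h' := h.comp ((const (α := List Bool) ()).pair
    (PolyFun.id.pair (const ((true, true), []))))
  have h'' := h'.snd.reverse
  convert h'' using 2 with l
  generalize hg : (fun (b : (Bool × Bool) × List Bool) a => bif b.1.1 then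
    (bif a then ((false, true), b.2) else ((true, true), true :: b.2))
      else ((false, false), bif b.1.2 then a :: false :: b.2 else a :: b.2)) = g
  have key : ∀ l acc : List Bool, (l.foldl g ((false, false), acc)).2 = l.reverse ++ acc := by
    intro l
    induction l with
    | nil => simp
    | cons b l ih => intro acc; subst hg; simp [ih]
  have key2 : ∀ l acc : List Bool,
      acc.reverse ++ predBits l = (l.foldl g ((true, true), acc)).2.reverse := by
    intro l
    induction l with
    | nil => simp [predBits]
    | cons b l ih =>
      intro acc
      cases b
      · have := ih (true :: acc)
        subst hg
        simpa [predBits] using this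
      · cases l with
        | nil => subst hg; simp [predBits]
        | cons b l =>
          have := key l (b :: false :: acc)
          subst hg
          simp [predBits, this]
  simpa using key2 l []

theorem succ {f : α → ℕ} (hf : PolyFun f) : PolyFun fun a => f a + 1 :=
  (succBits_polyFun.comp (hf.congr_out (g := fun a => encodeNat (f a)) fun _ => rfl)).congr_out
    fun a => by rw [← encodeNat_succ]; rfl

theorem pred {f : α → ℕ} (hf : PolyFun f) : PolyFun fun a => f a - 1 :=
  (predBits_polyFun.comp (hf.congr_out (g := fun a => encodeNat (f a)) fun _ => rfl)).congr_out
    fun a => by rw [← encodeNat_pred]; rfl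

theorem isZero {f : α → ℕ} (hf : PolyFun f) : PolyFun fun a => decide (f a = 0) := by
  have h := listCase (hf.congr_out (g := fun a => encodeNat (f a)) fun _ => rfl) (const true)
    (const false)
  convert h using 2 with a
  cases h : encodeNat (f a) with
  | nil => simpa using encodeNat_eq_nil.1 h
  | cons b l =>
    simp only [decide_eq_false_iff_not]
    intro h0
    rw [encodeNat_eq_nil.2 h0] at h
    cases h

/-- A fold over the first word whose state is the verdict so far and the unread part of the second
word, which has to be empty at the end. If the second word runs out early, the verdict becomes
`false` for good. -/
theorem bitsEq {f g : α → List Bool} (hf : PolyFun f) (hg : PolyFun g) :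
    PolyFun fun a => decide (f a = g a) := by
  have h := foldl_of_growth (α := Bool) (β := Bool × List Bool) (γ := Unit)
    (g := fun x => match x.2.1.2 with
      | [] => (false, [])
      | b :: l => (bif b then x.2.2 && x.2.1.1 else !x.2.2 && x.2.1.1, l))
    (by
      have h0 := listCase (l := fun x : Unit × (Bool × List Bool) × Bool => x.2.1.2)
        (f := fun _ => (false, ([] : List Bool)))
        (g := fun y => (bif y.2.1 then y.1.2.2 && y.1.2.1.1 else !y.1.2.2 && y.1.2.1.1, y.2.2))
        PolyFun.id.snd.fst.snd (const (false, []))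
        ((PolyFun.id.snd.fst.cond (PolyFun.id.fst.snd.snd.and PolyFun.id.fst.snd.fst.fst)
          (PolyFun.id.fst.snd.snd.not.and PolyFun.id.fst.snd.fst.fst)).pair PolyFun.id.snd.snd)
      convert h0 using 2 with x
      obtain ⟨_, ⟨c, _ | ⟨b, l⟩⟩, a⟩ := x <;> rfl) 0
    (by rintro _ ⟨c, _ | ⟨b, l⟩⟩ a <;> simp; omega)
  have h' := h.comp ((const (α := α) ()).pair (hf.pair ((const true).pair hg)))
  have h'' := h'.fst.and (listCase h'.snd (const true) (const false))
  convert h'' using 2 with a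
  generalize f a = l
  generalize g a = m
  simp only
  generalize hstep : (fun (b : Bool × List Bool) (a : Bool) => match b.2 with
    | [] => (false, [])
    | b' :: l => (bif b' then a && b.1 else !a && b.1, l)) = step
  have key : ∀ (l m : List Bool) (c : Bool),
      (c && decide (l = m)) = ((l.foldl step (c, m)).1 && match (l.foldl step (c, m)).2 with
        | [] => true
        | _ :: _ => false) := by
    intro l
    induction l with
    | nil => intro m c; cases m <;> simp
    | cons a l ih =>
      intro m c
      rw [List.foldl_cons]
      cases m with
      | nil =>
        have h0 : step (c, []) a = (false, []) := by subst hstep; rfl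
        rw [h0, ← ih]; simp
      | cons b m =>
        have h0 : step (c, b :: m) a = (bif b then a && c else !a && c, m) := by subst hstep; rfl
        rw [h0, ← ih]
        cases a <;> cases b <;> cases c <;> simp
  have := key l m true
  rw [Bool.true_and] at this
  rw [this]
  cases (l.foldl step (true, m)).2 <;> rfl

theorem natEq {f g : α → ℕ} (hf : PolyFun f) (hg : PolyFun g) :
    PolyFun fun a => decide (f a = g a) := by
  have h := bitsEq (hf.congr_out (g := fun a => encodeNat (f a)) fun _ => rfl)
    (hg.congr_out (g := fun a => encodeNat (g a)) fun _ => rfl)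
  convert h using 3 with a
  exact encodeNat_injective.eq_iff.symm

/-- Addition of a number in unary notation. -/
theorem addUnary {f : α → ℕ} {k : α → List Unit} (hf : PolyFun f) (hk : PolyFun k) :
    PolyFun fun a => f a + (k a).length := by
  have h := foldl_of_growth (α := Unit) (β := ℕ) (γ := Unit) (g := fun x => x.2.1 + 1)
    PolyFun.id.snd.fst.succ 3 (fun _ b _ => by
      have := sz_succBits (encodeNat b)
      rw [← encodeNat_succ] at this
      simp only [Polynomial.eval_ofNat]
      exact this)
  convert h.comp ((const ()).pair (hk.pair hf)) using 2 with a
  simp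

/-- Truncated subtraction of a number in unary notation. -/
theorem subUnary {f : α → ℕ} {k : α → List Unit} (hf : PolyFun f) (hk : PolyFun k) :
    PolyFun fun a => f a - (k a).length := by
  have h := foldl_of_growth (α := Unit) (β := ℕ) (γ := Unit) (g := fun x => x.2.1 - 1)
    PolyFun.id.snd.fst.pred 0 (fun _ b _ => by
      have := sz_predBits (encodeNat b)
      rw [← encodeNat_pred] at this
      exact this.trans (Nat.le_add_right _ _))
  convert h.comp ((const ()).pair (hk.pair hf)) using 2 with a
  simp only
  generalize f a = n
  induction k a generalizing n with
  | nil => simp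
  | cons u l ih => simp only [List.length_cons, List.foldl_cons, ← ih]; omega

theorem ltUnary {f : α → ℕ} {k : α → List Unit} (hf : PolyFun f) (hk : PolyFun k) :
    PolyFun fun a => decide (f a < (k a).length) := by
  -- With truncated subtraction, `f < k` means `f + 1 - k = 0`.
  convert (hf.succ.subUnary hk).isZero using 3 with a
  omega

end PolyFun

end LSC

namespace LSC

open LSC.Rep
open Computability (encodeNat encodeNum encodePosNum)

/-! ### The set operations -/

@[simp] theorem Timed.val_bind {α β : Type} (x : Timed α) (f : α → Timed β) :
    (x >>= f).val = (f x.val).val := rfl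

@[simp] theorem Timed.steps_bind {α β : Type} (x : Timed α) (f : α → Timed β) :
    (x >>= f).steps = x.steps + (f x.val).steps := rfl

@[simp] theorem Timed.val_pure {α : Type} (a : α) : (pure a : Timed α).val = a := rfl

@[simp] theorem Timed.steps_pure {α : Type} (a : α) : (pure a : Timed α).steps = 0 := rfl

@[simp] theorem steps_tick : tick.steps = 1 := rfl

theorem memT_val (x : ℕ) (V : List ℕ) : (memT x V).val = decide (x ∈ V) := by
  induction V with
  | nil => rfl
  | cons y V ih =>
    simp only [memT, Timed.val_bind]
    split_ifs with h
    · simp [h]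
    · simp [h, ih]

theorem unionT_val (V W : List ℕ) :
    (unionT V W).val = V.foldr (fun x U => if x ∈ U then U else x :: U) W := by
  induction V with
  | nil => rfl
  | cons x V ih =>
    simp only [unionT, Timed.val_bind, Timed.val_pure, memT_val, List.foldr_cons, ← ih,
      decide_eq_true_eq]

theorem mem_unionT {V W : List ℕ} {y : ℕ} : y ∈ (unionT V W).val ↔ y ∈ V ∨ y ∈ W := by
  rw [unionT_val]
  induction V with
  | nil => simp
  | cons x V ih =>
    rw [List.foldr_cons]
    split_ifs with h
    · rw [ih, List.mem_cons, or_assoc]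
      refine ⟨Or.inr, ?_⟩
      rintro (rfl | h')
      · exact ih.1 h
      · exact h'
    · rw [List.mem_cons, ih, List.mem_cons, or_assoc]

theorem length_unionT (V W : List ℕ) : (unionT V W).val.length ≤ V.length + W.length := by
  rw [unionT_val]
  induction V with
  | nil => simp
  | cons x V ih =>
    rw [List.foldr_cons]
    split_ifs <;> simp <;> omega

theorem removeT_val (k : ℕ) (V : List ℕ) :
    (removeT k V).val = (V.filter fun y => !decide (y = k)).map (unbindVar k) := by
  induction V with
  | nil => rfl
  | cons y V ih =>
    simp only [removeT, Timed.val_bind, Timed.val_pure, ih, List.filter_cons]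
    split_ifs <;> simp_all

theorem mem_removeT {k : ℕ} {V : List ℕ} {y : ℕ} :
    y ∈ (removeT k V).val ↔ ∃ z ∈ V, z ≠ k ∧ unbindVar k z = y := by
  simp [removeT_val, and_assoc]

theorem length_removeT (k : ℕ) (V : List ℕ) : (removeT k V).val.length ≤ V.length := by
  rw [removeT_val, List.length_map]
  exact List.length_filter_le _ _

theorem raiseT_val (k : ℕ) (V : List ℕ) : (raiseT k V).val = V.map (· + k) := by
  induction V with
  | nil => rfl
  | cons y V ih => simp [raiseT, ih]

theorem memT_steps (x : ℕ) (V : List ℕ) : (memT x V).steps ≤ V.length + 1 := by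
  induction V with
  | nil => simp [memT]
  | cons y V ih =>
    simp only [memT, Timed.steps_bind]
    split_ifs <;> simp <;> omega

/-- Each element of `V` is looked up in a list no longer than the two arguments together. -/
theorem unionT_steps (V W : List ℕ) :
    (unionT V W).steps ≤ (V.length + 1) * (V.length + W.length + 2) := by
  induction V with
  | nil => simp [unionT]
  | cons x V ih =>
    have h1 := memT_steps x (unionT V W).val
    have h2 := length_unionT V W
    simp only [unionT, Timed.steps_bind, steps_tick, Timed.steps_pure, List.length_cons]
    nlinarith

theorem removeT_steps (k : ℕ) (V : List ℕ) : (removeT k V).steps = V.length + 1 := by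
  induction V with
  | nil => simp [removeT]
  | cons y V ih => simp [removeT, ih]; omega

theorem raiseT_steps (k : ℕ) (V : List ℕ) : (raiseT k V).steps = V.length + 1 := by
  induction V with
  | nil => simp [raiseT]
  | cons y V ih => simp [raiseT, ih]; omega

/-! ### The clauses of the algorithms in polynomial time -/

/-- The flag and the list of variables tell the three natures apart: an application is the one with
neither. -/
instance : Rep Nature := ⟨fun n => rep (decide (n = .lam), n.vars)⟩
instance : Rep Tuple := ⟨fun a => rep (a.nature, a.redex, a.apvars, a.freevars)⟩

namespace PolyFun

variable {α β γ δ σ : Type} [Rep α] [Rep β] [Rep γ] [Rep δ] [Rep σ]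

theorem mem {x : α → ℕ} {V : α → List ℕ} (hx : PolyFun x) (hV : PolyFun V) :
    PolyFun fun a => decide (x a ∈ V a) := by
  have h := any (g := fun y : ℕ × ℕ => decide (y.1 = y.2)) (natEq PolyFun.id.fst PolyFun.id.snd)
    hx hV
  convert h using 2 with a
  induction V a with
  | nil => simp
  | cons y V ih => simp [← ih]

theorem union {V W : α → List ℕ} (hV : PolyFun V) (hW : PolyFun W) :
    PolyFun fun a => (unionT (V a) (W a)).val := by
  have h := foldl_of_growth (γ := Unit)
    (g := fun x : Unit × List ℕ × ℕ => if x.2.2 ∈ x.2.1 then x.2.1 else x.2.2 :: x.2.1)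
    (ite (mem PolyFun.id.snd.snd PolyFun.id.snd.fst) PolyFun.id.snd.fst
      (PolyFun.id.snd.snd.cons PolyFun.id.snd.fst)) (.X + 1) (fun c b a => by
        simp only [Polynomial.eval_add, Polynomial.eval_X, Polynomial.eval_one]
        split_ifs <;> simp <;> omega)
  convert h.comp ((const ()).pair (hV.reverse.pair hW)) using 2 with a
  simp only
  rw [List.foldl_reverse, unionT_val]

/-- The index of a substitution counts abstractions of the context, so its unary form is no longer
than the input; arithmetic with it reduces to iterated successors and predecessors. -/
theorem ofUnary {k : α → List Unit} (hk : PolyFun k) : PolyFun fun a => (k a).length := by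
  simpa using (const (α := α) 0).addUnary hk

theorem unbind {k : α → List Unit} {y : α → ℕ} (hk : PolyFun k) (hy : PolyFun y) :
    PolyFun fun a => unbindVar (k a).length (y a) :=
  (hy.ltUnary hk).ite hy hy.pred

theorem remove {k : α → List Unit} {V : α → List ℕ} (hk : PolyFun k) (hV : PolyFun V) :
    PolyFun fun a => (removeT (k a).length (V a)).val := by
  have h := map (g := fun x : List Unit × ℕ => unbindVar x.1.length x.2)
    (unbind PolyFun.id.fst PolyFun.id.snd) hk
    (filter (g := fun x : List Unit × ℕ => !decide (x.2 = x.1.length))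
      (natEq PolyFun.id.snd PolyFun.id.fst.ofUnary).not hk hV)
  convert h using 2 with a
  rw [removeT_val]

theorem raise {k : α → List Unit} {V : α → List ℕ} (hk : PolyFun k) (hV : PolyFun V) :
    PolyFun fun a => (raiseT (k a).length (V a)).val := by
  have h := map (g := fun x : List Unit × ℕ => x.2 + x.1.length)
    (PolyFun.id.snd.addUnary PolyFun.id.fst) hk hV
  convert h using 2 with a
  rw [raiseT_val]

section Fields

variable {a : α → Tuple} {n : α → Nature}

theorem isLam (hn : PolyFun n) : PolyFun fun x => decide (n x = .lam) :=
  (hn.congr_out (g := fun x => (decide (n x = .lam), (n x).vars)) fun _ => rfl).fst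

theorem vars (hn : PolyFun n) : PolyFun fun x => (n x).vars :=
  (hn.congr_out (g := fun x => (decide (n x = .lam), (n x).vars)) fun _ => rfl).snd

theorem fields (ha : PolyFun a) :
    PolyFun fun x => ((a x).nature, (a x).redex, (a x).apvars, (a x).freevars) :=
  ha.congr_out fun _ => rfl

theorem nature (ha : PolyFun a) : PolyFun fun x => (a x).nature := ha.fields.fst
theorem redex (ha : PolyFun a) : PolyFun fun x => (a x).redex := ha.fields.snd.fst
theorem apvars (ha : PolyFun a) : PolyFun fun x => (a x).apvars := ha.fields.snd.snd.fst
theorem freevars (ha : PolyFun a) : PolyFun fun x => (a x).freevars := ha.fields.snd.snd.snd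

theorem raiseNature {k : α → List Unit} (hk : PolyFun k) (hn : PolyFun n) :
    PolyFun fun x => (n x).raise (k x).length :=
  (hn.isLam.pair (raise hk hn.vars)).congr_out fun x => by
    cases h : n x <;> simp [rep, Nature.raise, Nature.vars, raiseT_val]

end Fields

theorem varCase : PolyFun fun x : ℕ => (varCase x).val :=
  (((const false).pair (PolyFun.id.cons nil)).pair
    ((const false).pair (nil.pair (PolyFun.id.cons nil)))).congr_out fun _ => rfl

theorem lamCase : PolyFun fun a : Tuple => (lamCase a).val :=
  ((const Nature.lam).pair (PolyFun.id.redex.pair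
    ((remove (const []) PolyFun.id.apvars).pair
      (remove (const []) PolyFun.id.freevars)))).congr_out fun _ => rfl

theorem appCase : PolyFun fun x : Tuple × Tuple => (appCase x.1 x.2).val :=
  ((const Nature.app).pair
    (((PolyFun.id.fst.redex.or PolyFun.id.snd.redex).or PolyFun.id.fst.nature.isLam).pair
    (((PolyFun.id.fst.apvars.union PolyFun.id.snd.apvars).union PolyFun.id.fst.nature.vars).pair
      (PolyFun.id.fst.freevars.union PolyFun.id.snd.freevars)))).congr_out fun _ => rfl

theorem esCase :
    PolyFun fun x : List Unit × Tuple × Tuple => (esCase x.1.length x.2.1 x.2.2).val := by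
  have hk := (PolyFun.id (α := List Unit × Tuple × Tuple)).fst
  have ha := (PolyFun.id (α := List Unit × Tuple × Tuple)).snd.fst
  have hb := (PolyFun.id (α := List Unit × Tuple × Tuple)).snd.snd
  have hnu := raiseNature hk hb.nature
  have hV := mem hk.ofUnary ha.apvars
  have hW := mem hk.ofUnary ha.freevars
  -- On representations, the nature is the variable `k` exactly when `k` belongs to its list of
  -- variables. Otherwise the flag is kept and the list is renamed, uniformly in the three natures.
  have hn := ite (mem hk.ofUnary ha.nature.vars) (hnu.isLam.pair hnu.vars)
    (ha.nature.isLam.pair (map (g := fun x : List Unit × ℕ => unbindVar x.1.length x.2)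
      (unbind PolyFun.id.fst PolyFun.id.snd) hk ha.nature.vars))
  refine (hn.pair (((ha.redex.or (hb.redex.and hW)).or (hnu.isLam.and hV)).pair
    ((((remove hk ha.apvars).union (hW.cond (raise hk hb.apvars) nil)).union
      (hV.cond hnu.vars nil)).pair
    ((remove hk ha.freevars).union (hW.cond (raise hk hb.freevars) nil))))).congr_out ?_
  rintro ⟨K, a, b⟩
  simp only [LSC.esCase, Timed.val_bind, Timed.val_pure, memT_val]
  refine congrArg₂ Data.node ?_ ?_
  · cases ha : a.nature with
    | var y =>
      simp only [Nature.vars, List.map_cons, List.map_nil, List.mem_singleton, eq_comm (b := y)]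
      split_ifs <;> rfl
    | lam => rfl
    | app => rfl
  · simp only [Bool.cond_eq_ite]

end PolyFun

end LSC

namespace LSC

open LSC.Rep
open Computability (encodeNat encodeNum encodePosNum)

/-! ### Reading binary numbers -/

/-- The value of a word in binary notation. -/
def ofBits (l : List Bool) : ℕ := l.foldr (fun b n => 2 * n + b.toNat) 0

/-- Zero has the empty numeral, whence the exceptional case. The identity lets a numeral be rebuilt
in canonical form digit by digit. -/
theorem encodeNat_bit (n : ℕ) (b : Bool) :
    encodeNat (2 * n + b.toNat) = if n = 0 ∧ b = false then [] else b :: encodeNat n := by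
  have hn := Num.to_of_nat n
  cases h : (n : Num) with
  | zero =>
    rw [h] at hn
    obtain rfl : n = 0 := hn.symm
    cases b <;> rfl
  | pos p =>
    rw [h] at hn
    obtain rfl : (p : ℕ) = n := hn
    have hp : (p : ℕ) ≠ 0 := p.to_nat_pos.ne'
    rw [if_neg (by tauto)]
    have h1 : (((2 * p + b.toNat : ℕ)) : Num) = Num.pos (cond b p.bit1 p.bit0) := by
      rw [← Num.of_to_nat (Num.pos (cond b p.bit1 p.bit0))]
      congr 1
      cases b <;> simp [two_mul]
    rw [encodeNat, encodeNat, h1, h]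
    cases b <;> rfl

theorem ofBits_encodeNat (n : ℕ) : ofBits (encodeNat n) = n := by
  have key : ∀ p : PosNum, ofBits (encodePosNum p) = p := by
    intro p
    induction p with
    | one => rfl
    | bit1 p ih => simp [encodePosNum, ofBits] at *; omega
    | bit0 p ih => simp [encodePosNum, ofBits] at *; omega
  rw [encodeNat]
  conv_rhs => rw [← Num.to_of_nat n]
  cases (n : Num) with
  | zero => rfl
  | pos p => exact key p

/-- Together with `lt_two_pow_length_encodeNat`, this trades numeral lengths for bounds `n < 2 ^ s`,
which are convenient under arithmetic on indices. -/
theorem length_encodeNat_le {n s : ℕ} (h : n < 2 ^ s) : (encodeNat n).length ≤ s := by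
  induction s generalizing n with
  | zero =>
    obtain rfl : n = 0 := by simpa using h
    simp [encodeNat_eq_nil.2]
  | succ s ih =>
    obtain ⟨m, b, rfl⟩ : ∃ m b, n = 2 * m + Bool.toNat b :=
      ⟨n / 2, decide (n % 2 = 1), by
        rcases Nat.mod_two_eq_zero_or_one n with h | h <;> simp [h] <;> omega⟩
    rw [encodeNat_bit]
    split_ifs
    · simp
    · have := ih (n := m) (by rw [pow_succ] at h; omega)
      simpa using this

theorem lt_two_pow_length_encodeNat (n : ℕ) : n < 2 ^ (encodeNat n).length := by
  conv_lhs => rw [← ofBits_encodeNat n]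
  generalize encodeNat n = l
  induction l with
  | nil => simp [ofBits]
  | cons b l ih =>
    have : b.toNat ≤ 1 := Bool.toNat_le b
    simp only [ofBits, List.foldr_cons, List.length_cons, pow_succ] at *
    omega

theorem sz_nat (n : ℕ) : sz n = 3 * (encodeNat n).length + 2 := by
  show sz (encodeNat n) = _
  generalize encodeNat n = l
  induction l with
  | nil => rfl
  | cons b l ih => simp [ih]; omega

theorem PolyFun.ofBits {α : Type} [Rep α] {l : α → List Bool} (hl : PolyFun l) :
    PolyFun fun a => ofBits (l a) := by
  have h := foldl_of_growth (γ := Unit) (g := fun x : Unit × ℕ × Bool => 2 * x.2.1 + x.2.2.toNat)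
    (PolyFun.congr_out (PolyFun.ite (p := fun x : Unit × ℕ × Bool => x.2.1 = 0 ∧ x.2.2 = false)
      (by
        have := (PolyFun.id (α := Unit × ℕ × Bool)).snd.fst.isZero.and PolyFun.id.snd.snd.not
        convert this using 2 with x
        cases x.2.2 <;> simp)
      (const []) (PolyFun.id.snd.snd.cons
        (PolyFun.congr_out PolyFun.id.snd.fst (g := fun x => encodeNat x.2.1) fun _ => rfl)))
      fun x => by rw [← encodeNat_bit]; rfl) 3 (fun _ n b => by
        rw [sz_nat, sz_nat, encodeNat_bit]
        simp only [Polynomial.eval_ofNat]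
        split_ifs <;> simp; omega)
  convert h.comp ((const ()).pair (hl.reverse.pair (const 0))) using 2 with a
  simp [LSC.ofBits]

/-! ### Trees in Polish notation -/

/-- The binary constructors of terms and contexts. -/
inductive BinOp : Type
  | app | appL | appR | es

def BinOp.tok : BinOp → Tok
  | .app => .app
  | .appL => .appL
  | .appR => .appR
  | .es => .es

/-- The common syntax of terms and contexts. -/
inductive Raw : Type
  | var (n : ℕ) : Raw
  | hole : Raw
  | lam (t : Raw) : Raw
  | bin (o : BinOp) (t u : Raw) : Raw

/-- Interpretations of the constructors. -/
structure RawAlg (γ β : Type) where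
  var : γ → ℕ → β
  hole : γ → β
  lam : γ → β → β
  bin : BinOp → γ → β → β → β

namespace Raw

def enc : Raw → List Tok
  | var n => .var :: encNat n
  | hole => [.hole]
  | lam t => .lam :: t.enc
  | bin o t u => o.tok :: (t.enc ++ u.enc)

/-- Structural recursion. -/
def fold {γ β : Type} (A : RawAlg γ β) (c : γ) : Raw → β
  | var n => A.var c n
  | hole => A.hole c
  | lam t => A.lam c (t.fold A c)
  | bin o t u => A.bin o c (t.fold A c) (u.fold A c)

end Raw

instance : Rep Raw := ⟨fun r => rep r.enc⟩

/-- Sequences of trees, represented by the concatenation of their encodings. -/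
structure Forest : Type where
  trees : List Raw

def Forest.enc (r : Forest) : List Tok := r.trees.flatMap Raw.enc

instance : Rep Forest := ⟨fun r => rep r.enc⟩

/-! ### Evaluation of Polish notation from right to left -/

section RawStep

variable {γ β : Type} (A : RawAlg γ β) (c : γ)

/-- One step of the evaluation of an encoding, read from the right to the left: the state consists
of the digits of the current number and of the stack of values. -/
def rawStep (s : List Bool × List β) (t : Tok) : List Bool × List β :=
  match t with
  | .bit b => (b :: s.1, s.2)
  | .var => ([], A.var c (ofBits s.1) :: s.2)
  | .hole => ([], A.hole c :: s.2)
  | .lam => ([], match s.2 with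
    | [] => []
    | b :: st => A.lam c b :: st)
  | .app => ([], match s.2 with
    | a :: b :: st => A.bin .app c a b :: st
    | st => st)
  | .appL => ([], match s.2 with
    | a :: b :: st => A.bin .appL c a b :: st
    | st => st)
  | .appR => ([], match s.2 with
    | a :: b :: st => A.bin .appR c a b :: st
    | st => st)
  | .es => ([], match s.2 with
    | a :: b :: st => A.bin .es c a b :: st
    | st => st)
  | .endm => ([], s.2)
  | .some => ([], s.2)

def rawRun (l : List Tok) (s : List Bool × List β) : List Bool × List β :=
  l.foldr (fun t s => rawStep A c s t) s

theorem rawRun_append (l m : List Tok) (s : List Bool × List β) :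
    rawRun A c (l ++ m) s = rawRun A c l (rawRun A c m s) := List.foldr_append

theorem rawRun_bits (l : List Bool) (s : List Bool × List β) :
    rawRun A c (l.map .bit) s = (l ++ s.1, s.2) := by
  induction l with
  | nil => rfl
  | cons b l ih =>
    show rawStep A c (rawRun A c (l.map .bit) s) (.bit b) = _
    rw [ih]; rfl

/-- Read backwards, Polish notation is postfix: when a constructor is met, the values of its
arguments are on top of the stack, the first one uppermost. The end marker, met before the digits of
a number, empties the digit buffer. -/
theorem rawRun_enc (r : Raw) (s : List Bool × List β) :
    rawRun A c r.enc s = ([], r.fold A c :: s.2) := by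
  induction r generalizing s with
  | var n =>
    show rawStep A c (rawRun A c (encNat n) s) .var = _
    rw [encNat, rawRun_append, rawRun_bits]
    show ([], A.var c (ofBits (encodeNat n ++ [])) :: s.2) = _
    rw [List.append_nil, ofBits_encodeNat]
    rfl
  | hole => rfl
  | lam t ih =>
    show rawStep A c (rawRun A c t.enc s) .lam = _
    rw [ih]; rfl
  | bin o t u iht ihu =>
    show rawStep A c (rawRun A c (t.enc ++ u.enc) s) o.tok = _
    rw [rawRun_append, ihu, iht]
    cases o <;> rfl

theorem rawRun_flatMap (l : List Raw) (s : List Bool × List β) :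
    (rawRun A c (l.flatMap Raw.enc) s).2 = l.map (Raw.fold A c) ++ s.2 := by
  induction l with
  | nil => rfl
  | cons r l ih => rw [List.flatMap_cons, rawRun_append, rawRun_enc, ih]; rfl

theorem length_rawRun (l : List Tok) (s : List Bool × List β) :
    (rawRun A c l s).1.length ≤ s.1.length + l.length ∧
      (rawRun A c l s).2.length ≤ s.2.length + l.length := by
  induction l with
  | nil => exact ⟨le_rfl, le_rfl⟩
  | cons t l ih =>
    have key : ∀ s : List Bool × List β, (rawStep A c s t).1.length ≤ s.1.length + 1 ∧
        (rawStep A c s t).2.length ≤ s.2.length + 1 := by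
      rintro ⟨a, _ | ⟨x, _ | ⟨y, st⟩⟩⟩ <;> cases t <;> simp [rawStep]
    have h : rawRun A c (t :: l) s = rawStep A c (rawRun A c l s) t := rfl
    have := key (rawRun A c l s)
    rw [h, List.length_cons]
    omega

/-- All the values on the stack come from trees of bounded size. -/
def StackBound (N : ℕ) (st : List β) : Prop := ∀ b ∈ st, ∃ r : Raw, b = r.fold A c ∧ r.enc.length ≤ N

theorem _root_.List.suffix_append_cases {α : Type} {w a b : List α} (h : w <:+ a ++ b) :
    w <:+ b ∨ ∃ m, w = m ++ b ∧ m <:+ a := by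
  induction a with
  | nil => exact .inl h
  | cons x a ih =>
    rcases List.suffix_cons_iff.1 h with rfl | h
    · exact .inr ⟨x :: a, rfl, List.suffix_rfl⟩
    · rcases ih h with h | ⟨m, rfl, hm⟩
      · exact .inl h
      · exact .inr ⟨m, rfl, hm.trans (List.suffix_cons _ _)⟩

variable {A c}

theorem StackBound.rawRun_enc {N : ℕ} {r : Raw} {s : List Bool × List β} (hr : r.enc.length ≤ N)
    (hs : StackBound A c N s.2) : StackBound A c N (rawRun A c r.enc s).2 := by
  intro b hb
  rw [LSC.rawRun_enc] at hb
  rcases List.mem_cons.1 hb with rfl | hb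
  · exact ⟨r, rfl, hr⟩
  · exact hs b hb

theorem rawRun_snd_of_digits {l : List Tok} (hl : ∀ t ∈ l, t = .endm ∨ ∃ b, t = .bit b)
    (s : List Bool × List β) : (rawRun A c l s).2 = s.2 := by
  induction l with
  | nil => rfl
  | cons t l ih =>
    rw [← ih fun t ht => hl t (List.mem_cons_of_mem _ ht)]
    rcases hl t List.mem_cons_self with rfl | ⟨b, rfl⟩ <;> rfl

/-- Even halfway through an encoding, each value pushed by the run is that of a complete subtree.
Bounds on folds thus control all intermediate stacks, whereas a bound on the growth per step could
compound to an exponential. -/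
theorem StackBound.rawRun_suffix {N : ℕ} {r : Raw} (hr : r.enc.length ≤ N) {w : List Tok}
    (hw : w <:+ r.enc) {s : List Bool × List β} (hs : StackBound A c N s.2) :
    StackBound A c N (rawRun A c w s).2 := by
  induction r generalizing w s with
  | var n =>
    rcases List.suffix_cons_iff.1 hw with rfl | hw
    · exact hs.rawRun_enc (r := .var n) hr
    · rw [rawRun_snd_of_digits]
      · exact hs
      · intro t ht
        have := hw.subset ht
        simp only [encNat, List.mem_append, List.mem_map, List.mem_singleton] at this
        rcases this with ⟨b, _, rfl⟩ | rfl
        · exact .inr ⟨b, rfl⟩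
        · exact .inl rfl
  | hole =>
    rcases List.suffix_cons_iff.1 hw with rfl | hw
    · exact hs.rawRun_enc (r := .hole) hr
    · rw [List.suffix_nil.1 hw]; exact hs
  | lam t ih =>
    rcases List.suffix_cons_iff.1 hw with rfl | hw
    · exact hs.rawRun_enc (r := .lam t) hr
    · exact ih (by simp only [Raw.enc, List.length_cons] at hr; omega) hw hs
  | bin o t u iht ihu =>
    rcases List.suffix_cons_iff.1 hw with rfl | hw
    · exact hs.rawRun_enc (r := .bin o t u) hr
    · simp only [Raw.enc, List.length_cons, List.length_append] at hr
      rcases List.suffix_append_cases hw with hw | ⟨m, rfl, hm⟩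
      · exact ihu (by omega) hw hs
      · rw [rawRun_append]
        exact iht (by omega) hm (hs.rawRun_enc (by omega))

theorem StackBound.rawRun_flatMap_suffix {N : ℕ} {l : List Raw}
    (hl : (l.flatMap Raw.enc).length ≤ N) {w : List Tok} (hw : w <:+ l.flatMap Raw.enc)
    {s : List Bool × List β} (hs : StackBound A c N s.2) :
    StackBound A c N (rawRun A c w s).2 := by
  have full : ∀ l : List Raw, (l.flatMap Raw.enc).length ≤ N →
      StackBound A c N (rawRun A c (l.flatMap Raw.enc) s).2 := by
    intro l hl
    induction l with
    | nil => exact hs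
    | cons r l ih =>
      simp only [List.flatMap_cons, List.length_append] at hl
      rw [List.flatMap_cons, rawRun_append]
      exact (ih (by omega)).rawRun_enc (by omega)
  induction l with
  | nil => rw [List.suffix_nil.1 hw]; exact hs
  | cons r l ih =>
    simp only [List.flatMap_cons, List.length_append] at hl hw
    rcases List.suffix_append_cases hw with hw | ⟨m, rfl, hm⟩
    · exact ih (by omega) hw
    · rw [rawRun_append]
      exact StackBound.rawRun_suffix (by omega) hm (full l (by omega))

end RawStep

/-- The constructors of an interpretation are polynomial time functions. -/
structure RawAlg.Poly {γ β : Type} [Rep γ] [Rep β] (A : RawAlg γ β) : Prop where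
  var : PolyFun fun x : γ × ℕ => A.var x.1 x.2
  hole : PolyFun A.hole
  lam : PolyFun fun x : γ × β => A.lam x.1 x.2
  bin : ∀ o, PolyFun fun x : γ × β × β => A.bin o x.1 x.2.1 x.2.2

namespace PolyFun

variable {γ β δ : Type} [Rep γ] [Rep β] [Rep δ]

theorem popTwo {A : RawAlg γ β} (hA : A.Poly) (o : BinOp) :
    PolyFun fun x : γ × (List Bool × List β) × Tok => match x.2.1.2 with
      | a :: b :: st => A.bin o x.1 a b :: st
      | st => st := by
  have h1 := listCase (l := fun y : (γ × (List Bool × List β) × Tok) × β × List β => y.2.2)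
    (f := fun y => y.2.1 :: y.2.2)
    (g := fun z => A.bin o z.1.1.1 z.1.2.1 z.2.1 :: z.2.2) PolyFun.id.snd.snd
    (PolyFun.id.snd.fst.cons PolyFun.id.snd.snd)
    (((hA.bin o).comp (PolyFun.id.fst.fst.fst.pair
      (PolyFun.id.fst.snd.fst.pair PolyFun.id.snd.fst))).cons PolyFun.id.snd.snd)
  have h2 := listCase (l := fun x : γ × (List Bool × List β) × Tok => x.2.1.2)
    PolyFun.id.snd.fst.snd nil h1
  convert h2 using 2 with x
  obtain ⟨c, ⟨a, _ | ⟨x, _ | ⟨y, st⟩⟩⟩, t⟩ := x <;> rfl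

theorem rawStep {A : RawAlg γ β} (hA : A.Poly) :
    PolyFun fun x : γ × (List Bool × List β) × Tok => rawStep A x.1 x.2.1 x.2.2 := by
  have ht := (PolyFun.id (α := γ × (List Bool × List β) × Tok)).snd.snd
  have hc := (PolyFun.id (α := γ × (List Bool × List β) × Tok)).fst
  have hs := (PolyFun.id (α := γ × (List Bool × List β) × Tok)).snd.fst
  have hlam := listCase (l := fun x : γ × (List Bool × List β) × Tok => x.2.1.2)
    hs.snd nil ((hA.lam.comp (PolyFun.id.fst.fst.pair PolyFun.id.snd.fst)).cons PolyFun.id.snd.snd)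
  have hbit := (ht.tokTest fun t => decide (t = .bit true)).cons hs.fst
  have h := (ht.tokTest fun t => decide (t = .bit true) || decide (t = .bit false)).cond
    (hbit.pair hs.snd) <| nil.pair <|
    (ht.tokTest fun t => decide (t = .var)).cond
      ((hA.var.comp (hc.pair hs.fst.ofBits)).cons hs.snd) <|
    (ht.tokTest fun t => decide (t = .hole)).cond ((hA.hole.comp hc).cons hs.snd) <|
    (ht.tokTest fun t => decide (t = .lam)).cond hlam <|
    (ht.tokTest fun t => decide (t = .app)).cond (popTwo hA .app) <|
    (ht.tokTest fun t => decide (t = .appL)).cond (popTwo hA .appL) <|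
    (ht.tokTest fun t => decide (t = .appR)).cond (popTwo hA .appR) <|
    (ht.tokTest fun t => decide (t = .es)).cond (popTwo hA .es) hs.snd
  convert h using 2 with x
  obtain ⟨c, s, t⟩ := x
  cases t with
  | bit b => cases b <;> rfl
  | _ => rfl

/-- Structural recursion over a sequence of trees. -/
theorem foldForest {A : RawAlg γ β} (hA : A.Poly) {c : δ → γ} {r : δ → Forest}
    (hc : PolyFun c) (hr : PolyFun r) (q : Polynomial ℕ)
    (hq : ∀ x, ∀ t : Raw, t.enc.length ≤ (r x).enc.length → sz (t.fold A (c x)) ≤ q.eval (sz x)) :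
    PolyFun fun x => (r x).trees.map (Raw.fold A (c x)) := by
  obtain ⟨p, hp⟩ := hr.sz_le
  have hl : PolyFun fun x => (r x).enc := hr.congr_out fun _ => rfl
  have h := foldl (rawStep hA) hc hl.reverse (const (([], []) : List Bool × List β))
    -- `4 * p` covers the buffered digits and `p * (q + 1)` a stack of at most `p` values of size at
    -- most `q`.
    (4 * p + p * (q + 1) + 10) ?_
  · convert h.snd using 2 with x
    have := rawRun_flatMap A (c x) (r x).trees ([], [])
    rw [List.append_nil] at this
    rw [← this, List.foldl_reverse]
    rfl
  · intro x l' hl'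
    have e : l'.foldl (fun b a => LSC.rawStep A (c x) b a) ([], []) =
        rawRun A (c x) l'.reverse ([], []) := by
      rw [rawRun, List.foldr_reverse]
    have hw : l'.reverse <:+ (r x).enc := by
      rw [← List.reverse_prefix, List.reverse_reverse]
      exact hl'
    have h1 := StackBound.rawRun_flatMap_suffix (A := A) (c := c x) (s := ([], [])) le_rfl hw
      (fun b hb => by simp at hb)
    have h2 := length_rawRun A (c x) l'.reverse ([], [])
    have h3 := hw.length_le
    have h4 := hp x
    change sz (r x).enc ≤ _ at h4
    rw [sz_word] at h4
    simp only
    rw [e]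
    generalize rawRun A (c x) l'.reverse ([], []) = s at *
    obtain ⟨a, st⟩ := s
    have ha : sz a = 3 * a.length + 2 := by
      generalize a = l
      induction l with
      | nil => rfl
      | cons b l ih => simp [ih]; omega
    have hst : sz st ≤ 2 + st.length * (q.eval (sz x) + 1) := by
      have hb : ∀ b ∈ st, sz b ≤ q.eval (sz x) := by
        intro b hb
        obtain ⟨t, rfl, ht⟩ := h1 b hb
        exact hq x t ht
      clear h1 h2 e
      induction st with
      | nil => simp
      | cons b st ih =>
        have := hb b List.mem_cons_self
        have := ih fun b' hb' => hb b' (List.mem_cons_of_mem _ hb')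
        simp only [sz_cons, List.length_cons, Nat.succ_mul]
        omega
    have h5 : st.length * (q.eval (sz x) + 1) ≤ p.eval (sz x) * (q.eval (sz x) + 1) :=
      Nat.mul_le_mul (by simp at h2 h3; omega) le_rfl
    simp only [sz_prod, Polynomial.eval_add, Polynomial.eval_mul, Polynomial.eval_ofNat,
      Polynomial.eval_one, List.length_nil] at *
    omega

/-- Structural recursion over a tree. -/
theorem foldRaw {A : RawAlg γ β} (hA : A.Poly) {c : δ → γ} {r : δ → Raw}
    (hc : PolyFun c) (hr : PolyFun r) (q : Polynomial ℕ)
    (hq : ∀ x, ∀ t : Raw, t.enc.length ≤ (r x).enc.length → sz (t.fold A (c x)) ≤ q.eval (sz x))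
    (b : β) : PolyFun fun x => (r x).fold A (c x) := by
  have h := foldForest (r := fun x => ⟨[r x]⟩) hA hc
    (hr.congr_out fun x => by simp [rep, Forest.enc]) q (by simpa [Forest.enc] using hq)
  -- The default `b` is never returned, since a single tree gives a list of one value.
  have h2 := listCase h (const b) PolyFun.id.snd.fst
  convert h2 using 2
  rfl

end PolyFun

end LSC

namespace LSC

open LSC.Rep
open Computability (encodeNat encodeNum encodePosNum)

/-! ### Number of steps -/

theorem length_vars (n : Nature) : n.vars.length ≤ 1 := by cases n <;> simp [Nature.vars]

theorem length_ite_nil {c : Prop} [Decidable c] (l : List ℕ) :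
    (if c then l else []).length ≤ l.length := by split_ifs <;> simp

/-- Bounds on the lengths of the lists of a tuple. -/
structure Tuple.Short (n : ℕ) (a : Tuple) : Prop where
  apvars : a.apvars.length ≤ n
  freevars : a.freevars.length ≤ n

theorem Tuple.Short.mono {n m : ℕ} {a : Tuple} (h : a.Short n) (hnm : n ≤ m) : a.Short m :=
  ⟨h.1.trans hnm, h.2.trans hnm⟩

theorem varCase_short (x : ℕ) : (varCase x).val.Short 1 := ⟨by simp [varCase], by simp [varCase]⟩

theorem Tuple.Short.lamCase {n : ℕ} {a : Tuple} (h : a.Short n) : (lamCase a).val.Short n :=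
  ⟨(length_removeT _ _).trans h.1, (length_removeT _ _).trans h.2⟩

/-- The extra unit is for the head variable of the application, which may join the applied
variables. -/
theorem Tuple.Short.appCase {n m : ℕ} {a b : Tuple} (ha : a.Short n) (hb : b.Short m) :
    (appCase a b).val.Short (n + m + 1) := by
  have h1 := length_unionT (unionT a.apvars b.apvars).val a.nature.vars
  have h2 := length_unionT a.apvars b.apvars
  have h3 := length_unionT a.freevars b.freevars
  have h4 := length_vars a.nature
  have := ha.1; have := ha.2; have := hb.1; have := hb.2
  constructor <;> simp only [LSC.appCase, Timed.val_bind, Timed.val_pure] <;> omega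

theorem Tuple.Short.esCase {n m k : ℕ} {a b : Tuple} (ha : a.Short n) (hb : b.Short m) :
    (esCase k a b).val.Short (n + m + 1) := by
  obtain ⟨ha1, ha2⟩ := ha
  obtain ⟨hb1, hb2⟩ := hb
  have e1 : (raiseT k b.apvars).val.length = b.apvars.length := by simp [raiseT_val]
  have e2 : (raiseT k b.freevars).val.length = b.freevars.length := by simp [raiseT_val]
  have h1 := length_removeT k a.apvars
  have h2 := length_removeT k a.freevars
  have h3 := length_ite_nil (c := (memT k a.freevars).val = true) (raiseT k b.apvars).val
  have h4 := length_ite_nil (c := (memT k a.freevars).val = true) (raiseT k b.freevars).val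
  have h5 := length_ite_nil (c := (memT k a.apvars).val = true) (b.nature.raise k).vars
  have h6 := length_vars (b.nature.raise k)
  constructor <;> simp only [LSC.esCase, Timed.val_bind, Timed.val_pure]
  · refine (length_unionT _ _).trans ?_
    have := length_unionT (removeT k a.apvars).val
      (if (memT k a.freevars).val = true then (raiseT k b.apvars).val else [])
    omega
  · refine (length_unionT _ _).trans ?_
    omega

theorem unionT_steps_le {V W : List ℕ} {n m : ℕ} (hV : V.length ≤ n) (hW : W.length ≤ m) :
    (unionT V W).steps ≤ (n + 1) * (n + m + 2) :=
  (unionT_steps V W).trans (Nat.mul_le_mul (by omega) (by omega))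

/-- A bound on the cost of a clause. -/
def caseCost (n : ℕ) : ℕ := 40 * (n + 1) ^ 2

theorem caseCost_pos (n : ℕ) : 1 ≤ caseCost n := Nat.mul_pos (by omega) (by positivity)

theorem lamCase_steps {n : ℕ} {a : Tuple} (h : a.Short n) :
    (lamCase a).steps ≤ caseCost n := by
  have := h.1; have := h.2
  have := Nat.zero_le (n ^ 2)
  simp only [lamCase, Timed.steps_bind, steps_tick, Timed.steps_pure, removeT_steps, caseCost]
  linarith

theorem appCase_steps {n : ℕ} {a b : Tuple} (ha : a.Short n) (hb : b.Short n) :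
    (appCase a b).steps ≤ caseCost n := by
  have h1 := unionT_steps_le ha.1 hb.1
  have h2 := unionT_steps_le ha.2 hb.2
  have h3 := unionT_steps_le (n := n + n) ((length_unionT a.apvars b.apvars).trans
    (Nat.add_le_add ha.1 hb.1)) (length_vars a.nature)
  have := Nat.zero_le (n ^ 2)
  simp only [appCase, Timed.steps_bind, steps_tick, Timed.steps_pure, caseCost]
  linarith

theorem esCase_steps {n k : ℕ} {a b : Tuple} (ha : a.Short n) (hb : b.Short n) :
    (esCase k a b).steps ≤ caseCost n := by
  obtain ⟨ha1, ha2⟩ := ha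
  obtain ⟨hb1, hb2⟩ := hb
  have e1 : (raiseT k b.apvars).val.length ≤ n := by simpa [raiseT_val] using hb1
  have e2 : (raiseT k b.freevars).val.length ≤ n := by simpa [raiseT_val] using hb2
  have h1 := (length_removeT k a.apvars).trans ha1
  have h2 := (length_removeT k a.freevars).trans ha2
  have h3 := (length_ite_nil (c := (memT k a.freevars).val = true) (raiseT k b.apvars).val).trans e1
  have h4 := (length_ite_nil (c := (memT k a.freevars).val = true)
    (raiseT k b.freevars).val).trans e2
  have h5 := (length_ite_nil (c := (memT k a.apvars).val = true) (b.nature.raise k).vars).trans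
    (length_vars (b.nature.raise k))
  have s1 := memT_steps k a.apvars
  have s2 := memT_steps k a.freevars
  have s3 := unionT_steps_le h1 h3
  have s4 := unionT_steps_le ((length_unionT _ _).trans (Nat.add_le_add h1 h3)) h5
  have s5 := unionT_steps_le h2 h4
  have := Nat.zero_le (n ^ 2)
  simp only [esCase, Timed.steps_bind, steps_tick, Timed.steps_pure, removeT_steps, raiseT_steps,
    caseCost]
  linarith

/-- Each constructor adds at most one element to each list. This linear bound is what makes the cost
of a clause polynomial. -/
theorem Ag_short (t : LTerm) : (Ag t).val.Short t.size := by
  induction t with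
  | var x => exact varCase_short x
  | lam t ih => exact ih.lamCase.mono (by simp [LTerm.size])
  | app t u iht ihu => exact iht.appCase ihu

theorem Bg_es_val (t u : Term) : (Bg (.es t u)).val = (esCase 0 (Bg t).val (Bg u).val).val := rfl

theorem Bg_short (t : Term) : (Bg t).val.Short t.size := by
  induction t with
  | var x => exact varCase_short x
  | lam t ih => exact ih.lamCase.mono (by simp [Term.size])
  | app t u iht ihu => exact iht.appCase ihu
  | es t u iht ihu =>
    rw [Bg_es_val]
    exact iht.esCase ihu

theorem Cg_short (t : Term) (C : Ctx) : (Cg t C).val.Short (t.size + C.size) := by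
  induction C with
  | hole => exact (Bg_short t).mono (by simp)
  | lam C ih => exact ih.mono (by simp [Ctx.size])
  | appL C u ih => exact ih.mono (by simp [Ctx.size]; omega)
  | appR u C ih => exact ih.mono (by simp [Ctx.size]; omega)
  | es C u ih => exact (ih.esCase (k := (lamDepthT C).val) (Bg_short u)).mono (by simp [Ctx.size]; omega)

/-- `N` bounds the size of the whole input and stays fixed in the induction, so that every
constructor is charged the same amount. -/
theorem Ag_steps {N : ℕ} (t : LTerm) (h : t.size ≤ N) :
    (Ag t).steps ≤ t.size * caseCost N := by
  have pos := caseCost_pos N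
  induction t with
  | var x => simpa [Ag, varCase, LTerm.size] using pos
  | lam t ih =>
    simp only [LTerm.size] at h
    have h1 := lamCase_steps ((Ag_short t).mono (m := N) (by omega))
    have h2 := ih (by omega)
    simp only [Ag, Timed.steps_bind, LTerm.size, Nat.succ_mul]
    omega
  | app t u iht ihu =>
    simp only [LTerm.size] at h
    have h1 := appCase_steps ((Ag_short t).mono (m := N) (by omega))
      ((Ag_short u).mono (m := N) (by omega))
    have h2 := iht (by omega)
    have h3 := ihu (by omega)
    simp only [Ag, Timed.steps_bind, LTerm.size, Nat.succ_mul, Nat.add_mul]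
    omega

theorem Bg_steps {N : ℕ} (t : Term) (h : t.size ≤ N) :
    (Bg t).steps ≤ t.size * caseCost N := by
  have pos := caseCost_pos N
  induction t with
  | var x => simpa [Bg, varCase, Term.size] using pos
  | lam t ih =>
    simp only [Term.size] at h
    have h1 := lamCase_steps ((Bg_short t).mono (m := N) (by omega))
    have h2 := ih (by omega)
    simp only [Bg, Timed.steps_bind, Term.size, Nat.succ_mul]
    omega
  | app t u iht ihu =>
    simp only [Term.size] at h
    have h1 := appCase_steps ((Bg_short t).mono (m := N) (by omega))
      ((Bg_short u).mono (m := N) (by omega))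
    have h2 := iht (by omega)
    have h3 := ihu (by omega)
    simp only [Bg, Timed.steps_bind, Term.size, Nat.succ_mul, Nat.add_mul]
    omega
  | es t u iht ihu =>
    simp only [Term.size] at h
    have h1 := esCase_steps (k := 0) ((Bg_short t).mono (m := N) (by omega))
      ((Bg_short u).mono (m := N) (by omega))
    have h2 := iht (by omega)
    have h3 := ihu (by omega)
    simp only [Bg, Timed.steps_bind, Term.size, Nat.succ_mul, Nat.add_mul]
    omega

theorem lamDepthT_val (C : Ctx) : (lamDepthT C).val = C.lamDepth := by
  induction C <;> simp_all [lamDepthT, Ctx.lamDepth]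

theorem lamDepthT_steps (C : Ctx) : (lamDepthT C).steps ≤ C.size := by
  induction C <;> simp_all [lamDepthT, Ctx.size] <;> omega

/-- The additional `N` per constructor pays for `lamDepthT`, which is run anew at each explicit
substitution of the context. -/
theorem Cg_steps {N : ℕ} (t : Term) (C : Ctx) (h : t.size + C.size ≤ N) :
    (Cg t C).steps ≤ (t.size + C.size) * (caseCost N + N) := by
  have pos := caseCost_pos N
  induction C with
  | hole =>
    simp only [Ctx.size] at h
    have := Bg_steps t (N := N) (by omega)
    simp only [Cg, Timed.steps_bind, steps_tick, Ctx.size, Nat.succ_mul, Nat.mul_add]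
    omega
  | lam C ih =>
    simp only [Ctx.size] at h
    have := ih (by omega)
    simp only [Cg, Timed.steps_bind, steps_tick, Ctx.size, ← Nat.add_assoc, Nat.succ_mul]
    omega
  | appL C u ih =>
    simp only [Ctx.size] at h
    have := ih (by omega)
    simp only [Cg, Timed.steps_bind, steps_tick, Ctx.size, ← Nat.add_assoc, Nat.succ_mul,
      Nat.add_mul] at *
    omega
  | appR u C ih =>
    simp only [Ctx.size] at h
    have := ih (by omega)
    simp only [Cg, Timed.steps_bind, steps_tick, Ctx.size, ← Nat.add_assoc, Nat.succ_mul,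
      Nat.add_mul] at *
    omega
  | es C u ih =>
    simp only [Ctx.size] at h
    have h1 := ih (by omega)
    have h2 := Bg_steps u (N := N) (by omega)
    have h3 := lamDepthT_steps C
    have h4 := esCase_steps (k := (lamDepthT C).val) ((Cg_short t C).mono (m := N) (by omega))
      ((Bg_short u).mono (m := N) (by omega))
    simp only [Cg, Timed.steps_bind, Ctx.size, ← Nat.add_assoc, Nat.succ_mul, Nat.add_mul,
      Nat.mul_add] at *
    omega

/-! ### Sizes of the tuples -/

/-- A bound on the size of a tuple. -/
structure Tuple.Small (m : ℕ) (a : Tuple) : Prop extends a.Short m where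
  lt_of_mem : ∀ y, y ∈ a.nature.vars ∨ y ∈ a.apvars ∨ y ∈ a.freevars → y < 2 ^ m

theorem Tuple.Small.mono {n m : ℕ} {a : Tuple} (h : a.Small n) (hnm : n ≤ m) : a.Small m :=
  ⟨h.toShort.mono hnm, fun y hy => (h.lt_of_mem y hy).trans_le (Nat.pow_le_pow_right (by omega) hnm)⟩

theorem varCase_small {n m : ℕ} (h : n < 2 ^ m) (hm : 1 ≤ m) : (varCase n).val.Small m :=
  ⟨(varCase_short n).mono hm, by simpa [varCase, Nature.vars] using h⟩

theorem unbindVar_le (k y : ℕ) : unbindVar k y ≤ y := by unfold unbindVar; split_ifs <;> omega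

theorem Tuple.Small.lamCase {m : ℕ} {a : Tuple} (h : a.Small m) : (lamCase a).val.Small m := by
  refine ⟨h.toShort.lamCase, ?_⟩
  rintro y (hy | hy | hy)
  · simp [LSC.lamCase, Nature.vars] at hy
  · obtain ⟨z, hz, -, rfl⟩ := mem_removeT.1 hy
    exact (unbindVar_le _ _).trans_lt (h.lt_of_mem z (by tauto))
  · obtain ⟨z, hz, -, rfl⟩ := mem_removeT.1 hy
    exact (unbindVar_le _ _).trans_lt (h.lt_of_mem z (by tauto))

theorem Tuple.Small.appCase {n m : ℕ} {a b : Tuple} (ha : a.Small n) (hb : b.Small m) :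
    (appCase a b).val.Small (n + m + 1) := by
  refine ⟨ha.toShort.appCase hb.toShort, fun y hy => ?_⟩
  have ha' := (ha.mono (m := n + m + 1) (by omega)).lt_of_mem y
  have hb' := (hb.mono (m := n + m + 1) (by omega)).lt_of_mem y
  simp only [LSC.appCase, Timed.val_bind, Timed.val_pure, mem_unionT, Nature.vars,
    List.not_mem_nil, false_or] at hy
  tauto

/-- Since `k < 2 ^ k`, raising an index by `k` costs at most `k` bits. -/
theorem add_lt_two_pow {y n k m : ℕ} (hy : y < 2 ^ n) (h : n + k ≤ m) : y + k < 2 ^ m := by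
  have h1 : k < 2 ^ k := Nat.lt_two_pow_self
  have h2 : 2 ^ (n + k) ≤ 2 ^ m := Nat.pow_le_pow_right (by omega) h
  rw [pow_add] at h2
  nlinarith

theorem mem_vars_raise {k y : ℕ} {n : Nature} (h : y ∈ (n.raise k).vars) :
    ∃ z ∈ n.vars, y = z + k := by
  cases n <;> simp_all [Nature.raise, Nature.vars]

theorem Tuple.Small.esCase {n m k : ℕ} {a b : Tuple} (ha : a.Small n) (hb : b.Small m) :
    (esCase k a b).val.Small (n + m + k + 1) := by
  refine ⟨(ha.toShort.esCase hb.toShort).mono (by omega), fun y hy => ?_⟩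
  have ha' : ∀ z, z ∈ a.nature.vars ∨ z ∈ a.apvars ∨ z ∈ a.freevars →
      unbindVar k z < 2 ^ (n + m + k + 1) := fun z hz =>
    (unbindVar_le _ _).trans_lt ((ha.mono (m := n + m + k + 1) (by omega)).lt_of_mem z hz)
  have hb' : ∀ z, z ∈ b.nature.vars ∨ z ∈ b.apvars ∨ z ∈ b.freevars →
      z + k < 2 ^ (n + m + k + 1) := fun z hz => add_lt_two_pow (hb.lt_of_mem z hz) (by omega)
  have hnu : y ∈ (b.nature.raise k).vars → y < 2 ^ (n + m + k + 1) := by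
    intro h
    obtain ⟨z, hz, rfl⟩ := mem_vars_raise h
    exact hb' z (by tauto)
  have hraise : ∀ V : List ℕ, (∀ z ∈ V, z + k < 2 ^ (n + m + k + 1)) → ∀ c : Bool,
      y ∈ (if c = true then (raiseT k V).val else []) → y < 2 ^ (n + m + k + 1) := by
    intro V hV c h
    cases c
    · simp at h
    · simp only [if_true, raiseT_val, List.mem_map] at h
      obtain ⟨z, hz, rfl⟩ := h
      exact hV z hz
  have hrem : ∀ V : List ℕ, (∀ z ∈ V, unbindVar k z < 2 ^ (n + m + k + 1)) →
      y ∈ (removeT k V).val → y < 2 ^ (n + m + k + 1) := by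
    intro V hV h
    obtain ⟨z, hz, -, rfl⟩ := mem_removeT.1 h
    exact hV z hz
  simp only [LSC.esCase, Timed.val_bind, Timed.val_pure, mem_unionT] at hy
  rcases hy with hy | ((hy | hy) | hy) | hy | hy
  · cases h : a.nature with
    | var z =>
      simp only [h] at hy
      split_ifs at hy
      · exact hnu hy
      · simp only [Nature.vars, List.mem_singleton] at hy
        subst hy
        exact ha' z (by simp [h, Nature.vars])
    | lam => simp [h, Nature.vars] at hy
    | app => simp [h, Nature.vars] at hy
  · exact hrem _ (fun z hz => ha' z (by tauto)) hy
  · exact hraise _ (fun z hz => hb' z (by tauto)) _ hy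
  · split_ifs at hy
    · exact hnu hy
    · simp at hy
  · exact hrem _ (fun z hz => ha' z (by tauto)) hy
  · exact hraise _ (fun z hz => hb' z (by tauto)) _ hy

theorem sz_list_le {m : ℕ} {V : List ℕ} (h : ∀ y ∈ V, y < 2 ^ m) :
    sz V ≤ 2 + V.length * (3 * m + 3) := by
  induction V with
  | nil => simp
  | cons y V ih =>
    have h1 := ih fun z hz => h z (List.mem_cons_of_mem _ hz)
    have h2 := length_encodeNat_le (h y List.mem_cons_self)
    rw [sz_cons, sz_nat, List.length_cons, Nat.add_mul]
    omega

theorem Tuple.Small.sz_le {m : ℕ} {a : Tuple} (h : a.Small m) :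
    sz a ≤ 20 + (2 * m + 1) * (3 * m + 3) := by
  have h0 : sz a = 2 + sz a.nature.vars + 1 + (2 + (sz a.apvars + sz a.freevars + 1) + 1) + 1 := rfl
  have h1 := sz_list_le (V := a.nature.vars) fun y hy => h.lt_of_mem y (by tauto)
  have h2 := sz_list_le (V := a.apvars) fun y hy => h.lt_of_mem y (by tauto)
  have h3 := sz_list_le (V := a.freevars) fun y hy => h.lt_of_mem y (by tauto)
  have h4 := Nat.mul_le_mul_right (3 * m + 3) (length_vars a.nature)
  have h5 := Nat.mul_le_mul_right (3 * m + 3) h.apvars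
  have h6 := Nat.mul_le_mul_right (3 * m + 3) h.freevars
  rw [h0]
  nlinarith

end LSC

namespace LSC

open LSC.Rep
open Computability (encodeNat encodeNum encodePosNum)

/-! ### The algorithms as structural recursions -/

def LTerm.raw : LTerm → Raw
  | var n => .var n
  | lam t => .lam t.raw
  | app t u => .bin .app t.raw u.raw

def Term.raw : Term → Raw
  | var n => .var n
  | lam t => .lam t.raw
  | app t u => .bin .app t.raw u.raw
  | es t u => .bin .es t.raw u.raw

def Ctx.raw : Ctx → Raw
  | hole => .hole
  | lam C => .lam C.raw
  | appL C u => .bin .appL C.raw u.raw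
  | appR t C => .bin .appR t.raw C.raw
  | es C u => .bin .es C.raw u.raw

theorem LTerm.enc_raw (t : LTerm) : t.raw.enc = t.enc := by
  induction t <;> simp_all [LTerm.raw, LTerm.enc, Raw.enc, BinOp.tok]

theorem Term.enc_raw (t : Term) : t.raw.enc = t.enc := by
  induction t <;> simp_all [Term.raw, Term.enc, Raw.enc, BinOp.tok]

theorem Ctx.enc_raw (C : Ctx) : C.raw.enc = C.enc := by
  induction C <;> simp_all [Ctx.raw, Ctx.enc, Raw.enc, BinOp.tok, Term.enc_raw]

/-- The common structure of the three algorithms. The parameter is the tuple of the term in the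
hole. A value records whether it comes from a context, the number of abstractions above the hole of
this context, and a tuple. -/
def tupleAlg : RawAlg Tuple ((Bool × List Unit) × Tuple) where
  var _ n := ((false, []), (varCase n).val)
  hole c := ((true, []), c)
  lam _ x := bif x.1.1 then ((true, () :: x.1.2), x.2) else ((false, []), (lamCase x.2).val)
  bin
    | .app, _, x, y => ((false, []), (appCase x.2 y.2).val)
    | .appL, _, x, _ => x
    | .appR, _, _, y => y
    | .es, _, x, y => (x.1, (esCase x.1.2.length x.2 y.2).val)

theorem LTerm.fold_raw (c : Tuple) (t : LTerm) :
    t.raw.fold tupleAlg c = ((false, []), (Ag t).val) := by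
  induction t with
  | var n => rfl
  | lam t ih =>
    show tupleAlg.lam c (t.raw.fold tupleAlg c) = _
    rw [ih]; rfl
  | app t u iht ihu =>
    show tupleAlg.bin .app c (t.raw.fold tupleAlg c) (u.raw.fold tupleAlg c) = _
    rw [iht, ihu]; rfl

/-- The recorded count stays empty on terms, so `tupleAlg` runs the substitution clause at index
`0`, as `Bg` does. -/
theorem Term.fold_raw (c : Tuple) (t : Term) :
    t.raw.fold tupleAlg c = ((false, []), (Bg t).val) := by
  induction t with
  | var n => rfl
  | lam t ih =>
    show tupleAlg.lam c (t.raw.fold tupleAlg c) = _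
    rw [ih]; rfl
  | app t u iht ihu =>
    show tupleAlg.bin .app c (t.raw.fold tupleAlg c) (u.raw.fold tupleAlg c) = _
    rw [iht, ihu]; rfl
  | es t u iht ihu =>
    show tupleAlg.bin .es c (t.raw.fold tupleAlg c) (u.raw.fold tupleAlg c) = _
    rw [iht, ihu, Bg_es_val]; rfl

theorem Cg_es_val (t : Term) (C : Ctx) (u : Term) :
    (Cg t (.es C u)).val = (esCase C.lamDepth (Cg t C).val (Bg u).val).val := by
  rw [← lamDepthT_val]; rfl

theorem Ctx.fold_raw (t : Term) (C : Ctx) :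
    C.raw.fold tupleAlg (Bg t).val = ((true, List.replicate C.lamDepth ()), (Cg t C).val) := by
  induction C with
  | hole => rfl
  | lam C ih =>
    show tupleAlg.lam _ (C.raw.fold tupleAlg _) = _
    rw [ih]; rfl
  | appL C u ih => exact ih
  | appR u C ih => exact ih
  | es C u ih =>
    show tupleAlg.bin .es _ (C.raw.fold tupleAlg _) (u.raw.fold tupleAlg _) = _
    rw [ih, Term.fold_raw, Cg_es_val]
    simp only [tupleAlg, List.length_replicate, Ctx.lamDepth]

theorem tupleAlg_poly : tupleAlg.Poly where
  var := (PolyFun.const (false, [])).pair (PolyFun.varCase.comp PolyFun.id.snd)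
  hole := (PolyFun.const (true, [])).pair PolyFun.id
  lam := PolyFun.id.snd.fst.fst.cond
    (((PolyFun.const true).pair ((PolyFun.const ()).cons PolyFun.id.snd.fst.snd)).pair
      PolyFun.id.snd.snd)
    ((PolyFun.const (false, [])).pair (PolyFun.lamCase.comp PolyFun.id.snd.snd))
  bin o := by
    have hx := (PolyFun.id
      (α := Tuple × ((Bool × List Unit) × Tuple) × ((Bool × List Unit) × Tuple))).snd.fst
    have hy := (PolyFun.id
      (α := Tuple × ((Bool × List Unit) × Tuple) × ((Bool × List Unit) × Tuple))).snd.snd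
    have happ := (PolyFun.const (false, ([] : List Unit))).pair
      (PolyFun.appCase.comp (hx.snd.pair hy.snd))
    have hes := hx.fst.pair (PolyFun.esCase.comp (hx.fst.snd.pair (hx.snd.pair hy.snd)))
    cases o
    · exact happ
    · exact hx
    · exact hy
    · exact hes

theorem Raw.length_enc_pos (r : Raw) : 1 ≤ r.enc.length := by cases r <;> simp [enc]

/-- The quadratic function that bounds the growth of the tuples. -/
theorem fold_tupleAlg_small {P : ℕ} {c : Tuple} (hc : c.Small P) (r : Raw) :
    (r.fold tupleAlg c).1.2.length ≤ r.enc.length ∧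
      (r.fold tupleAlg c).2.Small ((P + 1) * r.enc.length ^ 2) := by
  have hpow : ∀ n : ℕ, n ≤ (P + 1) * n ^ 2 := fun n => by
    rcases Nat.eq_zero_or_pos n with rfl | hn
    · simp
    · nlinarith [Nat.mul_le_mul hn (le_refl n), Nat.zero_le (P * n ^ 2)]
  have hmono : ∀ {n m : ℕ}, n ≤ m → (P + 1) * n ^ 2 ≤ (P + 1) * m ^ 2 := fun h =>
    Nat.mul_le_mul le_rfl (Nat.pow_le_pow_left h 2)
  induction r with
  | var n =>
    refine ⟨by simp [Raw.fold, tupleAlg], varCase_small ?_ ?_⟩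
    · refine (lt_two_pow_length_encodeNat n).trans_le (Nat.pow_le_pow_right (by omega)
        (le_trans ?_ (hpow _)))
      simp [Raw.enc, encNat]; omega
    · exact (Raw.length_enc_pos _).trans (hpow _)
  | hole =>
    refine ⟨by simp [Raw.fold, tupleAlg], hc.mono ?_⟩
    simp [Raw.enc]
  | lam t ih =>
    have hle := hmono (Nat.le_succ t.enc.length)
    simp only [Raw.fold, Raw.enc, List.length_cons, tupleAlg] at *
    generalize Raw.fold _ c t = x at *
    obtain ⟨⟨b, k⟩, a⟩ := x
    cases b
    · exact ⟨by simp, ih.2.lamCase.mono hle⟩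
    · exact ⟨by simpa using ih.1, ih.2.mono hle⟩
  | bin o t u iht ihu =>
    have hle1 : (P + 1) * t.enc.length ^ 2 ≤ (P + 1) * (t.enc.length + u.enc.length + 1) ^ 2 :=
      hmono (by omega)
    have hle2 : (P + 1) * u.enc.length ^ 2 ≤ (P + 1) * (t.enc.length + u.enc.length + 1) ^ 2 :=
      hmono (by omega)
    -- The cross terms of the square absorb the index `k ≤ t.enc.length` and the unit that the
    -- substitution clause adds; a linear bound could not.
    have hle3 : (P + 1) * t.enc.length ^ 2 + (P + 1) * u.enc.length ^ 2 + t.enc.length + 1 ≤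
        (P + 1) * (t.enc.length + u.enc.length + 1) ^ 2 := by
      generalize t.enc.length = n
      generalize u.enc.length = m
      have : n ^ 2 + m ^ 2 + n + 1 ≤ (n + m + 1) ^ 2 := by
        nlinarith [Nat.zero_le (n * m)]
      have := Nat.mul_le_mul (le_refl (P + 1)) this
      nlinarith [Nat.zero_le (P * n)]
    simp only [Raw.fold, Raw.enc, List.length_cons, List.length_append]
    generalize Raw.fold tupleAlg c t = x at *
    generalize Raw.fold tupleAlg c u = y at *
    obtain ⟨⟨b, k⟩, a⟩ := x
    obtain ⟨⟨b', k'⟩, a'⟩ := y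
    cases o <;> simp only [tupleAlg] at *
    · exact ⟨by simp, (iht.2.appCase ihu.2).mono (by omega)⟩
    · exact ⟨by omega, iht.2.mono hle1⟩
    · exact ⟨by omega, ihu.2.mono hle2⟩
    · exact ⟨by omega, (iht.2.esCase ihu.2).mono (by omega)⟩

theorem Tuple.small_sz (a : Tuple) : a.Small (sz a) := by
  have h0 : sz a = 2 + sz a.nature.vars + 1 + (2 + (sz a.apvars + sz a.freevars + 1) + 1) + 1 := rfl
  refine ⟨⟨?_, ?_⟩, fun y hy => ?_⟩
  · have := length_le_sz a.apvars; omega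
  · have := length_le_sz a.freevars; omega
  · refine (lt_two_pow_length_encodeNat y).trans_le (Nat.pow_le_pow_right (by omega) ?_)
    have h1 := sz_nat y
    rcases hy with hy | hy | hy <;> have := sz_le_of_mem hy <;> omega

theorem sz_fold_tupleAlg (c : Tuple) (r : Raw) :
    sz (r.fold tupleAlg c) ≤ 3 * r.enc.length + 26 +
      (2 * ((sz c + 1) * r.enc.length ^ 2) + 1) * (3 * ((sz c + 1) * r.enc.length ^ 2) + 3) := by
  have h := fold_tupleAlg_small c.small_sz r
  have h1 := h.2.sz_le
  have h2 := h.1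
  generalize Raw.fold tupleAlg c r = x at *
  obtain ⟨⟨b, k⟩, a⟩ := x
  have hk : sz k = 3 * k.length + 2 := by
    generalize k = l
    induction l with
    | nil => rfl
    | cons b l ih => simp [ih]; omega
  simp only [sz_prod, sz_bool] at *
  omega

namespace PolyFun

variable {α : Type} [Rep α]

theorem foldTuple {c : α → Tuple} {r : α → Raw} (hc : PolyFun c) (hr : PolyFun r) :
    PolyFun fun x => (r x).fold tupleAlg (c x) := by
  obtain ⟨p, hp⟩ := hc.sz_le
  obtain ⟨q, hq⟩ := hr.sz_le
  refine foldRaw tupleAlg_poly hc hr (3 * q + 26 +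
    (2 * ((p + 1) * q ^ 2) + 1) * (3 * ((p + 1) * q ^ 2) + 3)) (fun x t ht => ?_)
    ((false, []), ⟨.lam, false, [], []⟩)
  refine (sz_fold_tupleAlg _ _).trans ?_
  have h1 := hp x
  have h2 := hq x
  have h3 : t.enc.length ≤ q.eval (sz x) := by
    change sz (r x).enc ≤ _ at h2
    rw [sz_word] at h2
    omega
  simp only [Polynomial.eval_add, Polynomial.eval_mul, Polynomial.eval_pow, Polynomial.eval_ofNat,
    Polynomial.eval_one]
  gcongr

theorem encNat {f : α → ℕ} (hf : PolyFun f) : PolyFun fun x => encNat (f x) :=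
  (map (g := fun x : Unit × Bool => Tok.bit x.2) (PolyFun.congr_out PolyFun.id.snd fun _ => rfl)
    (const ()) (hf.congr_out (g := fun x => encodeNat (f x)) fun _ => rfl)).append (const [Tok.endm])

theorem encList {f : α → List ℕ} (hf : PolyFun f) : PolyFun fun x => encList (f x) := by
  obtain ⟨q, hq⟩ := (encNat (PolyFun.id (α := ℕ))).sz_le
  have h := foldl_of_growth (γ := Unit)
    (g := fun x : Unit × List Tok × ℕ => Tok.var :: (LSC.encNat x.2.2 ++ x.2.1))
    ((const Tok.var).cons (PolyFun.id.snd.snd.encNat.append PolyFun.id.snd.fst)) (q.comp .X + 3)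
    (fun _ b n => by
      have h1 := hq n
      have h2 := sz_append (LSC.encNat n) b
      have h3 := q.monotone_eval_nat (Nat.le_add_left (sz n) 2)
      simp only [sz_cons, sz_tok, Polynomial.eval_add, Polynomial.eval_comp, Polynomial.eval_X,
        Polynomial.eval_ofNat, sz_unit] at *
      omega)
  convert h.comp ((const ()).pair (hf.reverse.pair (const [Tok.endm]))) using 2 with a
  simp only
  rw [List.foldl_reverse]
  induction f a with
  | nil => rfl
  | cons x l ih => rw [LSC.encList, ih, List.foldr_cons]

theorem encNature {f : α → Nature} (hf : PolyFun f) : PolyFun fun x => encNature (f x) := by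
  have h := listCase hf.vars (hf.isLam.cond (const [Tok.lam]) (const [Tok.app]))
    ((const Tok.var).cons PolyFun.id.snd.fst.encNat)
  convert h using 2 with x
  cases f x <;> rfl

theorem encTuple {f : α → Tuple} (hf : PolyFun f) : PolyFun fun x => tupleCode.enc (f x) :=
  hf.nature.encNature.append (((hf.redex.congr_out (g := fun x => Tok.bit (f x).redex)
    fun _ => rfl).cons nil).append (hf.apvars.encList.append hf.freevars.encList))

end PolyFun

theorem polyTime_Ag : PolyTime lTermCode tupleCode fun t => (Ag t).val :=
  -- The parameter is the tuple for the hole; a term has no hole, so any value will do.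
  (PolyFun.foldTuple (PolyFun.const ⟨.lam, false, [], []⟩) PolyFun.id).snd.encTuple.polyTime
    LTerm.raw (fun t => by show rep t.raw.enc = _; rw [LTerm.enc_raw]; rfl)
    fun t => by rw [LTerm.fold_raw]

theorem polyTime_Bg : PolyTime termCode tupleCode fun t => (Bg t).val :=
  (PolyFun.foldTuple (PolyFun.const ⟨.lam, false, [], []⟩) PolyFun.id).snd.encTuple.polyTime
    Term.raw (fun t => by show rep t.raw.enc = _; rw [Term.enc_raw]; rfl)
    fun t => by rw [Term.fold_raw]

/-! ### Splitting sequences of trees -/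

/-- The interpretation of trees by themselves. -/
def idAlg : RawAlg Unit Raw where
  var _ n := .var n
  hole _ := .hole
  lam _ t := .lam t
  bin o _ t u := .bin o t u

theorem Raw.fold_idAlg (r : Raw) : r.fold idAlg () = r := by
  induction r <;> simp_all [Raw.fold, idAlg]

theorem idAlg_poly : idAlg.Poly where
  var := ((PolyFun.const Tok.var).cons PolyFun.id.snd.encNat).congr_out fun _ => rfl
  hole := (PolyFun.const [Tok.hole]).congr_out fun _ => rfl
  lam := ((PolyFun.const Tok.lam).cons (PolyFun.id.snd.congr_out
    (g := fun x : Unit × Raw => x.2.enc) fun _ => rfl)).congr_out fun _ => rfl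
  bin o := ((PolyFun.const o.tok).cons ((PolyFun.id.snd.fst.congr_out
    (g := fun x : Unit × Raw × Raw => x.2.1.enc) fun _ => rfl).append (PolyFun.id.snd.snd.congr_out
    (g := fun x : Unit × Raw × Raw => x.2.2.enc) fun _ => rfl))).congr_out fun _ => rfl

theorem sz_raw (r : Raw) : sz r = 3 * r.enc.length + 2 := sz_word _

/-- Folding with `idAlg` is parsing: the values left on the stack are the trees of the sequence. -/
theorem polyFun_trees : PolyFun Forest.trees := by
  have h := PolyFun.foldForest idAlg_poly (PolyFun.const (α := Forest) ()) PolyFun.id .X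
    (fun x t ht => by
      rw [Raw.fold_idAlg, sz_raw, Polynomial.eval_X]
      show _ ≤ sz x.enc
      rw [sz_word]
      omega)
  convert h using 2 with x
  rw [List.map_congr_left (fun r _ => Raw.fold_idAlg r), List.map_id']

theorem PolyFun.splitTwo {α : Type} [Rep α] {r : α → Forest} (hr : PolyFun r) :
    PolyFun fun x => match (r x).trees with
      | a :: b :: _ => (a, b)
      | _ => (Raw.hole, Raw.hole) := by
  have h := listCase (polyFun_trees.comp hr) (const (Raw.hole, Raw.hole))
    (listCase (l := fun y : α × Raw × List Raw => y.2.2) PolyFun.id.snd.snd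
      (const (Raw.hole, Raw.hole)) (PolyFun.id.fst.snd.fst.pair PolyFun.id.snd.fst))
  convert h using 2 with x
  rcases (r x).trees with _ | ⟨a, _ | ⟨b, l⟩⟩ <;> rfl

theorem polyTime_Cg : PolyTime (termCode.pair ctxCode) tupleCode fun p => (Cg p.1 p.2).val := by
  have h1 := PolyFun.splitTwo (PolyFun.id (α := Forest))
  -- Two folds are chained: the tuple obtained from the term becomes the parameter of the fold over
  -- the context.
  have h2 := PolyFun.foldTuple (PolyFun.const ⟨.lam, false, [], []⟩) h1.fst
  have h3 := (PolyFun.foldTuple h2.snd h1.snd).snd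
  refine h3.encTuple.polyTime (fun p => ⟨[p.1.raw, p.2.raw]⟩) (fun p => ?_) fun p => ?_
  · show rep (List.flatMap Raw.enc _) = _
    simp only [List.flatMap_cons, List.flatMap_nil, List.append_nil, Term.enc_raw, Ctx.enc_raw]
    rfl
  · simp only [Term.fold_raw, Ctx.fold_raw]

end LSC

namespace LSC

/-! ### Renaming and substitution -/

namespace LTerm

theorem rename_congr {ρ ρ' : ℕ → ℕ} (h : ∀ n, ρ n = ρ' n) (t : LTerm) :
    t.rename ρ = t.rename ρ' := by
  rw [funext h]

theorem liftRen_comp (ρ ρ' : ℕ → ℕ) (n : ℕ) :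
    liftRen ρ' (liftRen ρ n) = liftRen (fun n => ρ' (ρ n)) n := by
  cases n <;> rfl

theorem rename_rename (ρ ρ' : ℕ → ℕ) (t : LTerm) :
    (t.rename ρ).rename ρ' = t.rename fun n => ρ' (ρ n) := by
  induction t generalizing ρ ρ' with
  | var n => rfl
  | lam t ih => simp only [rename, ih, liftRen_comp]
  | app t u iht ihu => simp only [rename, iht, ihu]

theorem liftRen_id (n : ℕ) : liftRen (fun n => n) n = n := by cases n <;> rfl

theorem rename_id (t : LTerm) : t.rename (fun n => n) = t := by
  induction t with
  | var n => rfl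
  | lam t ih => rw [rename, rename_congr liftRen_id, ih]
  | app t u iht ihu => rw [rename, iht, ihu]

theorem shift_zero (t : LTerm) : t.shift 0 = t := rename_id t

theorem shift_shift (j k : ℕ) (t : LTerm) : (t.shift j).shift k = t.shift (j + k) := by
  rw [shift, shift, rename_rename]
  exact rename_congr (fun n => by omega) t

theorem subst_congr {σ σ' : ℕ → LTerm} (h : ∀ n, σ n = σ' n) (t : LTerm) :
    t.subst σ = t.subst σ' := by
  rw [funext h]

theorem liftSubst_liftRen (σ : ℕ → LTerm) (ρ : ℕ → ℕ) (n : ℕ) :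
    liftSubst σ (liftRen ρ n) = liftSubst (fun n => σ (ρ n)) n := by
  cases n <;> rfl

theorem subst_rename (σ : ℕ → LTerm) (ρ : ℕ → ℕ) (t : LTerm) :
    (t.rename ρ).subst σ = t.subst fun n => σ (ρ n) := by
  induction t generalizing σ ρ with
  | var n => rfl
  | lam t ih => simp only [rename, subst, ih, liftSubst_liftRen]
  | app t u iht ihu => simp only [rename, subst, iht, ihu]

theorem rename_liftSubst (σ : ℕ → LTerm) (ρ : ℕ → ℕ) (n : ℕ) :
    (liftSubst σ n).rename (liftRen ρ) = liftSubst (fun n => (σ n).rename ρ) n := by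
  cases n with
  | zero => rfl
  | succ n => simp only [liftSubst, shift, rename_rename, liftRen]

theorem rename_subst (σ : ℕ → LTerm) (ρ : ℕ → ℕ) (t : LTerm) :
    (t.subst σ).rename ρ = t.subst fun n => (σ n).rename ρ := by
  induction t generalizing σ ρ with
  | var n => rfl
  | lam t ih => simp only [rename, subst, ih, rename_liftSubst]
  | app t u iht ihu => simp only [rename, subst, iht, ihu]

theorem subst_var_eq_rename (ρ : ℕ → ℕ) (t : LTerm) : t.subst (fun n => var (ρ n)) = t.rename ρ := by
  induction t generalizing ρ with
  | var n => rfl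
  | lam t ih =>
    rw [subst, rename, ← ih]
    exact congrArg lam (subst_congr (fun n => by cases n <;> rfl) t)
  | app t u iht ihu => simp only [rename, subst, iht, ihu]

/-- The substitution that is used by `substAt`. -/
def bindSubst (k : ℕ) (u : LTerm) (i : ℕ) : LTerm :=
  if i < k then var i else if i = k then u.shift k else var (i - 1)

theorem substAt_eq (t : LTerm) (k : ℕ) (u : LTerm) : t.substAt k u = t.subst (bindSubst k u) := rfl

theorem bindSubst_self (k : ℕ) (u : LTerm) : bindSubst k u k = u.shift k := by simp [bindSubst]

theorem bindSubst_of_ne {k i : ℕ} (u : LTerm) (h : i ≠ k) :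
    bindSubst k u i = var (unbindVar k i) := by
  unfold bindSubst unbindVar
  split_ifs <;> rfl

theorem substAt_shift (t : LTerm) (k : ℕ) (u : LTerm) : (t.shift (k + 1)).substAt k u = t.shift k := by
  rw [substAt_eq, shift, subst_rename, shift, ← subst_var_eq_rename]
  refine subst_congr (fun n => ?_) t
  rw [bindSubst_of_ne u (by omega), unbindVar, if_neg (by omega)]
  congr 1

theorem rename_substAt_zero (ρ : ℕ → ℕ) (t u : LTerm) :
    (t.substAt 0 u).rename ρ = (t.rename (liftRen ρ)).substAt 0 (u.rename ρ) := by
  rw [substAt_eq, substAt_eq, rename_subst, subst_rename]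
  refine subst_congr (fun n => ?_) t
  cases n with
  | zero => simp only [liftRen, bindSubst_self, shift_zero]
  | succ n => simp [liftRen, bindSubst, rename]

/-! ### Variables, abstractions and redexes under renaming and substitution -/

/-- The variable `y` is free. -/
def Free : ℕ → LTerm → Prop
  | y, var n => y = n
  | y, lam t => Free (y + 1) t
  | y, app t u => Free y t ∨ Free y u

/-- The variable `y` has an applied occurrence. -/
def Applied : ℕ → LTerm → Prop
  | _, var _ => False
  | y, lam t => Applied (y + 1) t
  | y, app t u => Applied y t ∨ Applied y u ∨ t = var y

/-- The nature of a `λ`-term. -/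
def nature : LTerm → Nature
  | var n => .var n
  | lam _ => .lam
  | app _ _ => .app

theorem nature_eq_lam {t : LTerm} : t.nature = .lam ↔ t.IsLam := by
  cases t <;> simp [nature, IsLam]

theorem mem_vars_nature {t : LTerm} {y : ℕ} : y ∈ t.nature.vars ↔ t = var y := by
  cases t <;> simp [nature, Nature.vars, eq_comm]

theorem nature_rename (k : ℕ) (t : LTerm) : (t.shift k).nature = t.nature.raise k := by
  cases t <;> rfl

theorem hasBeta_var {n : ℕ} : ¬(var n).HasBeta := fun h => by cases h

theorem hasBeta_lam {t : LTerm} : (lam t).HasBeta ↔ t.HasBeta :=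
  ⟨fun h => by cases h; assumption, .lam⟩

theorem hasBeta_app {t u : LTerm} : (app t u).HasBeta ↔ t.HasBeta ∨ u.HasBeta ∨ t.IsLam := by
  constructor
  · intro h
    cases h with
    | root r u => exact .inr (.inr ⟨r, rfl⟩)
    | appL u h => exact .inl h
    | appR t h => exact .inr (.inl h)
  · rintro (h | h | ⟨r, rfl⟩)
    exacts [.appL u h, .appR t h, .root r u]

theorem free_rename {ρ : ℕ → ℕ} {t : LTerm} {y : ℕ} :
    Free y (t.rename ρ) ↔ ∃ x, Free x t ∧ y = ρ x := by
  induction t generalizing ρ y with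
  | var n => simp [rename, Free]
  | lam t ih =>
    simp only [rename, Free, ih]
    constructor
    · rintro ⟨_ | x, hx, h⟩
      · simp [liftRen] at h
      · exact ⟨x, hx, by simpa [liftRen] using h⟩
    · rintro ⟨x, hx, rfl⟩
      exact ⟨x + 1, hx, rfl⟩
  | app t u iht ihu => simp only [rename, Free, iht, ihu, or_and_right, exists_or]

theorem applied_rename {ρ : ℕ → ℕ} {t : LTerm} {y : ℕ} :
    Applied y (t.rename ρ) ↔ ∃ x, Applied x t ∧ y = ρ x := by
  induction t generalizing ρ y with
  | var n => simp [rename, Applied]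
  | lam t ih =>
    simp only [rename, Applied, ih]
    constructor
    · rintro ⟨_ | x, hx, h⟩
      · simp [liftRen] at h
      · exact ⟨x, hx, by simpa [liftRen] using h⟩
    · rintro ⟨x, hx, rfl⟩
      exact ⟨x + 1, hx, rfl⟩
  | app t u iht ihu =>
    have : t.rename ρ = var y ↔ ∃ x, t = var x ∧ y = ρ x := by
      cases t <;> simp [rename, eq_comm]
    simp only [rename, Applied, iht, ihu, or_and_right, exists_or, this]

theorem isLam_rename {ρ : ℕ → ℕ} {t : LTerm} : (t.rename ρ).IsLam ↔ t.IsLam := by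
  cases t <;> simp [rename, IsLam]

theorem hasBeta_rename {ρ : ℕ → ℕ} {t : LTerm} : (t.rename ρ).HasBeta ↔ t.HasBeta := by
  induction t generalizing ρ with
  | var n => simp [rename, hasBeta_var]
  | lam t ih => simp only [rename, hasBeta_lam, ih]
  | app t u iht ihu => simp only [rename, hasBeta_app, iht, ihu, isLam_rename]

theorem free_subst {σ : ℕ → LTerm} {t : LTerm} {y : ℕ} :
    Free y (t.subst σ) ↔ ∃ x, Free x t ∧ Free y (σ x) := by
  induction t generalizing σ y with
  | var n => simp [subst, Free]
  | lam t ih =>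
    simp only [subst, Free, ih]
    constructor
    · rintro ⟨_ | x, hx, h⟩
      · simp [liftSubst, Free] at h
      · obtain ⟨z, hz, e⟩ := free_rename.1 h
        obtain rfl : y = z := by omega
        exact ⟨x, hx, hz⟩
    · rintro ⟨x, hx, h⟩
      exact ⟨x + 1, hx, free_rename.2 ⟨y, h, rfl⟩⟩
  | app t u iht ihu => simp only [subst, Free, iht, ihu, or_and_right, exists_or]

theorem shift_one_eq_var {t : LTerm} {y : ℕ} : t.shift 1 = var (y + 1) ↔ t = var y := by
  cases t <;> simp [shift, rename]

/-- An application keeps its shape under substitution, so a new applied occurrence of `y` is either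
inside a copy of some `σ x` or the image of an applied variable `x` with `σ x = y`. -/
theorem applied_subst {σ : ℕ → LTerm} {t : LTerm} {y : ℕ} :
    Applied y (t.subst σ) ↔
      (∃ x, Free x t ∧ Applied y (σ x)) ∨ ∃ x, Applied x t ∧ σ x = var y := by
  induction t generalizing σ y with
  | var n => simp [subst, Free, Applied]
  | lam t ih =>
    simp only [subst, Free, Applied, ih]
    constructor
    · rintro (⟨_ | x, hx, h⟩ | ⟨_ | x, hx, h⟩)
      · simp [liftSubst, Applied] at h
      · obtain ⟨z, hz, e⟩ := applied_rename.1 h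
        obtain rfl : y = z := by omega
        exact .inl ⟨x, hx, hz⟩
      · simp [liftSubst] at h
      · exact .inr ⟨x, hx, shift_one_eq_var.1 h⟩
    · rintro (⟨x, hx, h⟩ | ⟨x, hx, h⟩)
      · exact .inl ⟨x + 1, hx, applied_rename.2 ⟨y, h, rfl⟩⟩
      · exact .inr ⟨x + 1, hx, shift_one_eq_var.2 h⟩
  | app t u iht ihu =>
    have : t.subst σ = var y ↔ ∃ x, t = var x ∧ σ x = var y := by
      cases t <;> simp [subst]
    simp only [subst, Free, Applied, iht, ihu, or_and_right, exists_or, this]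
    simp only [or_assoc, or_left_comm]

theorem isLam_subst {σ : ℕ → LTerm} {t : LTerm} :
    (t.subst σ).IsLam ↔ t.IsLam ∨ ∃ x, t = var x ∧ (σ x).IsLam := by
  cases t <;> simp [subst, IsLam]

/-- Substitution only replaces variables, so a redex that is neither old nor inside a copy must have
a head that was a variable and became an abstraction. -/
theorem hasBeta_subst {σ : ℕ → LTerm} {t : LTerm} :
    (t.subst σ).HasBeta ↔ t.HasBeta ∨ (∃ x, Free x t ∧ (σ x).HasBeta) ∨
      ∃ x, Applied x t ∧ (σ x).IsLam := by
  induction t generalizing σ with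
  | var n => simp [subst, Free, Applied, hasBeta_var]
  | lam t ih =>
    simp only [subst, Free, Applied, hasBeta_lam, ih]
    refine or_congr_right (or_congr ?_ ?_)
    · constructor
      · rintro ⟨_ | x, hx, h⟩
        · exact absurd h hasBeta_var
        · exact ⟨x, hx, hasBeta_rename.1 h⟩
      · rintro ⟨x, hx, h⟩
        exact ⟨x + 1, hx, hasBeta_rename.2 h⟩
    · constructor
      · rintro ⟨_ | x, hx, h⟩
        · obtain ⟨r, hr⟩ := h; cases hr
        · exact ⟨x, hx, isLam_rename.1 h⟩
      · rintro ⟨x, hx, h⟩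
        exact ⟨x + 1, hx, isLam_rename.2 h⟩
  | app t u iht ihu =>
    simp only [subst, Free, Applied, hasBeta_app, iht, ihu, isLam_subst, or_and_right, exists_or]
    simp only [or_assoc, or_left_comm]

end LTerm

/-! ### Correctness of the algorithms -/

/-- The tuple `a` describes the `λ`-term `t`. -/
structure Tuple.Describes (a : Tuple) (t : LTerm) : Prop where
  nature : a.nature = t.nature
  redex : a.redex = true ↔ t.HasBeta
  apvars : ∀ y, y ∈ a.apvars ↔ t.Applied y
  freevars : ∀ y, y ∈ a.freevars ↔ t.Free y

open LTerm in
theorem varCase_describes (n : ℕ) : (varCase n).val.Describes (.var n) :=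
  ⟨rfl, by simp [varCase, hasBeta_var], by simp [varCase, Applied], by simp [varCase, Free]⟩

theorem mem_removeT_zero {V : List ℕ} {y : ℕ} : y ∈ (removeT 0 V).val ↔ y + 1 ∈ V := by
  rw [mem_removeT]
  constructor
  · rintro ⟨z, hz, hz0, rfl⟩
    rwa [unbindVar, if_neg (by omega), Nat.sub_add_cancel (by omega)]
  · intro h
    exact ⟨y + 1, h, by omega, by simp [unbindVar]⟩

namespace Tuple.Describes

variable {a b : Tuple} {t u : LTerm}

open LTerm

theorem lamCase (ha : a.Describes t) : (lamCase a).val.Describes (.lam t) :=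
  ⟨rfl, ha.redex.trans hasBeta_lam.symm, fun _ => mem_removeT_zero.trans (ha.apvars _),
    fun _ => mem_removeT_zero.trans (ha.freevars _)⟩

theorem appCase (ha : a.Describes t) (hb : b.Describes u) :
    (appCase a b).val.Describes (.app t u) := by
  refine ⟨rfl, ?_, fun y => ?_, fun y => ?_⟩
  · simp only [LSC.appCase, Timed.val_bind, Timed.val_pure, Bool.or_eq_true, ha.redex, hb.redex,
      decide_eq_true_eq, hasBeta_app, ha.nature, nature_eq_lam, or_assoc]
  · simp only [LSC.appCase, Timed.val_bind, Timed.val_pure, mem_unionT, ha.apvars, hb.apvars,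
      ha.nature, mem_vars_nature, Applied, or_assoc]
  · simp only [LSC.appCase, Timed.val_bind, Timed.val_pure, mem_unionT, ha.freevars, hb.freevars,
      Free]

/-- The clause is a transcription of the substitution lemmas, specialised to a substitution that
sends every variable except `k` to a variable. -/
theorem esCase (k : ℕ) (ha : a.Describes t) (hb : b.Describes u) :
    (esCase k a b).val.Describes (t.substAt k u) := by
  have hnu : b.nature.raise k = (u.shift k).nature := by rw [hb.nature, nature_rename]
  -- This separates the variable `k` from the others, which turns the existential quantifiers of the
  -- substitution lemmas into the two sources named in the clause.
  have split : ∀ {P : ℕ → LTerm → Prop} {Q : ℕ → Prop}, (∃ x, Q x ∧ P x (bindSubst k u x)) ↔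
      (∃ x, Q x ∧ x ≠ k ∧ P x (.var (unbindVar k x))) ∨ (Q k ∧ P k (u.shift k)) := by
    intro P Q
    constructor
    · rintro ⟨x, hx, h⟩
      by_cases hk : x = k
      · subst hk
        rw [bindSubst_self] at h
        exact .inr ⟨hx, h⟩
      · rw [bindSubst_of_ne u hk] at h
        exact .inl ⟨x, hx, hk, h⟩
    · rintro (⟨x, hx, hk, h⟩ | ⟨hx, h⟩)
      · exact ⟨x, hx, by rwa [bindSubst_of_ne u hk]⟩
      · exact ⟨k, hx, by rwa [bindSubst_self]⟩
  refine ⟨?_, ?_, fun y => ?_, fun y => ?_⟩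
  · simp only [LSC.esCase, Timed.val_bind, Timed.val_pure, hnu, ha.nature, substAt_eq]
    cases t with
    | var n =>
      simp only [LTerm.nature, subst]
      split_ifs with h
      · rw [h, bindSubst_self]
      · rw [bindSubst_of_ne u h]
    | lam t => rfl
    | app t u => rfl
  · simp only [LSC.esCase, Timed.val_bind, Timed.val_pure, hnu, Bool.or_eq_true, Bool.and_eq_true,
      memT_val, decide_eq_true_eq, nature_eq_lam, ha.redex, hb.redex, ha.apvars, ha.freevars,
      substAt_eq, hasBeta_subst]
    rw [split (P := fun _ s => s.HasBeta) (Q := fun x => Free x t),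
      split (P := fun _ s => s.IsLam) (Q := fun x => Applied x t)]
    -- A variable other than `k` is replaced by a variable, so it creates no redex; likewise no
    -- abstraction in `h2`.
    have h1 : (∃ x, Free x t ∧ x ≠ k ∧ (LTerm.var (unbindVar k x)).HasBeta) ↔ False := by
      simp [hasBeta_var]
    have h2 : (∃ x, Applied x t ∧ x ≠ k ∧ (LTerm.var (unbindVar k x)).IsLam) ↔ False := by
      simp [IsLam]
    rw [h1, h2, shift, hasBeta_rename]
    tauto
  · have hr : ∀ V : List ℕ, y ∈ (if decide (k ∈ a.freevars) = true then (raiseT k V).val else []) ↔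
        k ∈ a.freevars ∧ ∃ z ∈ V, y = z + k := by
      intro V
      by_cases h : k ∈ a.freevars <;> simp [h, raiseT_val, eq_comm]
    have hv : y ∈ (if decide (k ∈ a.apvars) = true then (b.nature.raise k).vars else []) ↔
        k ∈ a.apvars ∧ u.shift k = var y := by
      by_cases h : k ∈ a.apvars <;> simp [h, hnu, mem_vars_nature]
    simp only [LSC.esCase, Timed.val_bind, Timed.val_pure, memT_val, mem_unionT, mem_removeT,
      hr, hv, substAt_eq, applied_subst, ha.apvars, ha.freevars, hb.apvars]
    rw [split (P := fun _ s => Applied y s) (Q := fun x => Free x t),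
      split (P := fun _ s => s = var y) (Q := fun x => Applied x t), shift, applied_rename]
    simp only [Applied, and_false, exists_false, false_or, LTerm.var.injEq, or_left_comm, or_assoc]
  · have hr : ∀ V : List ℕ, y ∈ (if decide (k ∈ a.freevars) = true then (raiseT k V).val else []) ↔
        k ∈ a.freevars ∧ ∃ z ∈ V, y = z + k := by
      intro V
      by_cases h : k ∈ a.freevars <;> simp [h, raiseT_val, eq_comm]
    simp only [LSC.esCase, Timed.val_bind, Timed.val_pure, memT_val, mem_unionT, mem_removeT,
      hr, substAt_eq, free_subst, ha.freevars, hb.freevars]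
    rw [split (P := fun _ s => Free y s) (Q := fun x => Free x t), shift, free_rename]
    simp only [Free, eq_comm]

end Tuple.Describes

end LSC

/-! ### Unfolding and the tuples -/

namespace LSC

open LTerm in
theorem Term.unf_rename (ρ : ℕ → ℕ) (t : Term) : (t.rename ρ).unf = t.unf.rename ρ := by
  induction t generalizing ρ with
  | var n => rfl
  | lam t ih => simp only [rename, unf, LTerm.rename, ih]
  | app t u iht ihu => simp only [rename, unf, LTerm.rename, iht, ihu]
  | es t u iht ihu => simp only [rename, unf, iht, ihu, rename_substAt_zero]

theorem Term.rename_congr {ρ ρ' : ℕ → ℕ} (h : ∀ n, ρ n = ρ' n) (t : Term) :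
    t.rename ρ = t.rename ρ' := by
  rw [funext h]

theorem Term.rename_rename (ρ ρ' : ℕ → ℕ) (t : Term) :
    (t.rename ρ).rename ρ' = t.rename fun n => ρ' (ρ n) := by
  induction t generalizing ρ ρ' with
  | var n => rfl
  | lam t ih => simp only [rename, ih, LTerm.liftRen_comp]
  | app t u iht ihu => simp only [rename, iht, ihu]
  | es t u iht ihu => simp only [rename, iht, ihu, LTerm.liftRen_comp]

theorem Term.rename_id (t : Term) : t.rename (fun n => n) = t := by
  induction t with
  | var n => rfl
  | lam t ih => rw [rename, rename_congr LTerm.liftRen_id, ih]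
  | app t u iht ihu => rw [rename, iht, ihu]
  | es t u iht ihu => rw [rename, rename_congr LTerm.liftRen_id, iht, ihu]

theorem Term.shift_shift (j k : ℕ) (t : Term) : (t.shift j).shift k = t.shift (j + k) := by
  rw [shift, shift, rename_rename]
  exact rename_congr (fun n => by omega) t

/-- This is what makes usefulness testable without writing down the unfolding, which may be
exponentially larger than the term. -/
theorem Bg_describes (t : Term) : (Bg t).val.Describes t.unf := by
  induction t with
  | var n => exact varCase_describes n
  | lam t ih => exact ih.lamCase
  | app t u iht ihu => exact iht.appCase ihu
  | es t u iht ihu =>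
    rw [Bg_es_val]
    exact iht.esCase 0 ihu

theorem Cg_describes (t : Term) (C : Ctx) : (Cg t C).val.Describes (relUnf t C) := by
  induction C with
  | hole => exact Bg_describes t
  | lam C ih => exact ih
  | appL C u ih => exact ih
  | appR u C ih => exact ih
  | es C u ih =>
    rw [Cg_es_val]
    exact ih.esCase C.lamDepth (Bg_describes u)

/-! ### Relative unfolding -/

theorem relUnf_comp_congr {s s' : Term} {C : Ctx} (h : relUnf s C = relUnf s' C) (D : Ctx) :
    relUnf s (D.comp C) = relUnf s' (D.comp C) := by
  induction D with
  | hole => exact h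
  | lam D ih => exact ih
  | appL D u ih => exact ih
  | appR u D ih => exact ih
  | es D u ih => simp only [Ctx.comp, relUnf, ih]

/-- A term that mentions no binder of `C` is untouched by the substitutions of `C`; only the indices
of its abstractions remain. -/
theorem relUnf_shift_depth (C : Ctx) (v : Term) :
    relUnf (v.shift C.depth) C = v.unf.shift C.lamDepth := by
  induction C generalizing v with
  | hole => exact v.unf_rename _
  | lam C ih =>
    rw [relUnf, Ctx.depth, add_comm, ← Term.shift_shift, ih, Term.shift, Term.unf_rename,
      ← LTerm.shift, LTerm.shift_shift, Ctx.lamDepth, add_comm]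
  | appL C u ih => exact ih v
  | appR u C ih => exact ih v
  | es C u ih =>
    rw [relUnf, Ctx.depth, add_comm, ← Term.shift_shift, ih, Term.shift, Term.unf_rename,
      ← LTerm.shift, LTerm.shift_shift, add_comm, LTerm.substAt_shift, Ctx.lamDepth]

theorem relUnf_var_depth (C : Ctx) (j : ℕ) :
    relUnf (.var (C.depth + j)) C = .var (C.lamDepth + j) := by
  have := relUnf_shift_depth C (.var j)
  simpa only [Term.shift, Term.rename, LTerm.shift, LTerm.rename, Term.unf, add_comm] using this

/-- Performing the substitution step first or leaving it to the unfolding is the same. Hence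
usefulness can be tested on the variable in place, without extracting the content. -/
theorem relUnf_bound (D C : Ctx) (u : Term) :
    relUnf (u.shift (C.depth + 1)) (D.comp (.es C u)) = relUnf (.var C.depth) (D.comp (.es C u)) := by
  refine relUnf_comp_congr ?_ D
  have := relUnf_shift_depth (.es C u) u
  rw [Ctx.depth] at this
  rw [this, relUnf, ← add_zero C.depth, relUnf_var_depth, LTerm.substAt_eq, LTerm.subst, add_zero,
    LTerm.bindSubst_self, Ctx.lamDepth]

/-- A variable is bound by an explicit substitution of the context around it, or it is bound by an
abstraction, or it is free. In the last two cases, its unfolding is a variable. -/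
theorem relUnf_var_cases (E : Ctx) (n : ℕ) :
    (∃ (D C : Ctx) (u : Term), E = D.comp (.es C u) ∧ n = C.depth) ∨
    (n < E.depth ∧ ∃ m < E.lamDepth, relUnf (.var n) E = .var m) ∨ E.depth ≤ n := by
  induction E with
  | hole => exact .inr (.inr (Nat.zero_le n))
  | lam E ih =>
    rcases ih with ⟨D, C, u, rfl, h⟩ | ⟨h, m, hm, e⟩ | h
    · exact .inl ⟨.lam D, C, u, rfl, h⟩
    · exact .inr (.inl ⟨Nat.lt_succ_of_lt h, m, Nat.lt_succ_of_lt hm, e⟩)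
    · rcases h.eq_or_lt with rfl | h
      · exact .inr (.inl ⟨Nat.lt_succ_self _, E.lamDepth, Nat.lt_succ_self _,
          relUnf_var_depth E 0⟩)
      · exact .inr (.inr h)
  | appL E v ih =>
    rcases ih with ⟨D, C, u, rfl, h⟩ | h
    · exact .inl ⟨.appL D v, C, u, rfl, h⟩
    · exact .inr h
  | appR v E ih =>
    rcases ih with ⟨D, C, u, rfl, h⟩ | h
    · exact .inl ⟨.appR v D, C, u, rfl, h⟩
    · exact .inr h
  | es E v ih =>
    rcases ih with ⟨D, C, u, rfl, h⟩ | ⟨h, m, hm, e⟩ | h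
    · exact .inl ⟨.es D v, C, u, rfl, h⟩
    · refine .inr (.inl ⟨Nat.lt_succ_of_lt h, m, hm, ?_⟩)
      rw [relUnf, e, LTerm.substAt_eq, LTerm.subst, LTerm.bindSubst, if_pos hm]
    · rcases h.eq_or_lt with rfl | h
      · exact .inl ⟨.hole, E, v, rfl, rfl⟩
      · exact .inr (.inr h)

/-- A variable not bound by a substitution unfolds to a variable, which is neither an abstraction
nor contains a redex; so the right side forces the existence of the binding substitution, which need
not be located. -/
theorem usefulRedex_var {E : Ctx} {n : ℕ} : UsefulRedex E (.var n) ↔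
    (relUnf (.var n) E).HasBeta ∨ ((relUnf (.var n) E).IsLam ∧ E.Applicative) := by
  constructor
  · intro h
    cases h with
    | ls D C u E r hE hr h =>
      subst hE hr
      rwa [relUnf_bound] at h
  · intro h
    rcases relUnf_var_cases E n with ⟨D, C, u, rfl, rfl⟩ | ⟨-, m, -, e⟩ | hn
    · refine .ls D C u _ _ rfl rfl ?_
      rwa [relUnf_bound]
    · rw [e] at h
      rcases h with h | ⟨⟨r, h⟩, -⟩
      · exact absurd h LTerm.hasBeta_var
      · cases h
    · obtain ⟨j, rfl⟩ := Nat.exists_eq_add_of_le hn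
      rw [relUnf_var_depth] at h
      rcases h with h | ⟨⟨r, h⟩, -⟩
      · exact absurd h LTerm.hasBeta_var
      · cases h

/-! ### Answers and applicative contexts -/

/-- `t` is of the form `L⟨λx.r⟩`. -/
def Term.isAns : Term → Bool
  | var _ => false
  | lam _ => true
  | app _ _ => false
  | es t _ => t.isAns

theorem Term.isAns_iff {t : Term} : t.isAns = true ↔ ∃ L r, t = SubCtx.plug L (.lam r) := by
  induction t with
  | var n =>
    refine ⟨fun h => (Bool.false_ne_true h).elim, ?_⟩
    rintro ⟨_ | L, r, h⟩ <;> cases h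
  | lam t ih => exact ⟨fun _ => ⟨.hole, t, rfl⟩, fun _ => rfl⟩
  | app t u iht ihu =>
    refine ⟨fun h => (Bool.false_ne_true h).elim, ?_⟩
    rintro ⟨_ | L, r, h⟩ <;> cases h
  | es t u iht ihu =>
    rw [isAns, iht]
    constructor
    · rintro ⟨L, r, rfl⟩
      exact ⟨.es L u, r, rfl⟩
    · rintro ⟨_ | ⟨L, v⟩, r, h⟩
      · cases h
      · cases h
        exact ⟨L, r, rfl⟩

namespace Ctx

/-- The context is a substitution context. -/
def isSub : Ctx → Bool
  | hole => true
  | lam _ => false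
  | appL _ _ => false
  | appR _ _ => false
  | es C _ => C.isSub

theorem isSub_iff {C : Ctx} : C.isSub = true ↔ ∃ L : SubCtx, C = L.toCtx := by
  induction C with
  | hole => exact ⟨fun _ => ⟨.hole, rfl⟩, fun _ => rfl⟩
  | lam C ih =>
    refine ⟨fun h => (Bool.false_ne_true h).elim, ?_⟩
    rintro ⟨_ | L, h⟩ <;> cases h
  | appL C u ih =>
    refine ⟨fun h => (Bool.false_ne_true h).elim, ?_⟩
    rintro ⟨_ | L, h⟩ <;> cases h
  | appR u C ih =>
    refine ⟨fun h => (Bool.false_ne_true h).elim, ?_⟩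
    rintro ⟨_ | L, h⟩ <;> cases h
  | es C u ih =>
    rw [isSub, ih]
    constructor
    · rintro ⟨L, rfl⟩
      exact ⟨.es L u, rfl⟩
    · rintro ⟨_ | ⟨L, v⟩, h⟩
      · cases h
      · cases h
        exact ⟨L, rfl⟩

/-- The context is applicative. -/
def isAppl : Ctx → Bool
  | hole => false
  | lam C => C.isAppl
  | appL C _ => C.isSub || C.isAppl
  | appR _ C => C.isAppl
  | es C _ => C.isAppl

theorem isAppl_iff {E : Ctx} : E.isAppl = true ↔ E.Applicative := by
  induction E with
  | hole =>
    refine ⟨fun h => (Bool.false_ne_true h).elim, ?_⟩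
    rintro ⟨_ | _ | _ | _ | _, L, t, h⟩ <;> cases h
  | lam E ih =>
    rw [isAppl, ih]
    constructor
    · rintro ⟨C, L, t, rfl⟩
      exact ⟨lam C, L, t, rfl⟩
    · rintro ⟨C, L, t, h⟩
      cases C <;> cases h
      exact ⟨_, L, t, rfl⟩
  | appL E u ih =>
    rw [isAppl, Bool.or_eq_true, ih, isSub_iff]
    constructor
    · rintro (⟨L, rfl⟩ | ⟨C, L, t, rfl⟩)
      · exact ⟨hole, L, u, rfl⟩
      · exact ⟨appL C u, L, t, rfl⟩
    · rintro ⟨C, L, t, h⟩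
      cases C <;> cases h
      · exact .inl ⟨L, rfl⟩
      · exact .inr ⟨_, L, t, rfl⟩
  | appR u E ih =>
    rw [isAppl, ih]
    constructor
    · rintro ⟨C, L, t, rfl⟩
      exact ⟨appR u C, L, t, rfl⟩
    · rintro ⟨C, L, t, h⟩
      cases C <;> cases h
      exact ⟨_, L, t, rfl⟩
  | es E u ih =>
    rw [isAppl, ih]
    constructor
    · rintro ⟨C, L, t, rfl⟩
      exact ⟨es C u, L, t, rfl⟩
    · rintro ⟨C, L, t, h⟩
      cases C <;> cases h
      exact ⟨_, L, t, rfl⟩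

end Ctx

/-- The usefulness test. -/
def isUseful (E : Ctx) : Term → Bool
  | .var n => (Cg (.var n) E).val.redex ||
      (decide ((Cg (.var n) E).val.nature = .lam) && E.isAppl)
  | .lam _ => false
  | .app t _ => t.isAns
  | .es _ _ => false

theorem isUseful_iff {E : Ctx} {s : Term} : isUseful E s = true ↔ UsefulRedex E s := by
  cases s with
  | var n =>
    rw [usefulRedex_var, isUseful, Bool.or_eq_true, Bool.and_eq_true, decide_eq_true_eq,
      (Cg_describes _ E).redex, (Cg_describes _ E).nature, LTerm.nature_eq_lam, Ctx.isAppl_iff]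
  | lam t =>
    refine ⟨fun h => (Bool.false_ne_true h).elim, fun h => ?_⟩
    cases h
  | app t u =>
    rw [isUseful, Term.isAns_iff]
    constructor
    · rintro ⟨L, r, rfl⟩
      exact .dB E L r u
    · intro h
      cases h with
      | dB L r u => exact ⟨_, _, rfl⟩
  | es t u =>
    refine ⟨fun h => (Bool.false_ne_true h).elim, fun h => ?_⟩
    cases h

theorem usefulTest_eq (R : Ctx × Term) : usefulTest R = isUseful R.1 R.2 := by
  rw [Bool.eq_iff_iff, isUseful_iff, usefulTest]
  exact @decide_eq_true_iff _ (_)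

end LSC

namespace LSC

open LSC.Rep
open Computability (encodeNat encodeNum encodePosNum)

/-! ### Usefulness in polynomial time -/

/-- Whether a term is an answer, is a `dB`-redex, or is a variable. -/
def shapeAlg : RawAlg Unit (Bool × Bool × Bool) where
  var _ _ := (false, false, true)
  hole _ := (false, false, false)
  lam _ _ := (true, false, false)
  bin
    | .app, _, x, _ => (false, x.1, false)
    | .appL, _, _, _ => (false, false, false)
    | .appR, _, _, _ => (false, false, false)
    | .es, _, x, _ => (x.1, false, false)

theorem shapeAlg_poly : shapeAlg.Poly where
  var := PolyFun.const _
  hole := PolyFun.const _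
  lam := PolyFun.const _
  bin o := by
    have hx := (PolyFun.id
      (α := Unit × (Bool × Bool × Bool) × (Bool × Bool × Bool))).snd.fst.fst
    cases o
    · exact (PolyFun.const false).pair (hx.pair (PolyFun.const false))
    · exact PolyFun.const _
    · exact PolyFun.const _
    · exact hx.pair (PolyFun.const (false, false))

theorem Term.fold_shapeAlg_fst (t : Term) : (t.raw.fold shapeAlg ()).1 = t.isAns := by
  induction t with
  | var n => rfl
  | lam t ih => rfl
  | app t u iht ihu => rfl
  | es t u iht ihu => exact iht

/-- Whether a context is a substitution context, and whether it is applicative. -/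
def applAlg : RawAlg Unit (Bool × Bool) where
  var _ _ := (false, false)
  hole _ := (true, false)
  lam _ x := (false, x.2)
  bin
    | .app, _, _, _ => (false, false)
    | .appL, _, x, _ => (false, x.1 || x.2)
    | .appR, _, _, y => (false, y.2)
    | .es, _, x, _ => x

theorem applAlg_poly : applAlg.Poly where
  var := PolyFun.const _
  hole := PolyFun.const _
  lam := (PolyFun.const false).pair PolyFun.id.snd.snd
  bin o := by
    have hx := (PolyFun.id (α := Unit × (Bool × Bool) × (Bool × Bool))).snd.fst
    cases o
    · exact PolyFun.const _
    · exact (PolyFun.const false).pair (hx.fst.or hx.snd)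
    · exact (PolyFun.const false).pair PolyFun.id.snd.snd.snd
    · exact hx

theorem Ctx.fold_applAlg (C : Ctx) : C.raw.fold applAlg () = (C.isSub, C.isAppl) := by
  induction C with
  | hole => rfl
  | lam C ih =>
    show applAlg.lam () (C.raw.fold applAlg ()) = _
    rw [ih]; rfl
  | appL C u ih =>
    show applAlg.bin .appL () (C.raw.fold applAlg ()) _ = _
    rw [ih]; rfl
  | appR u C ih =>
    show applAlg.bin .appR () _ (C.raw.fold applAlg ()) = _
    rw [ih]; rfl
  | es C u ih => exact ih

/-- The usefulness test on trees. -/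
def Raw.isUseful (E s : Raw) : Bool :=
  (s.fold shapeAlg ()).2.1 || ((s.fold shapeAlg ()).2.2 &&
    ((E.fold tupleAlg (s.fold tupleAlg ⟨.lam, false, [], []⟩).2).2.redex ||
      (decide ((E.fold tupleAlg (s.fold tupleAlg ⟨.lam, false, [], []⟩).2).2.nature = .lam) &&
        (E.fold applAlg ()).2)))

theorem Raw.isUseful_raw (E : Ctx) (s : Term) : E.raw.isUseful s.raw = LSC.isUseful E s := by
  rw [Raw.isUseful, Term.fold_raw, Ctx.fold_raw, Ctx.fold_applAlg]
  cases s with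
  | var n => rfl
  | lam t => rfl
  | app t u =>
    show ((t.raw.fold shapeAlg ()).1 || _) = _
    rw [Term.fold_shapeAlg_fst]
    exact Bool.or_false _
  | es t u => rfl

theorem PolyFun.rawIsUseful {α : Type} [Rep α] {E s : α → Raw} (hE : PolyFun E) (hs : PolyFun s) :
    PolyFun fun x => (E x).isUseful (s x) := by
  have h1 := foldRaw shapeAlg_poly (const (α := α) ()) hs 20 (fun x t _ => by
    obtain ⟨a, b, c⟩ := t.fold shapeAlg ()
    simp only [sz_prod, sz_bool, Polynomial.eval_ofNat]; omega) (false, false, false)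
  have h2 := foldRaw applAlg_poly (const (α := α) ()) hE 20 (fun x t _ => by
    obtain ⟨a, b⟩ := t.fold applAlg ()
    simp only [sz_prod, sz_bool, Polynomial.eval_ofNat]; omega) (false, false)
  have h3 := (foldTuple (foldTuple (const ⟨.lam, false, [], []⟩) hs).snd hE).snd
  exact h1.snd.fst.or (h1.snd.snd.and (h3.redex.or (h3.nature.isLam.and h2.snd)))

theorem polyTime_usefulTest : PolyTime (ctxCode.pair termCode) boolCode usefulTest := by
  have h1 := PolyFun.splitTwo (PolyFun.id (α := Forest))
  have h2 := PolyFun.rawIsUseful h1.fst h1.snd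
  have h3 := ((h2.congr_out (g := fun x : Forest => Tok.bit _) fun _ => rfl).cons PolyFun.nil)
  refine h3.polyTime (fun p => ⟨[p.1.raw, p.2.raw]⟩) (fun p => ?_) fun p => ?_
  · show rep (List.flatMap Raw.enc _) = _
    simp only [List.flatMap_cons, List.flatMap_nil, List.append_nil, Term.enc_raw, Ctx.enc_raw]
    rfl
  · simp only [Raw.isUseful_raw, usefulTest_eq]
    rfl

/-! ### The decompositions of a term -/

/-- All the pairs `(E, s)` such that `E⟨s⟩ = t`, in the left-to-right outside-in order. -/
def decs : Term → List (Ctx × Term)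
  | .var n => [(.hole, .var n)]
  | .lam t => (.hole, .lam t) :: (decs t).map fun p => (.lam p.1, p.2)
  | .app t u => (.hole, .app t u) :: ((decs t).map (fun p => (.appL p.1 u, p.2)) ++
      (decs u).map fun p => (.appR t p.1, p.2))
  | .es t u => (.hole, .es t u) :: (decs t).map fun p => (.es p.1 u, p.2)

/-- A tree together with its decompositions. -/
def decsAlg : RawAlg Unit (Raw × List (Raw × Raw)) where
  var _ n := (.var n, [(.hole, .var n)])
  hole _ := (.hole, [])
  lam _ x := (.lam x.1, (.hole, .lam x.1) :: x.2.map fun p => (.lam p.1, p.2))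
  bin
    | .app, _, x, y => (.bin .app x.1 y.1, (.hole, .bin .app x.1 y.1) ::
        (x.2.map (fun p => (.bin .appL p.1 y.1, p.2)) ++
          y.2.map fun p => (.bin .appR x.1 p.1, p.2)))
    | .appL, _, _, _ => (.hole, [])
    | .appR, _, _, _ => (.hole, [])
    | .es, _, x, y => (.bin .es x.1 y.1, (.hole, .bin .es x.1 y.1) ::
        x.2.map fun p => (.bin .es p.1 y.1, p.2))

theorem decsAlg_poly : decsAlg.Poly where
  var :=
    have h := idAlg_poly.var
    h.pair (((PolyFun.const Raw.hole).pair h).cons PolyFun.nil)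
  hole := PolyFun.const _
  lam :=
    have hl := fun {α : Type} [Rep α] {f : α → Raw} (hf : PolyFun f) =>
      idAlg_poly.lam.comp ((PolyFun.const ()).pair hf)
    have hx := hl (PolyFun.id (α := Unit × Raw × List (Raw × Raw))).snd.fst
    hx.pair (((PolyFun.const Raw.hole).pair hx).cons
      (PolyFun.map (γ := Unit) (g := fun x : Unit × Raw × Raw => (Raw.lam x.2.1, x.2.2))
        ((hl PolyFun.id.snd.fst).pair PolyFun.id.snd.snd) (PolyFun.const ()) PolyFun.id.snd.snd))
  bin o := by
    have hb := fun (o : BinOp) {α : Type} [Rep α] {f g : α → Raw} (hf : PolyFun f)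
      (hg : PolyFun g) => (idAlg_poly.bin o).comp ((PolyFun.const ()).pair (hf.pair hg))
    have hx := (PolyFun.id
      (α := Unit × (Raw × List (Raw × Raw)) × (Raw × List (Raw × Raw)))).snd.fst
    have hy := (PolyFun.id
      (α := Unit × (Raw × List (Raw × Raw)) × (Raw × List (Raw × Raw)))).snd.snd
    cases o
    · have h1 := PolyFun.map (γ := Raw) (g := fun x : Raw × Raw × Raw => (Raw.bin .appL x.2.1 x.1, x.2.2))
        ((hb .appL PolyFun.id.snd.fst PolyFun.id.fst).pair PolyFun.id.snd.snd) hy.fst hx.snd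
      have h2 := PolyFun.map (γ := Raw) (g := fun x : Raw × Raw × Raw => (Raw.bin .appR x.1 x.2.1, x.2.2))
        ((hb .appR PolyFun.id.fst PolyFun.id.snd.fst).pair PolyFun.id.snd.snd) hx.fst hy.snd
      have h3 := hb .app hx.fst hy.fst
      exact h3.pair (((PolyFun.const Raw.hole).pair h3).cons (h1.append h2))
    · exact PolyFun.const _
    · exact PolyFun.const _
    · have h1 := PolyFun.map (γ := Raw) (g := fun x : Raw × Raw × Raw => (Raw.bin .es x.2.1 x.1, x.2.2))
        ((hb .es PolyFun.id.snd.fst PolyFun.id.fst).pair PolyFun.id.snd.snd) hy.fst hx.snd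
      have h3 := hb .es hx.fst hy.fst
      exact h3.pair (((PolyFun.const Raw.hole).pair h3).cons h1)

theorem Term.fold_decsAlg (t : Term) : t.raw.fold decsAlg () =
    (t.raw, (decs t).map fun p => (p.1.raw, p.2.raw)) := by
  induction t with
  | var n => rfl
  | lam t ih =>
    show decsAlg.lam () (t.raw.fold decsAlg ()) = _
    rw [ih]
    simp [decsAlg, decs, Term.raw, Ctx.raw]
  | app t u iht ihu =>
    show decsAlg.bin .app () (t.raw.fold decsAlg ()) (u.raw.fold decsAlg ()) = _
    rw [iht, ihu]
    simp [decsAlg, decs, Term.raw, Ctx.raw, Function.comp_def]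
  | es t u iht ihu =>
    show decsAlg.bin .es () (t.raw.fold decsAlg ()) (u.raw.fold decsAlg ()) = _
    rw [iht, ihu]
    simp [decsAlg, decs, Term.raw, Ctx.raw]

/-- A decomposition splits the encoding in two and adds only the hole token, and there is at most
one decomposition per token. The list has quadratic size. -/
theorem Raw.fold_decsAlg_bounds (r : Raw) :
    (r.fold decsAlg ()).1.enc.length ≤ r.enc.length ∧
    (r.fold decsAlg ()).2.length ≤ r.enc.length ∧
    ∀ p ∈ (r.fold decsAlg ()).2, p.1.enc.length + p.2.enc.length ≤ r.enc.length + 1 := by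
  induction r with
  | var n => simp [fold, decsAlg, enc]; omega
  | hole => simp [fold, decsAlg, enc]
  | lam t ih =>
    simp only [fold, enc, List.length_cons] at *
    generalize fold decsAlg () t = x at *
    obtain ⟨h1, h2, h3⟩ := ih
    simp only [decsAlg, enc, List.length_cons, List.length_map, List.mem_cons, List.mem_map]
    refine ⟨by omega, by omega, ?_⟩
    rintro p (rfl | ⟨p, hp, rfl⟩)
    · simp [enc]; omega
    · have := h3 p hp
      simp only [enc, List.length_cons]; omega
  | bin o t u iht ihu =>
    simp only [fold, enc, List.length_cons, List.length_append] at *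
    generalize fold decsAlg () t = x at *
    generalize fold decsAlg () u = y at *
    obtain ⟨h1, h2, h3⟩ := iht
    obtain ⟨h4, h5, h6⟩ := ihu
    cases o
    · simp only [decsAlg, enc, List.length_cons, List.length_append, List.length_map,
        List.mem_cons, List.mem_append, List.mem_map]
      refine ⟨by omega, by omega, ?_⟩
      rintro p (rfl | ⟨p, hp, rfl⟩ | ⟨p, hp, rfl⟩)
      · simp [enc]; omega
      · have := h3 p hp
        simp only [enc, List.length_cons, List.length_append]; omega
      · have := h6 p hp
        simp only [enc, List.length_cons, List.length_append]; omega
    · simp [decsAlg, enc]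
    · simp [decsAlg, enc]
    · simp only [decsAlg, enc, List.length_cons, List.length_append, List.length_map,
        List.mem_cons, List.mem_map]
      refine ⟨by omega, by omega, ?_⟩
      rintro p (rfl | ⟨p, hp, rfl⟩)
      · simp [enc]; omega
      · have := h3 p hp
        simp only [enc, List.length_cons, List.length_append]; omega

theorem sz_le_length_mul {α : Type} [Rep α] {l : List α} {m : ℕ} (h : ∀ a ∈ l, sz a ≤ m) :
    sz l ≤ 2 + l.length * (m + 1) := by
  induction l with
  | nil => simp
  | cons a l ih =>
    have h1 := ih fun b hb => h b (List.mem_cons_of_mem _ hb)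
    have h2 := h a List.mem_cons_self
    rw [sz_cons, List.length_cons, Nat.add_mul]
    omega

theorem Raw.sz_fold_decsAlg (r : Raw) :
    sz (r.fold decsAlg ()) ≤ 3 * r.enc.length + 10 + r.enc.length * (3 * r.enc.length + 9) := by
  obtain ⟨h1, h2, h3⟩ := r.fold_decsAlg_bounds
  generalize Raw.fold decsAlg () r = x at *
  obtain ⟨r', l⟩ := x
  have h4 : sz l ≤ 2 + l.length * (3 * r.enc.length + 9) := sz_le_length_mul fun p hp => by
    have := h3 p hp
    rw [← Prod.eta p, sz_prod, sz_raw, sz_raw]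
    omega
  dsimp only at h1 h2
  have h5 := Nat.mul_le_mul_right (3 * r.enc.length + 9) h2
  rw [sz_prod, sz_raw]
  omega

theorem PolyFun.decs {α : Type} [Rep α] {r : α → Raw} (hr : PolyFun r) :
    PolyFun fun x => ((r x).fold decsAlg ()).2 := by
  obtain ⟨q, hq⟩ := hr.sz_le
  refine (foldRaw decsAlg_poly (const (α := α) ()) hr (3 * q + 10 + q * (3 * q + 9))
    (fun x t ht => ?_) (Raw.hole, [])).snd
  refine (Raw.sz_fold_decsAlg t).trans ?_
  have h1 := hq x
  rw [sz_raw] at h1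
  have h2 : t.enc.length ≤ q.eval (sz x) := by omega
  simp only [Polynomial.eval_add, Polynomial.eval_mul, Polynomial.eval_ofNat]
  gcongr

/-- The position of the redex that is selected by the strategy. -/
def nextRedex (t : Term) : Option Ctx := ((decs t).find? fun p => isUseful p.1 p.2).map Prod.fst

theorem polyTime_nextRedex : PolyTime termCode ctxCode.option nextRedex := by
  have h1 := PolyFun.find? (γ := Unit) (g := fun x : Unit × Raw × Raw => x.2.1.isUseful x.2.2)
    (PolyFun.rawIsUseful PolyFun.id.snd.fst PolyFun.id.snd.snd) (PolyFun.const (α := Raw) ())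
    (PolyFun.decs PolyFun.id)
  have h2 := PolyFun.optionCase h1 (f := fun _ => [Tok.endm])
    (g := fun x : Raw × Raw × Raw => Tok.some :: x.2.1.enc) (PolyFun.const _)
    (PolyFun.cons (g := fun x : Raw × Raw × Raw => x.2.1.enc) (PolyFun.const Tok.some) (PolyFun.id.snd.fst.congr_out
      (g := fun x : Raw × Raw × Raw => x.2.1.enc) fun _ => rfl))
  refine h2.polyTime Term.raw (fun t => ?_) fun t => ?_
  · show rep t.raw.enc = _
    rw [Term.enc_raw]; rfl
  · simp only [Term.fold_decsAlg, List.find?_map, nextRedex]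
    have : ((fun x : Raw × Raw => x.1.isUseful x.2) ∘ fun p : Ctx × Term => (p.1.raw, p.2.raw)) =
        fun p => isUseful p.1 p.2 := funext fun p => Raw.isUseful_raw p.1 p.2
    rw [this]
    cases (LSC.decs t).find? fun p => isUseful p.1 p.2 with
    | none => rfl
    | some p => exact congrArg _ p.1.enc_raw

end LSC

namespace LSC

/-! ### The left-to-right outside-in order -/

namespace Ctx

/-- The sequence of directions from the root to the hole. -/
def path : Ctx → List ℕ
  | hole => []
  | lam C => 0 :: C.path
  | appL C _ => 0 :: C.path
  | appR _ C => 1 :: C.path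
  | es C _ => 0 :: C.path

theorem path_comp (C D : Ctx) : (C.comp D).path = C.path ++ D.path := by
  induction C <;> simp_all [comp, path]

theorem OutsideIn.path_lt {C D : Ctx} (h : OutsideIn C D) : C.path < D.path := by
  induction h with
  | @root C h =>
    cases C with
    | hole => exact absurd rfl h
    | _ => exact List.nil_lt_cons _ _
  | closure E h ih =>
    rw [path_comp, path_comp]
    exact List.append_left_lt ih

theorem LeftRight.path_lt {C D : Ctx} (h : LeftRight C D) : C.path < D.path := by
  induction h with
  | app hC hD => exact List.cons_lt_cons_iff.2 (.inl Nat.zero_lt_one)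
  | closure E h ih =>
    rw [path_comp, path_comp]
    exact List.append_left_lt ih

/-- The lexicographic order on paths is a strict total order, which makes `LO` asymmetric; this
gives the uniqueness of the selected position. -/
theorem LO.path_lt {C D : Ctx} (h : C.LO D) : C.path < D.path :=
  h.elim OutsideIn.path_lt LeftRight.path_lt

theorem LO.closure (E : Ctx) {C D : Ctx} (h : C.LO D) : (E.comp C).LO (E.comp D) :=
  h.imp (.closure E) (.closure E)

end Ctx

theorem mem_decs {t : Term} {p : Ctx × Term} : p ∈ decs t ↔ p.1.plug p.2 = t := by
  obtain ⟨E, s⟩ := p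
  induction t generalizing E with
  | var n => cases E <;> simp [decs, Ctx.plug]
  | lam t ih =>
    have := fun E => ih E
    cases E <;> simp_all [decs, Ctx.plug]
  | app t u iht ihu =>
    cases E <;> simp_all [decs, Ctx.plug, eq_comm, and_comm]
  | es t u iht ihu =>
    cases E <;> simp_all [decs, Ctx.plug, eq_comm, and_comm]

/-- Since `decs` enumerates positions along the order of the strategy, minimisation becomes a linear
search. -/
theorem pairwise_decs (t : Term) : (decs t).Pairwise fun p q => p.1.LO q.1 := by
  induction t with
  | var n => exact List.pairwise_singleton _ _
  | lam t ih =>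
    refine List.pairwise_cons.2 ⟨fun p hp => ?_, List.pairwise_map.2
      (ih.imp fun h => h.closure (.lam .hole))⟩
    obtain ⟨p, hp, rfl⟩ := List.mem_map.1 hp
    exact .inl (.root (by simp))
  | app t u iht ihu =>
    refine List.pairwise_cons.2 ⟨fun p hp => ?_, List.pairwise_append.2
      ⟨List.pairwise_map.2 (iht.imp fun h => h.closure (.appL .hole u)),
        List.pairwise_map.2 (ihu.imp fun h => h.closure (.appR t .hole)), fun p hp q hq => ?_⟩⟩
    · rcases List.mem_append.1 hp with hp | hp <;> obtain ⟨p, hp, rfl⟩ := List.mem_map.1 hp <;>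
        exact .inl (.root (by simp))
    · obtain ⟨p, hp', rfl⟩ := List.mem_map.1 hp
      obtain ⟨q, hq', rfl⟩ := List.mem_map.1 hq
      exact .inr (.app ⟨_, mem_decs.1 hp'⟩ ⟨_, mem_decs.1 hq'⟩)
  | es t u iht ihu =>
    refine List.pairwise_cons.2 ⟨fun p hp => ?_, List.pairwise_map.2
      (iht.imp fun h => h.closure (.es .hole u))⟩
    obtain ⟨p, hp, rfl⟩ := List.mem_map.1 hp
    exact .inl (.root (by simp))

theorem lou_of_find {t : Term} {p : Ctx × Term}
    (h : ((decs t).find? fun p => isUseful p.1 p.2) = some p) : LOU t p.1 := by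
  obtain ⟨hp, l, m, e, hl⟩ := List.find?_eq_some_iff_append.1 h
  refine ⟨p.2, mem_decs.1 (e ▸ by simp), isUseful_iff.1 hp, fun E' s' he hu hne => ?_⟩
  have hm : (E', s') ∈ decs t := mem_decs.2 he
  have hpw := pairwise_decs t
  rw [e] at hm hpw
  rcases List.mem_append.1 hm with hm | hm
  · have := hl _ hm
    rw [isUseful_iff.2 hu] at this
    cases this
  · rcases List.mem_cons.1 hm with rfl | hm
    · exact absurd rfl hne
    · exact (List.pairwise_cons.1 (List.pairwise_append.1 hpw).2.1).1 _ hm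

theorem nextRedex_eq_some {t : Term} {E : Ctx} : nextRedex t = some E ↔ LOU t E := by
  rw [nextRedex, Option.map_eq_some_iff]
  constructor
  · rintro ⟨p, h, rfl⟩
    exact lou_of_find h
  · rintro ⟨s, hs, hu, h⟩
    cases hf : (decs t).find? fun p => isUseful p.1 p.2 with
    | none =>
      refine absurd (isUseful_iff.2 hu) ?_
      exact List.find?_eq_none.1 hf (E, s) (mem_decs.2 hs)
    | some p =>
      -- Two distinct minimal positions would precede each other, against the asymmetry of the order
      -- on paths.
      refine ⟨p, rfl, by_contra fun hne => ?_⟩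
      obtain ⟨s', hs', hu', h'⟩ := lou_of_find hf
      exact lt_asymm (h _ _ hs' hu' hne).path_lt (h' _ _ hs hu (Ne.symm hne)).path_lt

theorem selectionProperty_LOU : SelectionProperty LOU :=
  ⟨nextRedex, polyTime_nextRedex, fun _ _ => nextRedex_eq_some⟩

end LSC

namespace LSC

/-! ### Subterms -/

namespace Term

theorem SubAt.trans {t s r : Term} {d e : ℕ} (h : SubAt t d s) (h' : SubAt s e r) :
    SubAt t (d + e) r := by
  induction h with
  | refl => rwa [Nat.zero_add]
  | lam _ ih => rw [Nat.succ_add]; exact (ih h').lam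
  | appL u _ ih => exact (ih h').appL u
  | appR t _ ih => exact (ih h').appR t
  | esL u _ ih => rw [Nat.succ_add]; exact (ih h').esL u
  | esR t _ ih => exact (ih h').esR t

theorem isSubterm_refl (t : Term) : IsSubterm 0 t t :=
  ⟨0, t, fun n => n, .refl t, (rename_id t).symm, fun _ _ _ _ h => h,
    fun i hi => absurd hi (Nat.not_lt_zero i), fun _ _ => rfl⟩

namespace IsSubterm

variable {t r s : Term} {d : ℕ}

theorem shift (k : ℕ) (h : IsSubterm d r t) : IsSubterm (d + k) (r.shift k) t := by
  obtain ⟨e, r₀, ρ, h1, rfl, h2, h3, h4⟩ := h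
  refine ⟨e, r₀, fun n => ρ n + k, h1, rename_rename _ _ _, fun i hi j hj e => h2 hi hj ?_,
    fun i hi hf => Nat.add_lt_add_right (h3 i hi hf) k, fun j hj => ?_⟩
  · exact Nat.add_right_cancel e
  · simp only [h4 j hj]; omega

/-- Descent under a binder. -/
theorem of_scope {e : ℕ} {q q₀ : Term} {ρ : ℕ → ℕ} (h1 : SubAt t (e + 1) q₀)
    (h : q = q₀.rename (liftRen ρ)) (h2 : Set.InjOn ρ {i | Free (i + 1) q₀})
    (h3 : ∀ i, i < e → Free (i + 1) q₀ → ρ i < d)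
    (h4 : ∀ j, Free (e + j + 1) q₀ → ρ (e + j) = d + j) : IsSubterm (d + 1) q t := by
  refine ⟨e + 1, q₀, liftRen ρ, h1, h, ?_, ?_, fun j hj => ?_⟩
  · rintro (_ | i) hi (_ | j) hj e
    · rfl
    · simp [liftRen] at e
    · simp [liftRen] at e
    · rw [h2 hi hj (Nat.succ.inj e)]
  · rintro (_ | i) hi hf
    · exact Nat.succ_pos d
    · exact Nat.succ_lt_succ (h3 i (Nat.lt_of_succ_lt_succ hi) hf)
  · have e1 : e + 1 + j = e + j + 1 := by omega
    rw [e1] at hj ⊢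
    simp only [liftRen, h4 j hj]
    omega

theorem of_part {e : ℕ} {q q₀ : Term} {ρ : ℕ → ℕ} (h1 : SubAt t e q₀) (h : q = q₀.rename ρ)
    {F : ℕ → Prop} (hF : ∀ i, Free i q₀ → F i) (h2 : Set.InjOn ρ {i | F i})
    (h3 : ∀ i, i < e → F i → ρ i < d) (h4 : ∀ j, F (e + j) → ρ (e + j) = d + j) :
    IsSubterm d q t :=
  ⟨e, q₀, ρ, h1, h, fun _ hi _ hj => h2 (hF _ hi) (hF _ hj), fun i hi hf => h3 i hi (hF _ hf),
    fun j hj => h4 j (hF _ hj)⟩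

theorem of_lam (h : IsSubterm d (lam r) t) : IsSubterm (d + 1) r t := by
  obtain ⟨e, r₀, ρ, h1, h, h2, h3, h4⟩ := h
  -- A renaming keeps the head constructor, so the original occurrence `r₀` has the same shape.
  cases r₀ <;> cases h
  exact of_scope (h1.trans (.lam (.refl _))) rfl h2 h3 h4

theorem of_app_left (h : IsSubterm d (app r s) t) : IsSubterm d r t := by
  obtain ⟨e, r₀, ρ, h1, h, h2, h3, h4⟩ := h
  cases r₀ <;> cases h
  exact of_part (h1.trans (.appL _ (.refl _))) rfl (fun _ h => .inl h) h2 h3 h4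

theorem of_app_right (h : IsSubterm d (app r s) t) : IsSubterm d s t := by
  obtain ⟨e, r₀, ρ, h1, h, h2, h3, h4⟩ := h
  cases r₀ <;> cases h
  exact of_part (h1.trans (.appR _ (.refl _))) rfl (fun _ h => .inr h) h2 h3 h4

theorem of_es_left (h : IsSubterm d (es r s) t) : IsSubterm (d + 1) r t := by
  obtain ⟨e, r₀, ρ, h1, h, h2, h3, h4⟩ := h
  cases r₀ <;> cases h
  exact of_scope (h1.trans (.esL _ (.refl _))) rfl (fun _ hi _ hj => h2 (.inl hi) (.inl hj))
    (fun i hi hf => h3 i hi (.inl hf)) fun j hj => h4 j (.inl hj)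

theorem of_es_right (h : IsSubterm d (es r s) t) : IsSubterm d s t := by
  obtain ⟨e, r₀, ρ, h1, h, h2, h3, h4⟩ := h
  cases r₀ <;> cases h
  exact of_part (h1.trans (.esR _ (.refl _))) rfl (fun _ h => .inr h) h2 h3 h4

end IsSubterm

/-- All the arguments and the contents of the explicit substitutions of `s`, which lives in the
scope of `d` binders, are subterms of `t`. -/
def Intact (t : Term) : ℕ → Term → Prop
  | _, var _ => True
  | d, lam s => Intact t (d + 1) s
  | d, app s u => Intact t d s ∧ IsSubterm d u t
  | d, es s u => Intact t (d + 1) s ∧ IsSubterm d u t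

/-- Being a subterm passes to parts. Hence a copied subterm is intact wherever it lands. -/
theorem IsSubterm.intact {t s : Term} {d : ℕ} (h : IsSubterm d s t) : Intact t d s := by
  induction s generalizing d with
  | var n => trivial
  | lam s ih => exact ih h.of_lam
  | app s u ihs ihu => exact ⟨ihs h.of_app_left, h.of_app_right⟩
  | es s u ihs ihu => exact ⟨ihs h.of_es_left, h.of_es_right⟩

/-- The argument enters the substitutions of `L` and is shifted accordingly; it remains a subterm
because subterms are taken up to renaming. -/
theorem Intact.contract_dB {t r u : Term} {d : ℕ} {L : SubCtx} (h : Intact t d (L.plug (lam r)))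
    (hu : IsSubterm d u t) : Intact t d (L.plug (es r (u.shift L.length))) := by
  induction L generalizing d u with
  | hole =>
    refine ⟨h, ?_⟩
    have := hu.shift 0
    exact this
  | es L v ih =>
    refine ⟨?_, h.2⟩
    have := ih h.1 (hu.shift 1)
    rwa [shift_shift, Nat.add_comm 1] at this

end Term

/-! ### Derivations of the strategy -/

namespace Ctx

theorem comp_assoc (C D E : Ctx) : (C.comp D).comp E = C.comp (D.comp E) := by
  induction C <;> simp_all [comp]

theorem comp_hole (C : Ctx) : C.comp hole = C := by
  induction C <;> simp_all [comp]

theorem depth_comp (C D : Ctx) : (C.comp D).depth = C.depth + D.depth := by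
  induction C <;> simp_all [comp, depth] <;> omega

/-- The contents of the explicit substitutions of the context, which lives in the scope of `d`
binders, are subterms of `t`. -/
def Intact (t : Term) : ℕ → Ctx → Prop
  | _, hole => True
  | d, lam C => Intact t (d + 1) C
  | d, appL C _ => Intact t d C
  | d, appR _ C => Intact t d C
  | d, es C u => Intact t (d + 1) C ∧ Term.IsSubterm d u t

theorem intact_comp {t : Term} {d : ℕ} {C D : Ctx} :
    (C.comp D).Intact t d ↔ C.Intact t d ∧ D.Intact t (d + C.depth) := by
  induction C generalizing d with
  | hole => simp [comp, Intact, depth]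
  | lam C ih => simp only [comp, Intact, depth, ih, Nat.add_assoc, Nat.add_comm 1]
  | appL C u ih => exact ih
  | appR u C ih => exact ih
  | es C u ih =>
    simp only [comp, Intact, depth, ih, Nat.add_assoc, Nat.add_comm 1, and_assoc, and_comm,
      and_left_comm]

/-- Neither the relative unfolding nor applicativity looks at the arguments beside the path to the
hole. The next lemmas record this, so that reducing an argument does not affect usefulness to its
left. -/
theorem lamDepth_comp_appL (E P : Ctx) (u u' : Term) :
    (E.comp (appL P u)).lamDepth = (E.comp (appL P u')).lamDepth := by
  induction E <;> simp_all [comp, lamDepth]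

theorem isSub_comp_appL (E P : Ctx) (u u' : Term) :
    (E.comp (appL P u)).isSub = (E.comp (appL P u')).isSub := by
  induction E <;> simp_all [comp, isSub]

theorem isAppl_comp_appL (E P : Ctx) (u u' : Term) :
    (E.comp (appL P u)).isAppl = (E.comp (appL P u')).isAppl := by
  induction E with
  | appL E v ih => simp only [comp, isAppl, ih, isSub_comp_appL E P u u']
  | _ => simp_all [comp, isAppl]

end Ctx

theorem relUnf_comp_appL (s : Term) (E P : Ctx) (u u' : Term) :
    relUnf s (E.comp (.appL P u)) = relUnf s (E.comp (.appL P u')) := by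
  induction E with
  | es E v ih => simp only [Ctx.comp, relUnf, ih, Ctx.lamDepth_comp_appL E P u u']
  | _ => simp_all [Ctx.comp, relUnf]

/-- The usefulness of a redex does not depend on the arguments of its position. -/
theorem UsefulRedex.change_arg {s : Term} {E P : Ctx} {u : Term} (u' : Term)
    (h : UsefulRedex (E.comp (.appL P u)) s) : UsefulRedex (E.comp (.appL P u')) s := by
  cases s with
  | var n =>
    rw [usefulRedex_var] at h ⊢
    rwa [relUnf_comp_appL _ E P u' u, ← Ctx.isAppl_iff, Ctx.isAppl_comp_appL E P u' u,
      Ctx.isAppl_iff]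
  | lam t => cases h
  | app t v =>
    cases h with
    | dB => exact .dB _ _ _ v
  | es t v => cases h

/-! ### The first useful redex and the invariant of derivations -/

/-- In the context `E`, the term `s` has no useful redex. -/
def UsefulNormal (E : Ctx) (s : Term) : Prop := ∀ P r, P.plug r = s → ¬UsefulRedex (E.comp P) r

theorem UsefulNormal.change_arg {E : Ctx} {s u : Term} (u' : Term)
    (h : UsefulNormal (E.comp (.appL .hole u)) s) : UsefulNormal (E.comp (.appL .hole u')) s := by
  intro P r hr hu
  refine h P r hr ?_
  rw [Ctx.comp_assoc] at hu ⊢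
  exact hu.change_arg u

/-- `P` is the position of the first useful redex of `s`, in the context `E`. -/
inductive First : Ctx → Ctx → Term → Prop
  | here {E : Ctx} {s : Term} : UsefulRedex E s → First E .hole s
  | lam {E P : Ctx} {s : Term} : First (E.comp (.lam .hole)) P s → First E (.lam P) (.lam s)
  | es {E P : Ctx} {s u : Term} :
      First (E.comp (.es .hole u)) P s → First E (.es P u) (.es s u)
  | appL {E P : Ctx} {s u : Term} : s.isAns = false → First (E.comp (.appL .hole u)) P s →
      First E (.appL P u) (.app s u)
  | appR {E P : Ctx} {s u : Term} : s.isAns = false → UsefulNormal (E.comp (.appL .hole u)) s →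
      First (E.comp (.appR s .hole)) P u → First E (.appR s P) (.app s u)

theorem isAns_eq_false_of_not_useful {E : Ctx} {s u : Term} (h : ¬UsefulRedex E (.app s u)) :
    s.isAns = false := by
  rw [← Bool.not_eq_true]
  exact fun hs => h (isUseful_iff.1 hs)

/-- Minimality of the path unrolls along the position: the applications passed are not themselves
`dB`-redexes, since their paths are shorter prefixes, and a turn to the right means that the left
part has no useful redex. -/
theorem first_of_path_min {E P : Ctx} {r s : Term} (hs : P.plug r = s)
    (hu : UsefulRedex (E.comp P) r)
    (h : ∀ P' r', P'.plug r' = s → UsefulRedex (E.comp P') r' → ¬P'.path < P.path) :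
    First E P s := by
  induction P generalizing E s with
  | hole =>
    subst hs
    rw [Ctx.comp_hole] at hu
    exact .here hu
  | lam P ih =>
    subst hs
    refine .lam (ih rfl (by rwa [Ctx.comp_assoc]) fun P' r' he hu' hlt => ?_)
    rw [Ctx.comp_assoc] at hu'
    exact h (.lam P') r' (congrArg Term.lam he) hu' (List.cons_lt_cons_iff.2 (.inr ⟨rfl, hlt⟩))
  | es P u ih =>
    subst hs
    refine .es (ih rfl (by rwa [Ctx.comp_assoc]) fun P' r' he hu' hlt => ?_)
    rw [Ctx.comp_assoc] at hu'
    exact h (.es P' u) r' (congrArg (Term.es · u) he) hu'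
      (List.cons_lt_cons_iff.2 (.inr ⟨rfl, hlt⟩))
  | appL P u ih =>
    subst hs
    refine .appL (isAns_eq_false_of_not_useful (E := E.comp .hole) (u := u)
      fun h' => h .hole _ rfl h' (List.nil_lt_cons _ _))
      (ih rfl (by rwa [Ctx.comp_assoc]) fun P' r' he hu' hlt => ?_)
    rw [Ctx.comp_assoc] at hu'
    exact h (.appL P' u) r' (congrArg (Term.app · u) he) hu'
      (List.cons_lt_cons_iff.2 (.inr ⟨rfl, hlt⟩))
  | appR t P ih =>
    subst hs
    refine .appR (isAns_eq_false_of_not_useful (E := E.comp .hole) (u := P.plug r)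
      fun h' => h .hole _ rfl h' (List.nil_lt_cons _ _)) (fun P' r' he hu' => ?_)
      (ih rfl (by rwa [Ctx.comp_assoc]) fun P' r' he hu' hlt => ?_)
    · rw [Ctx.comp_assoc] at hu'
      exact h (.appL P' _) r' (congrArg (Term.app · _) he) hu'
        (List.cons_lt_cons_iff.2 (.inl Nat.zero_lt_one))
    · rw [Ctx.comp_assoc] at hu'
      exact h (.appR t P') r' (congrArg (Term.app t) he) hu'
        (List.cons_lt_cons_iff.2 (.inr ⟨rfl, hlt⟩))

theorem LOU.first {t : Term} {E : Ctx} (h : LOU t E) : First .hole E t := by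
  obtain ⟨s, hs, hu, h⟩ := h
  refine first_of_path_min hs hu fun P' r' he hu' hlt => ?_
  exact lt_asymm hlt (h P' r' he hu' fun e => lt_irrefl _ (e ▸ hlt)).path_lt

theorem First.exists_useful {E P : Ctx} {s : Term} (h : First E P s) :
    ∃ r, P.plug r = s ∧ UsefulRedex (E.comp P) r := by
  induction h with
  | here h => exact ⟨_, rfl, by rwa [Ctx.comp_hole]⟩
  | lam _ ih =>
    obtain ⟨r, rfl, hr⟩ := ih
    exact ⟨r, rfl, by rwa [Ctx.comp_assoc] at hr⟩
  | es _ ih =>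
    obtain ⟨r, rfl, hr⟩ := ih
    exact ⟨r, rfl, by rwa [Ctx.comp_assoc] at hr⟩
  | appL _ _ ih =>
    obtain ⟨r, rfl, hr⟩ := ih
    exact ⟨r, rfl, by rwa [Ctx.comp_assoc] at hr⟩
  | appR _ _ _ ih =>
    obtain ⟨r, rfl, hr⟩ := ih
    exact ⟨r, rfl, by rwa [Ctx.comp_assoc] at hr⟩

theorem First.not_usefulNormal {E P : Ctx} {s : Term} (h : First E P s) : ¬UsefulNormal E s :=
  fun h' => let ⟨r, hr, hu⟩ := h.exists_useful; h' P r hr hu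

/-- The invariant of the derivations of the strategy from `t`: in the context `E`, only the parts
of `s` that lie to the right of normal parts are not intact. -/
inductive Reachable (t : Term) : Ctx → Term → Prop
  | intact {E : Ctx} {s : Term} : Term.Intact t E.depth s → Reachable t E s
  | lam {E : Ctx} {s : Term} : Reachable t (E.comp (.lam .hole)) s → Reachable t E (.lam s)
  | es {E : Ctx} {s u : Term} : Reachable t (E.comp (.es .hole u)) s → u.IsSubterm E.depth t →
      Reachable t E (.es s u)
  | appL {E : Ctx} {s u : Term} : Reachable t (E.comp (.appL .hole u)) s → s.isAns = false →
      u.IsSubterm E.depth t → Reachable t E (.app s u)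
  | appR {E : Ctx} {s u : Term} : UsefulNormal (E.comp (.appL .hole u)) s → s.isAns = false →
      Reachable t (E.comp (.appR s .hole)) u → Reachable t E (.app s u)

namespace Reachable

variable {t : Term} {E : Ctx} {s u : Term}

theorem of_lam (h : Reachable t E (.lam s)) : Reachable t (E.comp (.lam .hole)) s := by
  cases h with
  | intact h =>
    refine .intact ?_
    rw [Ctx.depth_comp]
    exact h
  | lam h => exact h

theorem of_es (h : Reachable t E (.es s u)) :
    Reachable t (E.comp (.es .hole u)) s ∧ u.IsSubterm E.depth t := by
  cases h with
  | intact h =>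
    refine ⟨.intact ?_, h.2⟩
    rw [Ctx.depth_comp]
    exact h.1
  | es h hu => exact ⟨h, hu⟩

/-- If the left part is normal, `appR` guarantees nothing about the argument; the hypothesis
excludes this case, and it holds whenever the first redex lies on the left. -/
theorem of_app_left (h : Reachable t E (.app s u))
    (hs : ¬UsefulNormal (E.comp (.appL .hole u)) s) :
    Reachable t (E.comp (.appL .hole u)) s ∧ u.IsSubterm E.depth t := by
  cases h with
  | intact h =>
    refine ⟨.intact ?_, h.2⟩
    rw [Ctx.depth_comp]
    exact h.1
  | appL h _ hu => exact ⟨h, hu⟩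
  | appR h => exact absurd h hs

theorem of_app_right (h : Reachable t E (.app s u)) : Reachable t (E.comp (.appR s .hole)) u := by
  have key : u.IsSubterm E.depth t → Reachable t (E.comp (.appR s .hole)) u := fun h => by
    refine .intact ?_
    rw [Ctx.depth_comp]
    exact h.intact
  cases h with
  | intact h => exact key h.2
  | appL _ _ hu => exact key hu
  | appR _ _ h => exact h

/-- The application clauses of the invariant ask for a left part that is not an answer. So a
`dB`-redex occurs only where everything is intact, and its argument may safely enter an explicit
substitution. -/
theorem intact_of_dB {L : SubCtx} {r : Term} (h : Reachable t E (.app (L.plug (.lam r)) u)) :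
    Term.Intact t E.depth (.app (L.plug (.lam r)) u) := by
  have hans : (L.plug (.lam r)).isAns = true := Term.isAns_iff.2 ⟨L, r, rfl⟩
  cases h with
  | intact h => exact h
  | appL _ h => rw [h] at hans; cases hans
  | appR _ h => rw [h] at hans; cases hans

/-- This yields the subterm property: the content duplicated by an `ls`-step is that of a
substitution on the path to the first redex. -/
theorem ctx_intact {P : Ctx} (h : Reachable t E s) (hP : First E P s) : P.Intact t E.depth := by
  induction hP with
  | here => trivial
  | lam hP ih =>
    have := ih h.of_lam
    rwa [Ctx.depth_comp] at this
  | es hP ih =>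
    have := ih h.of_es.1
    rw [Ctx.depth_comp] at this
    exact ⟨this, h.of_es.2⟩
  | appL _ hP ih =>
    have := ih (h.of_app_left hP.not_usefulNormal).1
    rwa [Ctx.depth_comp] at this
  | appR _ _ hP ih =>
    have := ih h.of_app_right
    rwa [Ctx.depth_comp] at this

/-- The invariant is preserved, and answers are created intact. -/
theorem contract {P : Ctx} {r r' : Term} (hP : First E P s) (h : Reachable t E s)
    (hE : (E.comp P).Intact t 0) (hs : P.plug r = s) (hr : Contract (E.comp P) r r') :
    Reachable t E (P.plug r') ∧
      (s.isAns = false → (P.plug r').isAns = true → Term.Intact t E.depth (P.plug r')) := by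
  induction hP with
  | @here E s hu =>
    rw [Ctx.comp_hole] at hr hE
    obtain rfl : r = s := hs
    suffices h' : Term.Intact t E.depth r' from ⟨.intact h', fun _ _ => h'⟩
    cases hr with
    | dB L q v => exact h.intact_of_dB.1.contract_dB h.intact_of_dB.2
    | ls D C v =>
      -- The copied content is a subterm of `t` by intactness of the surrounding context, and its
      -- shift lives at the depth of the position.
      have hv := (Ctx.intact_comp.1 hE).2.2
      have := (hv.shift (C.depth + 1)).intact
      rw [Ctx.depth_comp]
      rwa [Nat.zero_add] at this
  | lam hP ih =>
    rw [Ctx.comp_assoc] at ih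
    have := ih h.of_lam hE (Term.lam.inj hs) hr
    exact ⟨.lam this.1, fun h => by cases h⟩
  | @es E P s u hP ih =>
    rw [Ctx.comp_assoc] at ih
    have := ih h.of_es.1 hE (Term.es.inj hs).1 hr
    refine ⟨.es this.1 h.of_es.2, fun h1 h2 => ⟨?_, h.of_es.2⟩⟩
    have := this.2 h1 h2
    rwa [Ctx.depth_comp] at this
  | @appL E P s u ha hP ih =>
    rw [Ctx.comp_assoc] at ih
    obtain ⟨h1, hu⟩ := h.of_app_left hP.not_usefulNormal
    have := ih h1 hE (Term.app.inj hs).1 hr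
    refine ⟨?_, fun _ h => by cases h⟩
    -- If the left part has just become an answer, the application has turned into a `dB`-redex and
    -- must be wholly intact; the second half of the statement exists for this case.
    cases ha' : (P.plug r').isAns with
    | false => exact .appL this.1 ha' hu
    | true =>
      have := this.2 ha ha'
      rw [Ctx.depth_comp] at this
      exact .intact ⟨this, hu⟩
  | @appR E P s u ha hn hP ih =>
    rw [Ctx.comp_assoc] at ih
    have := ih h.of_app_right hE (Term.app.inj hs).2 hr
    -- The left part remains normal although its argument has changed.
    exact ⟨.appR (hn.change_arg _) ha this.1, fun _ h => by cases h⟩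

theorem ctx_intact_of_lou {v : Term} {P : Ctx} (h : Reachable t .hole v) (hP : LOU v P) :
    P.Intact t 0 := h.ctx_intact hP.first

theorem step {v v' : Term} (h : Reachable t .hole v) (hv : LOU.Step v v') :
    Reachable t .hole v' := by
  obtain ⟨E, s, s', hE, rfl, rfl, hc⟩ := hv
  exact (contract hE.first h (h.ctx_intact_of_lou hE) rfl hc).1

end Reachable

theorem subtermProperty_LOU : SubtermProperty LOU := by
  intro t u h D C r _ hX
  have hu : Reachable t .hole u :=
    h.rec (motive := fun v _ => Reachable t .hole v) (.intact t.isSubterm_refl.intact)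
      fun _ hs ih => ih.step hs
  have := (Ctx.intact_comp.1 (hu.ctx_intact_of_lou hX)).2.2
  rwa [Nat.zero_add] at this

end LSC

/-! ### Assembly of the results -/

theorem mainTheorem10 :
    -- the number of steps of each of the three algorithms is polynomial in the input size
    (∃ p : Polynomial ℕ, ∀ t : LSC.LTerm, (LSC.Ag t).steps ≤ p.eval t.size) ∧
    (∃ p : Polynomial ℕ, ∀ t : LSC.Term, (LSC.Bg t).steps ≤ p.eval t.size) ∧
    (∃ p : Polynomial ℕ, ∀ (t : LSC.Term) (C : LSC.Ctx),
      (LSC.Cg t C).steps ≤ p.eval (t.size + C.size)) ∧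
    -- the three algorithms are implemented by polynomial time Turing machines
    LSC.PolyTime LSC.lTermCode LSC.tupleCode (fun t => (LSC.Ag t).val) ∧
    LSC.PolyTime LSC.termCode LSC.tupleCode (fun t => (LSC.Bg t).val) ∧
    LSC.PolyTime (LSC.termCode.pair LSC.ctxCode) LSC.tupleCode
      (fun p => (LSC.Cg p.1 p.2).val) ∧
    -- usefulness of a redex is decidable in polynomial time
    LSC.PolyTime (LSC.ctxCode.pair LSC.termCode) LSC.boolCode LSC.usefulTest ∧
    -- LOU derivations have the selection property and are mechanisable
    LSC.SelectionProperty LSC.LOU ∧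
    LSC.Mechanisable LSC.LOU := by
  -- The polynomials are the number of constructors times `caseCost`, with an additional `X` per
  -- constructor of `Cg` for the indices.
  refine ⟨⟨.X * (40 * (.X + 1) ^ 2), fun t => ?_⟩, ⟨.X * (40 * (.X + 1) ^ 2), fun t => ?_⟩,
    ⟨.X * (40 * (.X + 1) ^ 2 + .X), fun t C => ?_⟩, LSC.polyTime_Ag, LSC.polyTime_Bg,
    LSC.polyTime_Cg, LSC.polyTime_usefulTest, LSC.selectionProperty_LOU,
    LSC.subtermProperty_LOU, LSC.selectionProperty_LOU⟩
  · simpa [LSC.caseCost] using LSC.Ag_steps t le_rfl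
  · simpa [LSC.caseCost] using LSC.Bg_steps t le_rfl
  · simpa [LSC.caseCost] using LSC.Cg_steps t C le_rfl
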